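/- For $p\ge 1$ let $\gamma_p$ denote the ground-state energy, i.e. the minimal eigenvalue, of the (an)harmonic oscillator $-\frac{d^2}{dt^2}+|t|^p$ on $L^2(\mathbb R)$ (the closure of this operator defined on $C_0^\infty(\mathbb R)$); this minimal eigenvalue exists. For $\lambda\ge 0$ let $L_p(\lambda)$ be the closure of the operator $$\psi\mapsto -\Delta\psi+\Bigl(|xy|^p-\lambda\,(x^2+y^2)^{p/(p+2)}\Bigr)\psi,\qquad \psi\in C_0^\infty(\mathbb R^2),$$ in the complex Hilbert space $L^2(\mathbb R^2)$. Then for every $p\ge 1$ and every $0\le\lambda<\gamma_p$ the operator $L_p(\lambda)$ is self-adjoint and bounded from below (so that its spectrum is contained in $[c,\infty)$ for some $c\in\mathbb R$), and its spectrum is purely discrete: every point of the spectrum is an isolated point of it and an eigenvalue of finite multiplicity. -/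

import Mathlib

open scoped ContDiff InnerProductSpace Laplacian

noncomputable section

namespace Schrodinger

/-! ### Spectral notions for unbounded operators -/

section Spectral

variable {H : Type*} [NormedAddCommGroup H] [InnerProductSpace ℂ H]

/-- The eigenspace `{f ∈ dom A : A f = z f}` of an unbounded operator `A`. -/
def eigenspace (A : H →ₗ.[ℂ] H) (z : ℂ) : Submodule ℂ H :=
  A.graph.comap (LinearMap.id.prod (z • LinearMap.id))

/-- `z` is an eigenvalue of `A`. -/
def IsEigenvalue (A : H →ₗ.[ℂ] H) (z : ℂ) : Prop :=
  eigenspace A z ≠ ⊥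

/-- The resolvent set: those `z` for which `A - z : dom A → H` has a two-sided inverse that is
a bounded operator on `H`. -/
def resolventSet (A : H →ₗ.[ℂ] H) : Set ℂ :=
  {z | ∃ R : H →L[ℂ] H,
    (∀ f : A.domain, R (A f - z • (f : H)) = f) ∧
    (∀ g : H, ∃ h : R g ∈ A.domain, A ⟨R g, h⟩ - z • R g = g)}

/-- The spectrum of an unbounded operator. -/
def spectrum (A : H →ₗ.[ℂ] H) : Set ℂ :=
  (resolventSet A)ᶜ

/-- The spectrum is purely discrete: it consists of isolated points, each of which is an
eigenvalue of finite multiplicity. -/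
def HasPurelyDiscreteSpectrum (A : H →ₗ.[ℂ] H) : Prop :=
  ∀ z ∈ spectrum A,
    ¬ AccPt z (Filter.principal (spectrum A)) ∧ IsEigenvalue A z ∧
      FiniteDimensional ℂ (eigenspace A z)

/-- `A` is bounded from below by `c`: `⟨f, A f⟩ ≥ c ‖f‖²` for all `f ∈ dom A`. -/
def IsBoundedBelowBy (A : H →ₗ.[ℂ] H) (c : ℝ) : Prop :=
  ∀ f : A.domain, c * ‖(f : H)‖ ^ 2 ≤ (inner ℂ (f : H) (A f)).re

end Spectral

/-! ### Schrödinger operators -/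

section Operators

variable {E : Type*} [NormedAddCommGroup E] [InnerProductSpace ℝ E] [FiniteDimensional ℝ E]
  [MeasurableSpace E] [BorelSpace E]

variable (E) in
/-- The complex Hilbert space `L²(E)` with respect to Lebesgue measure. -/
abbrev L2 : Type _ := MeasureTheory.Lp ℂ 2 (MeasureTheory.volume : MeasureTheory.Measure E)

/-- The differential expression `-Δψ + Vψ`. -/
def expr (V : E → ℝ) (ψ : E → ℂ) : E → ℂ :=
  fun x => -(Δ ψ) x + (V x : ℂ) * ψ x

/-- The graph of `ψ ↦ -Δψ + Vψ` on the smooth compactly supported functions `ψ : E → ℂ`. (If `V`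
is locally square integrable, in particular if it is continuous, then `-Δψ + Vψ` lies in `L²` for
every such `ψ`.) -/
def coreGraph (V : E → ℝ) : Submodule ℂ (L2 E × L2 E) where
  carrier := {q | ∃ ψ : E → ℂ, ContDiff ℝ ∞ ψ ∧ HasCompactSupport ψ ∧
    q.1 =ᵐ[MeasureTheory.volume] ψ ∧ q.2 =ᵐ[MeasureTheory.volume] expr V ψ}
  add_mem' := by
    rintro ⟨f, g⟩ ⟨f', g'⟩ ⟨ψ, hs, hc, h1, h2⟩ ⟨ψ', hs', hc', h1', h2'⟩
    refine ⟨ψ + ψ', hs.add hs', hc.add hc', ?_, ?_⟩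
    · exact (MeasureTheory.Lp.coeFn_add f f').trans (h1.add h1')
    · refine (MeasureTheory.Lp.coeFn_add g g').trans ((h2.add h2').trans (.of_eq ?_))
      funext x
      have := (hs.of_le (m := 2) (by norm_cast)).contDiffAt.laplacian_add (x := x)
        (hs'.of_le (m := 2) (by norm_cast)).contDiffAt
      simp only [expr, Pi.add_apply, this]
      ring
  zero_mem' := by
    refine ⟨0, contDiff_const, HasCompactSupport.zero, ?_, ?_⟩
    · exact MeasureTheory.Lp.coeFn_zero _ _ _
    · refine (MeasureTheory.Lp.coeFn_zero _ _ _).trans (.of_eq ?_)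
      funext x
      have : (Δ (0 : E → ℂ)) x = 0 := by
        exact congrFun (InnerProductSpace.laplacian_const (E := E) (c := (0 : ℂ))) x
      simp [expr, this]
  smul_mem' := by
    rintro c ⟨f, g⟩ ⟨ψ, hs, hc, h1, h2⟩
    refine ⟨c • ψ, contDiff_const.smul hs, hc.smul_left (f := fun _ => c), ?_, ?_⟩
    · exact (MeasureTheory.Lp.coeFn_smul c f).trans (h1.const_smul c)
    · refine (MeasureTheory.Lp.coeFn_smul c g).trans ((h2.const_smul c).trans (.of_eq ?_))
      funext x
      have := InnerProductSpace.laplacian_smul (x := x) c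
        (hs.of_le (m := 2) (by norm_cast)).contDiffAt
      simp only [expr, Pi.smul_apply, this, smul_eq_mul]
      ring

/-- `coreGraph V` is single-valued, that is, it is the graph of an operator. -/
theorem coreGraph_single (V : E → ℝ) :
    ∀ q ∈ coreGraph V, q.1 = 0 → q.2 = 0 := by
  rintro ⟨f, g⟩ ⟨ψ, hs, hc, h1, h2⟩ (rfl : f = 0)
  have h0 : ψ = 0 := by
    refine MeasureTheory.Measure.eq_of_ae_eq (h1.symm.trans (MeasureTheory.Lp.coeFn_zero _ _ _))
      hs.continuous continuous_zero
  subst h0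
  refine MeasureTheory.Lp.ext (h2.trans ((Filter.EventuallyEq.of_eq ?_).trans
    (MeasureTheory.Lp.coeFn_zero _ _ _).symm))
  funext x
  have : (Δ (0 : E → ℂ)) x = 0 := by
    exact congrFun (InnerProductSpace.laplacian_const (E := E) (c := (0 : ℂ))) x
  simp [expr, this]

/-- The operator `-Δ + V` on `L²(E)` with domain `C_c^∞(E)`. -/
def coreOperator (V : E → ℝ) : L2 E →ₗ.[ℂ] L2 E :=
  (coreGraph V).toLinearPMap

theorem coreOperator_graph (V : E → ℝ) : (coreOperator V).graph = coreGraph V :=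
  Submodule.toLinearPMap_graph_eq _ (coreGraph_single V)

/-- The Schrödinger operator `-Δ + V` on `L²(E)`: the closure of its restriction to
`C_c^∞(E)`. -/
def schrodinger (V : E → ℝ) : L2 E →ₗ.[ℂ] L2 E :=
  (coreOperator V).closure

end Operators

/-- The (an)harmonic oscillator `-d²/dt² + |t|^p` on `L²(ℝ)`. -/
def oscillator (p : ℝ) : L2 ℝ →ₗ.[ℂ] L2 ℝ :=
  schrodinger fun t : ℝ => |t| ^ p

/-- The ground-state energy `γ_p`: the lowest eigenvalue of `-d²/dt² + |t|^p`. -/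
def groundEnergy (p : ℝ) : ℝ :=
  sInf {μ : ℝ | IsEigenvalue (oscillator p) (μ : ℂ)}

/-- The operator `L_p(lam) = -Δ + |xy|^p - lam (x² + y²)^{p/(p+2)}` on `L²(ℝ²)`. -/
def L (p lam : ℝ) : L2 (EuclideanSpace ℝ (Fin 2)) →ₗ.[ℂ] L2 (EuclideanSpace ℝ (Fin 2)) :=
  schrodinger fun v => |v 0 * v 1| ^ p - lam * ((v 0) ^ 2 + (v 1) ^ 2) ^ (p / (p + 2))

end Schrodinger

end

/-! Everything reduces to one object: a bounded compact symmetric `R` inverse to `A + μ` with `A + μ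
≥ 1` (`IsCompactResolvent`). Given such an `R`, self-adjointness, the lower bound, the location of
the spectrum, its discreteness and the existence of a least eigenvalue are abstract consequences of
the Fredholm alternative for `R`.

Such an `R` exists for `-Δ + V`, `V` continuous, as soon as its form on test functions dominates
that of `-κΔ + W` with `κ > 0` and `W → ∞` (`exists_isCompactResolvent_schrodinger`). Two facts
enter. After a shift making the form at least the squared norm, a square integrable weak solution of
`(-Δ + V) u = 0` vanishes (`ae_eq_zero_of_weak_solution`): mollify `u`, multiply by a slowly varying
cutoff, and apply the form bound to the product; its energy consists of a commutator with `V`, small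
on the compact support of the cutoff, and of a gradient term of the cutoff. Hence the range of the
core operator is dense, which is essential self-adjointness, without any growth condition on `V`.
Secondly, up to an arbitrarily small multiple of the form, the norm is controlled by finitely many
functionals (`exists_functional_norm_sq_le`), which is a Rellich type compactness.

In one dimension this applies with `W = V = |t|^p`, so that `γ_p` is the least eigenvalue and the
form of the oscillator is at least `γ_p` times the squared norm. Scaling gives `-d²/dt² + |s t|^p ≥
γ_p |s|^{2p/(p+2)}`.

In the plane, apply this on each line orthogonal to an axis. The transversal energy in the channel
along the axis then compensates the attractive term `γ_p (x² + y²)^{p/(p+2)}` up to a constant. Away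
from both axes `|xy|^p` grows faster than the attractive term. An IMS localisation glues the two
channels and the remaining region together, so the form at the critical coupling `γ_p` is bounded
below (`exists_critical_energy_ge`). For `lam < γ_p`, the form of `L_p(lam)` dominates a convex
combination: a fraction `1 - ε` of the critical form, plus `ε` times the kinetic energy and a
positive multiple of `(x² + y²)^{p/(p+2)}`. The latter two are the confining comparison operator. -/

noncomputable section

namespace Schrodinger

/-! ### Spectral consequences of a compact resolvent. -/

section CompactResolvent

variable {H : Type*} [NormedAddCommGroup H] [InnerProductSpace ℂ H]

/-- `R` is a compact operator inverse to `A + μ`, and `A + μ ≥ 1`. -/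
structure IsCompactResolvent (A : H →ₗ.[ℂ] H) (μ : ℝ) (R : H →L[ℂ] H) : Prop where
  mem_graph_iff : ∀ f g : H, (f, g) ∈ A.graph ↔ R (g + (μ : ℂ) • f) = f
  compact : IsCompactOperator R
  symmetric : ∀ f g : H, inner ℂ (R f) g = inner ℂ f (R g)
  lower : ∀ g : H, ‖R g‖ ^ 2 ≤ (inner ℂ (R g) g).re

namespace IsCompactResolvent

variable {A : H →ₗ.[ℂ] H} {μ : ℝ} {R : H →L[ℂ] H}

theorem apply_mem_graph (h : IsCompactResolvent A μ R) (g : H) :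
    (R g, g - (μ : ℂ) • R g) ∈ A.graph := by
  rw [h.mem_graph_iff]; simp

theorem apply_mem_domain (h : IsCompactResolvent A μ R) (g : H) : R g ∈ A.domain :=
  LinearPMap.mem_domain_of_mem_graph (h.apply_mem_graph g)

theorem apply_coe (h : IsCompactResolvent A μ R) (f : A.domain) :
    R (A f + (μ : ℂ) • (f : H)) = f :=
  (h.mem_graph_iff _ _).1 (A.mem_graph f)

theorem map_apply (h : IsCompactResolvent A μ R) (g : H) (hg : R g ∈ A.domain) :
    A ⟨R g, hg⟩ = g - (μ : ℂ) • R g := by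
  have h1 := A.mem_graph ⟨R g, hg⟩
  exact A.mem_graph_snd_inj' h1 (h.apply_mem_graph g) rfl

theorem eq_zero_of_apply_eq_zero (h : IsCompactResolvent A μ R) {g : H} (hg : R g = 0) :
    g = 0 := by
  have h1 := h.apply_mem_graph g
  rw [hg] at h1
  simpa using A.graph_fst_eq_zero_snd h1 rfl

theorem mem_eigenspace_iff (h : IsCompactResolvent A μ R) (z : ℂ) (f : H) :
    f ∈ eigenspace A z ↔ (z + μ) • R f = f := by
  rw [eigenspace, Submodule.mem_comap]
  change (f, z • f) ∈ A.graph ↔ _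
  rw [h.mem_graph_iff, ← add_smul, map_smul]

/-- `A f = z f` amounts to `f = (z + μ) R f`, so eigenvalues of `A` correspond to nonzero
eigenvalues of the compact operator `R` under `z ↦ (z + μ)⁻¹`. -/
theorem eigenspace_eq (h : IsCompactResolvent A μ R) {z : ℂ} (hz : z + μ ≠ 0) :
    eigenspace A z = Module.End.eigenspace (R : H →ₗ[ℂ] H) (z + μ)⁻¹ := by
  ext f
  rw [h.mem_eigenspace_iff, Module.End.mem_eigenspace_iff]
  change _ ↔ R f = _
  rw [eq_inv_smul_iff₀ hz]

theorem isEigenvalue_iff (h : IsCompactResolvent A μ R) {z : ℂ} (hz : z + μ ≠ 0) :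
    IsEigenvalue A z ↔ Module.End.HasEigenvalue (R : H →ₗ[ℂ] H) (z + μ)⁻¹ := by
  rw [IsEigenvalue, h.eigenspace_eq hz, Module.End.hasEigenvalue_iff]

/-- At `z = -μ` the equation `(z + μ) R f = f` forces `f = 0`. This licenses the inversion of `z +
μ`. -/
theorem add_ne_zero_of_isEigenvalue (h : IsCompactResolvent A μ R) {z : ℂ}
    (hz : IsEigenvalue A z) : z + μ ≠ 0 := by
  intro h0
  obtain ⟨f, hf, hf0⟩ := Submodule.exists_mem_ne_zero_of_ne_bot hz
  rw [h.mem_eigenspace_iff, h0, zero_smul] at hf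
  exact hf0 hf.symm

theorem inner_add_smul (h : IsCompactResolvent A μ R) (f : A.domain) :
    ‖(f : H)‖ ^ 2 ≤ (inner ℂ (f : H) (A f + (μ : ℂ) • (f : H))).re := by
  have := h.lower (A f + (μ : ℂ) • (f : H))
  rwa [h.apply_coe] at this

theorem re_inner_add_smul (A : H →ₗ.[ℂ] H) (μ : ℝ) (f : A.domain) :
    (inner ℂ (f : H) (A f + (μ : ℂ) • (f : H))).re
      = (inner ℂ (f : H) (A f)).re + μ * ‖(f : H)‖ ^ 2 := by
  rw [inner_add_right, inner_smul_right, inner_self_eq_norm_sq_to_K]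
  rw [Complex.add_re, Complex.re_ofReal_mul]
  norm_cast

theorem isBoundedBelowBy (h : IsCompactResolvent A μ R) : IsBoundedBelowBy A (1 - μ) := by
  intro f
  have := h.inner_add_smul f
  rw [re_inner_add_smul] at this
  linarith

theorem inner_map_eq (h : IsCompactResolvent A μ R) (f g : A.domain) :
    inner ℂ (A f) (g : H) = inner ℂ (f : H) (A g) := by
  have := h.symmetric (A f + (μ : ℂ) • (f : H)) (A g + (μ : ℂ) • (g : H))
  rw [h.apply_coe, h.apply_coe, inner_add_left, inner_add_right, inner_smul_left,
    inner_smul_right, Complex.conj_ofReal] at this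
  exact (add_right_cancel this).symm

theorem eigenvalue_real (h : IsCompactResolvent A μ R) {z : ℂ} (hz : IsEigenvalue A z) :
    z.im = 0 ∧ 1 - μ ≤ z.re := by
  obtain ⟨f, hf, hf0⟩ := Submodule.exists_mem_ne_zero_of_ne_bot hz
  rw [eigenspace, Submodule.mem_comap] at hf
  change (f, z • f) ∈ A.graph at hf
  rw [LinearPMap.mem_graph_iff] at hf
  obtain ⟨y, hy, hAy⟩ := hf
  dsimp only at hy hAy
  subst hy
  have hpos : 0 < ‖(y : H)‖ ^ 2 := by positivity
  have hb := h.isBoundedBelowBy y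
  have hs := h.inner_map_eq y y
  rw [hAy, inner_smul_left, inner_smul_right, inner_self_eq_norm_sq_to_K] at hs
  rw [hAy, inner_smul_right, inner_self_eq_norm_sq_to_K] at hb
  have hne : ((‖(y : H)‖ : ℂ)) ^ 2 ≠ 0 := by exact_mod_cast hpos.ne'
  have hc := mul_right_cancel₀ hne hs
  refine ⟨Complex.conj_eq_iff_im.1 hc, ?_⟩
  have : (z * (‖(y : H)‖ : ℂ) ^ 2).re = z.re * ‖(y : H)‖ ^ 2 := by
    rw [← Complex.ofReal_pow, Complex.re_mul_ofReal]
  erw [this] at hb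
  exact le_of_mul_le_mul_right hb hpos

variable [CompleteSpace H]

/-- Since `R` is symmetric, a vector orthogonal to its range lies in its kernel, and the kernel is
trivial because the graph of `A` is single-valued. -/
theorem dense_domain (h : IsCompactResolvent A μ R) : Dense (A.domain : Set H) := by
  rw [Submodule.dense_iff_topologicalClosure_eq_top, Submodule.topologicalClosure_eq_top_iff,
    Submodule.eq_bot_iff]
  intro u hu
  apply h.eq_zero_of_apply_eq_zero
  rw [← inner_self_eq_zero (𝕜 := ℂ), h.symmetric]
  exact (Submodule.mem_orthogonal' _ _).1 hu _ (h.apply_mem_domain _)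

/-- Symmetry gives one inclusion. For the other, testing `(u, v)` in the graph of the adjoint
against the vectors `R g` yields `R (v + μ u) = u`, which places `u` in the domain of `A`. -/
theorem isSelfAdjoint (h : IsCompactResolvent A μ R) : IsSelfAdjoint A := by
  rw [LinearPMap.isSelfAdjoint_def]
  have hd := h.dense_domain
  refine le_antisymm ?_ (LinearPMap.IsFormalAdjoint.le_adjoint hd fun f g => h.inner_map_eq f g)
  apply LinearPMap.le_of_le_graph
  rintro ⟨u, v⟩ huv
  rw [LinearPMap.mem_graph_iff] at huv
  obtain ⟨y, hy, hv⟩ := huv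
  dsimp only at hy hv
  have hfa := LinearPMap.adjoint_isFormalAdjoint hd y
  rw [h.mem_graph_iff]
  refine ext_inner_right ℂ fun g => ?_
  have h1 := hfa ⟨R g, h.apply_mem_domain g⟩
  rw [h.map_apply, hv, hy, inner_sub_right, inner_smul_right] at h1
  rw [h.symmetric, inner_add_left, inner_smul_left, Complex.conj_ofReal]
  dsimp only at h1
  rw [h1]; ring

/-- Fredholm alternative. With `w = z + μ` one has `A - z = (1 - w R)(A + μ)`, so the resolvent is
`R (1 - w R)⁻¹`; below, `U = w⁻¹ - R`. For `w = 0` the resolvent is `R` itself. -/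
theorem mem_resolventSet_of_not_isEigenvalue (h : IsCompactResolvent A μ R) {z : ℂ}
    (hz : ¬ IsEigenvalue A z) : z ∈ resolventSet A := by
  by_cases h0 : z + μ = 0
  · have hz' : z = -(μ : ℂ) := eq_neg_of_add_eq_zero_left h0
    subst hz'
    refine ⟨R, fun f => ?_, fun g => ⟨h.apply_mem_domain g, ?_⟩⟩
    · rw [neg_smul, sub_neg_eq_add, h.apply_coe]
    · rw [h.map_apply]; simp
  · rw [h.isEigenvalue_iff h0] at hz
    have hr := (h.compact.hasEigenvalue_or_mem_resolventSet (inv_ne_zero h0)).resolve_left hz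
    rw [_root_.spectrum.mem_resolventSet_iff] at hr
    obtain ⟨U, hU⟩ := hr
    set w := z + μ with hw
    have hU1 : ∀ g, (↑U : H →L[ℂ] H) ((↑U⁻¹ : H →L[ℂ] H) g) = g := fun g => by
      rw [← mul_apply_eq_comp]; simp
    have hU2 : ∀ g, (↑U⁻¹ : H →L[ℂ] H) ((↑U : H →L[ℂ] H) g) = g := fun g => by
      rw [← mul_apply_eq_comp]; simp
    have hUa : ∀ g, (↑U : H →L[ℂ] H) g = w⁻¹ • g - R g := fun g => by
      rw [hU]; simp [Algebra.algebraMap_eq_smul_one]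
    have hcomm : ∀ g, R ((↑U⁻¹ : H →L[ℂ] H) g) = (↑U⁻¹ : H →L[ℂ] H) (R g) := fun g => by
      have : (↑U : H →L[ℂ] H) (R ((↑U⁻¹ : H →L[ℂ] H) g)) = R g := by
        conv_rhs => rw [← hU1 g]
        rw [hUa, hUa, map_sub, map_smul]
      rw [← this, hU2]
    refine ⟨R * (w⁻¹ • (↑U⁻¹ : H →L[ℂ] H)), fun f => ?_, fun g => ?_⟩
    · have h1 := h.apply_coe f
      have h2 : R (A f - z • (f : H)) = w • (↑U : H →L[ℂ] H) f := by
        have : A f - z • (f : H) = (A f + (μ : ℂ) • (f : H)) - w • (f : H) := by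
          rw [hw, add_smul]; abel
        rw [this, map_sub, h1, hUa, map_smul, smul_sub, smul_inv_smul₀ h0]
      change R (w⁻¹ • (↑U⁻¹ : H →L[ℂ] H) _) = _
      rw [map_smul, hcomm, h2, map_smul, hU2, inv_smul_smul₀ h0]
    · refine ⟨h.apply_mem_domain (w⁻¹ • (↑U⁻¹ : H →L[ℂ] H) g), ?_⟩
      change A ⟨R (w⁻¹ • (↑U⁻¹ : H →L[ℂ] H) g), _⟩
        - z • R (w⁻¹ • (↑U⁻¹ : H →L[ℂ] H) g) = g
      rw [h.map_apply, sub_sub, ← add_smul, add_comm (μ : ℂ), ← hw]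
      rw [map_smul, smul_inv_smul₀ h0, ← hUa, hU1]

theorem isEigenvalue_of_mem_spectrum (h : IsCompactResolvent A μ R) {z : ℂ}
    (hz : z ∈ spectrum A) : IsEigenvalue A z := by
  by_contra hn
  exact hz (h.mem_resolventSet_of_not_isEigenvalue hn)

theorem spectrum_subset (h : IsCompactResolvent A μ R) :
    spectrum A ⊆ (fun x : ℝ => (x : ℂ)) '' Set.Ici (1 - μ) := by
  intro z hz
  have := h.eigenvalue_real (h.isEigenvalue_of_mem_spectrum hz)
  exact ⟨z.re, this.2, Complex.ext rfl (by simp [this.1])⟩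

/-- An accumulation point would give infinitely many eigenvalues in a unit ball. Their normalised
eigenvectors are orthogonal, and `R` maps them to orthogonal vectors of norm at least `M⁻¹`, because
`M` bounds `|w + μ|` on the ball. These images are uniformly separated, contradicting compactness of
`R`. -/
theorem not_accPt (h : IsCompactResolvent A μ R) (z : ℂ) :
    ¬ AccPt z (Filter.principal (spectrum A)) := by
  intro hacc
  set M : ℝ := ‖z‖ + 1 + |μ|
  have hinf : (spectrum A ∩ Metric.ball z 1).Infinite := by
    rw [accPt_iff_nhds] at hacc
    by_contra hfin
    rw [Set.not_infinite] at hfin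
    have hfin' : ((spectrum A ∩ Metric.ball z 1) \ {z}).Finite := hfin.subset Set.sdiff_subset
    have : ((spectrum A ∩ Metric.ball z 1) \ {z})ᶜ ∩ Metric.ball z 1 ∈ nhds z :=
      Filter.inter_mem (hfin'.isClosed.isOpen_compl.mem_nhds (by simp))
        (Metric.ball_mem_nhds z one_pos)
    obtain ⟨y, ⟨hy1, hy2⟩, hy3⟩ := hacc _ this
    exact hy1.1 ⟨⟨hy2, hy1.2⟩, hy3⟩
  have hx : ∀ w : ↥(spectrum A ∩ Metric.ball z 1),
      ∃ e : H, ‖e‖ = 1 ∧ ((w : ℂ) + μ) • R e = e := by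
    rintro ⟨w, hw, -⟩
    obtain ⟨f, hf, hf0⟩ := Submodule.exists_mem_ne_zero_of_ne_bot
      (h.isEigenvalue_of_mem_spectrum hw)
    refine ⟨((‖f‖⁻¹ : ℝ) : ℂ) • f, ?_, ?_⟩
    · rw [norm_smul]; simp [hf0]
    · rw [← h.mem_eigenspace_iff]; exact Submodule.smul_mem _ _ hf
  choose e he1 he2 using hx
  have hne : ∀ w : ↥(spectrum A ∩ Metric.ball z 1), ((w : ℂ) + μ) ≠ 0 := fun w h0 => by
    have := he2 w
    rw [h0, zero_smul] at this
    have h1 := he1 w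
    rw [← this] at h1
    simp at h1
  have hR : ∀ w, R (e w) = ((w : ℂ) + μ)⁻¹ • e w := fun w => by
    rw [eq_inv_smul_iff₀ (hne w), he2]
  have him : ∀ w : ↥(spectrum A ∩ Metric.ball z 1), (w : ℂ).im = 0 := fun w =>
    (h.eigenvalue_real (h.isEigenvalue_of_mem_spectrum w.2.1)).1
  have hconj : ∀ w : ↥(spectrum A ∩ Metric.ball z 1), (starRingEnd ℂ) ((w : ℂ) + μ)⁻¹
      = ((w : ℂ) + μ)⁻¹ := fun w => by
    rw [map_inv₀, map_add, Complex.conj_ofReal, Complex.conj_eq_iff_im.2 (him w)]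
  have horth : ∀ w w', w ≠ w' → inner ℂ (e w) (e w') = 0 := fun w w' hww => by
    have h1 := h.symmetric (e w) (e w')
    rw [hR, hR, inner_smul_left, inner_smul_right, hconj] at h1
    by_contra h0
    have h2 := mul_right_cancel₀ h0 h1
    rw [inv_inj] at h2
    exact hww (Subtype.ext (add_right_cancel h2))
  have hMpos : 0 < M := by positivity
  have hlow : ∀ w, M⁻¹ ≤ ‖R (e w)‖ := fun w => by
    rw [hR, norm_smul, he1, mul_one, norm_inv]
    apply inv_anti₀ (norm_pos_iff.2 (hne w))
    have h1 : ‖(w : ℂ) - z‖ < 1 := by simpa [dist_eq_norm] using w.2.2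
    calc ‖(w : ℂ) + μ‖ = ‖((w : ℂ) - z) + z + μ‖ := by ring_nf
      _ ≤ ‖(w : ℂ) - z‖ + ‖z‖ + ‖(μ : ℂ)‖ := norm_add₃_le
      _ ≤ M := by
        rw [Complex.norm_real, Real.norm_eq_abs]; simp only [M]; linarith
  have hdist : ∀ w w', w ≠ w' → M⁻¹ ≤ dist (R (e w)) (R (e w')) := fun w w' hww => by
    rw [dist_eq_norm]
    have h0 : inner ℂ (R (e w)) (R (e w')) = 0 := by
      rw [hR, hR, inner_smul_left, inner_smul_right, horth w w' hww]; simp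
    have h1 : ‖R (e w) - R (e w')‖ ^ 2 = ‖R (e w)‖ ^ 2 + ‖R (e w')‖ ^ 2 := by
      rw [@norm_sub_sq ℂ, h0]; simp
    refine (hlow w).trans (le_of_sq_le_sq ?_ (norm_nonneg _))
    rw [h1]; nlinarith [sq_nonneg ‖R (e w')‖]
  have : Infinite ↥(spectrum A ∩ Metric.ball z 1) := hinf.to_subtype
  let s : ℕ ↪ ↥(spectrum A ∩ Metric.ball z 1) := Infinite.natEmbedding _
  obtain ⟨K, hK, hsub⟩ := IsCompactOperator.image_closedBall_subset_compact
    (f := (R : H →ₗ[ℂ] H)) h.compact 1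
  have hmem : ∀ n, R (e (s n)) ∈ K := fun n => hsub ⟨e (s n), by simp [he1], rfl⟩
  obtain ⟨a, -, φ, hφ, hlim⟩ := hK.tendsto_subseq hmem
  have hc := hlim.cauchySeq
  rw [Metric.cauchySeq_iff] at hc
  obtain ⟨N, hN⟩ := hc M⁻¹ (by positivity)
  have := hN N le_rfl (N + 1) (by omega)
  refine absurd this (not_lt.2 (hdist _ _ fun heq => ?_))
  have := hφ.injective (s.injective heq)
  omega

theorem hasPurelyDiscreteSpectrum (h : IsCompactResolvent A μ R) :
    HasPurelyDiscreteSpectrum A := by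
  intro z hz
  have he := h.isEigenvalue_of_mem_spectrum hz
  have h0 := h.add_ne_zero_of_isEigenvalue he
  refine ⟨h.not_accPt z, he, ?_⟩
  rw [h.eigenspace_eq h0]
  exact ContinuousLinearMap.finite_dimensional_eigenspace h.compact _ (inv_ne_zero h0)

/-- The least eigenvalue exists, equals `‖R‖⁻¹ - μ`, and is a lower bound of the operator. -/
theorem isLeast_eigenvalue [Nontrivial H] (h : IsCompactResolvent A μ R) :
    IsLeast {ν : ℝ | IsEigenvalue A (ν : ℂ)} (‖R‖⁻¹ - μ) ∧
      IsBoundedBelowBy A (‖R‖⁻¹ - μ) := by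
  have hR0 : R ≠ 0 := by
    rintro rfl
    obtain ⟨x, hx⟩ := exists_ne (0 : H)
    exact hx (h.eq_zero_of_apply_eq_zero (by simp))
  have hRpos : 0 < ‖R‖ := norm_pos_iff.2 hR0
  have hsa : IsSelfAdjoint R :=
    ContinuousLinearMap.isSelfAdjoint_iff_isSymmetric.2 fun f g => h.symmetric f g
  have hbound : ∀ ν : ℝ, IsEigenvalue A (ν : ℂ) → ‖R‖⁻¹ - μ ≤ ν := by
    intro ν hν
    have hre := (h.eigenvalue_real hν).2
    rw [Complex.ofReal_re] at hre
    obtain ⟨f, hf, hf0⟩ := Submodule.exists_mem_ne_zero_of_ne_bot hν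
    rw [h.mem_eigenspace_iff, ← Complex.ofReal_add] at hf
    have h1 : ‖f‖ ≤ (ν + μ) * (‖R‖ * ‖f‖) := by
      conv_lhs => rw [← hf]
      rw [norm_smul, Complex.norm_real, Real.norm_eq_abs, abs_of_pos (by linarith)]
      exact mul_le_mul_of_nonneg_left (R.le_opNorm f) (by linarith)
    have hfp : 0 < ‖f‖ := norm_pos_iff.2 hf0
    have h2 : 1 ≤ (ν + μ) * ‖R‖ := by
      refine le_of_mul_le_mul_right ?_ hfp
      linarith
    have : ‖R‖⁻¹ ≤ ν + μ := by
      rw [inv_le_iff_one_le_mul₀ hRpos]; exact h2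
    linarith
  refine ⟨⟨?_, fun ν hν => hbound ν hν⟩, ?_⟩
  -- For self-adjoint `R` the spectral radius is the norm, so some spectral value `k` has modulus
  -- `‖R‖`. The eigenvalue `k⁻¹ - μ` of `A` is real and at least `1 - μ`, hence `k` is positive and
  -- equals `‖R‖`.
  · obtain ⟨k, hk, hkn⟩ := _root_.spectrum.exists_nnnorm_eq_spectralRadius R
    rw [R.spectralRadius_eq_nnnorm hsa, ENNReal.coe_inj] at hkn
    have hkn' : ‖k‖ = ‖R‖ := congrArg NNReal.toReal hkn
    have hk0 : k ≠ 0 := by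
      rw [← norm_pos_iff, hkn']; exact hRpos
    have hev := (h.compact.hasEigenvalue_iff_mem_spectrum hk0).2 hk
    set z : ℂ := k⁻¹ - μ with hz
    have hzμ : z + μ = k⁻¹ := by rw [hz]; ring
    have hzev : IsEigenvalue A z := by
      rw [h.isEigenvalue_iff (by rw [hzμ]; exact inv_ne_zero hk0), hzμ, inv_inv]; exact hev
    obtain ⟨him, hre⟩ := h.eigenvalue_real hzev
    have hkk : k⁻¹ = ((z.re + μ : ℝ) : ℂ) := by
      rw [← hzμ]; apply Complex.ext <;> simp [him]
    have hn : ‖R‖⁻¹ = z.re + μ := by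
      rw [← hkn', ← norm_inv, hkk, Complex.norm_real, Real.norm_eq_abs, abs_of_pos (by linarith)]
    change IsEigenvalue A _
    have : ((‖R‖⁻¹ - μ : ℝ) : ℂ) = z := by
      rw [hn]; apply Complex.ext <;> simp [him]
    rwa [this]
  · intro f
    have key : ∀ g : H, ‖R‖⁻¹ * ‖R g‖ ^ 2 ≤ (inner ℂ (R g) g).re := by
      intro g
      set t : ℝ := ‖R‖⁻¹ with ht
      -- Positivity of `R` at `g - t R g`, with `t = ‖R‖⁻¹`: the quadratic term in the expansion is
      -- at most `t ‖R g‖²`, which cancels half of the cross term.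
      have hp := (sq_nonneg _).trans (h.lower (g - (t : ℂ) • R g))
      have hexp : (inner ℂ (R (g - (t : ℂ) • R g)) (g - (t : ℂ) • R g)).re
          = (inner ℂ (R g) g).re - 2 * t * ‖R g‖ ^ 2 + t ^ 2 * (inner ℂ (R (R g)) (R g)).re := by
        rw [map_sub, map_smul, inner_sub_left, inner_sub_right, inner_sub_right, inner_smul_left,
          inner_smul_left, inner_smul_right, inner_smul_right, Complex.conj_ofReal,
          h.symmetric (R g) g]
        simp only [Complex.sub_re, Complex.re_ofReal_mul]
        have hsq : (inner ℂ (R g) (R g)).re = ‖R g‖ ^ 2 := inner_self_eq_norm_sq (𝕜 := ℂ) (R g)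
        rw [hsq]
        ring
      rw [hexp] at hp
      have hle : (inner ℂ (R (R g)) (R g)).re ≤ ‖R‖ * ‖R g‖ ^ 2 := by
        refine (Complex.re_le_norm _).trans ((norm_inner_le_norm _ _).trans ?_)
        have := R.le_opNorm (R g)
        nlinarith [norm_nonneg (R g)]
      have htR : t * ‖R‖ = 1 := inv_mul_cancel₀ hRpos.ne'
      have h3 : t ^ 2 * (inner ℂ (R (R g)) (R g)).re ≤ t * ‖R g‖ ^ 2 := by
        calc _ ≤ t ^ 2 * (‖R‖ * ‖R g‖ ^ 2) := by gcongr
          _ = (t * ‖R‖) * t * ‖R g‖ ^ 2 := by ring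
          _ = _ := by rw [htR, one_mul]
      linarith
    have := key (A f + (μ : ℂ) • (f : H))
    rw [h.apply_coe, re_inner_add_smul] at this
    linarith

end IsCompactResolvent

end CompactResolvent

/-! ### From a semibounded symmetric core to a compact resolvent of the closure. -/

section Closure

variable {H : Type*} [NormedAddCommGroup H] [InnerProductSpace ℂ H]

/-- The adjoint of a densely defined symmetric operator is a closed extension of it. -/
theorem isClosable_of_symmetric [CompleteSpace H] {A : H →ₗ.[ℂ] H} (hd : Dense (A.domain : Set H))
    (hs : ∀ f g : A.domain, inner ℂ (A f) (g : H) = inner ℂ (f : H) (A g)) : A.IsClosable :=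
  (LinearPMap.adjoint_isClosed hd).isClosable.leIsClosable
    (LinearPMap.IsFormalAdjoint.le_adjoint hd fun f g => hs f g)

/-- This is how symmetry, the lower bound and the compactness estimate pass from the core to the
closure: each is a closed condition on the pair. -/
theorem closure_graph_induction {A : H →ₗ.[ℂ] H} (hA : A.IsClosable) {P : H × H → Prop}
    (hP : IsClosed {q | P q}) (h : ∀ f : A.domain, P ((f : H), A f)) :
    ∀ q ∈ A.closure.graph, P q := by
  intro q hq
  rw [← hA.graph_closure_eq_closure_graph] at hq
  have hsub : (A.graph : Set (H × H)) ⊆ {q | P q} := by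
    rintro ⟨a, b⟩ hab
    obtain ⟨y, hy, hAy⟩ := (LinearPMap.mem_graph_iff A).1 hab
    dsimp only at hy hAy
    rw [← hy, ← hAy]; exact h y
  exact closure_minimal hsub hP hq

/-- A symmetric operator `A` with `A + μ ≥ 1` such that `A + μ` has dense range and the form ball of
`A + μ` is precompact has a closure with compact resolvent. -/
theorem exists_isCompactResolvent [CompleteSpace H] {A : H →ₗ.[ℂ] H} {μ : ℝ} (hd : Dense (A.domain : Set H))
    (hs : ∀ f g : A.domain, inner ℂ (A f) (g : H) = inner ℂ (f : H) (A g))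
    (hl : ∀ f : A.domain, ‖(f : H)‖ ^ 2 ≤ (inner ℂ (f : H) (A f + (μ : ℂ) • (f : H))).re)
    (hr : ∀ u : H, (∀ f : A.domain, inner ℂ u (A f + (μ : ℂ) • (f : H)) = 0) → u = 0)
    (hc : ∀ ε > 0, ∃ (N : ℕ) (T : H →L[ℂ] (Fin N → ℂ)), ∀ f : A.domain,
      ‖(f : H)‖ ^ 2 ≤ ε * (inner ℂ (f : H) (A f + (μ : ℂ) • (f : H))).re + ‖T f‖ ^ 2) :
    ∃ R : H →L[ℂ] H, IsCompactResolvent A.closure μ R := by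
  have hA := isClosable_of_symmetric hd hs
  have hl' : ∀ q ∈ A.closure.graph, ‖q.1‖ ^ 2 ≤ (inner ℂ q.1 (q.2 + (μ : ℂ) • q.1)).re := by
    refine closure_graph_induction hA ?_ hl
    refine isClosed_le (by fun_prop) ?_
    exact Complex.continuous_re.comp (by fun_prop)
  have hs' : ∀ q ∈ A.closure.graph, ∀ r ∈ A.closure.graph, inner ℂ q.2 r.1 = inner ℂ q.1 r.2 := by
    refine closure_graph_induction hA ?_ fun f => ?_
    · have : {q : H × H | ∀ r ∈ A.closure.graph, inner ℂ q.2 r.1 = inner ℂ q.1 r.2}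
          = ⋂ r ∈ A.closure.graph, {q : H × H | inner ℂ q.2 r.1 = inner ℂ q.1 r.2} := by
        ext q; simp
      rw [this]
      exact isClosed_biInter fun r _ => isClosed_eq (by fun_prop) (by fun_prop)
    · exact closure_graph_induction hA (isClosed_eq (by fun_prop) (by fun_prop)) fun g => hs f g
  -- Cauchy–Schwarz turns the form bound into a norm bound, which yields closed range, uniqueness of
  -- the preimage and `‖R‖ ≤ 1`.
  have hle : ∀ q ∈ A.closure.graph, ‖q.1‖ ≤ ‖q.2 + (μ : ℂ) • q.1‖ := by
    intro q hq
    have h1 := hl' q hq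
    have h2 : (inner ℂ q.1 (q.2 + (μ : ℂ) • q.1)).re ≤ ‖q.1‖ * ‖q.2 + (μ : ℂ) • q.1‖ :=
      (Complex.re_le_norm _).trans (norm_inner_le_norm _ _)
    rcases (norm_nonneg q.1).eq_or_lt with h0 | h0
    · rw [← h0]; exact norm_nonneg _
    · refine le_of_mul_le_mul_left ?_ h0
      nlinarith
  let S : Submodule ℂ H := LinearMap.range (A.toFun + (μ : ℂ) • A.domain.subtype)
  have hSd : Dense (S : Set H) := by
    rw [Submodule.dense_iff_topologicalClosure_eq_top, Submodule.topologicalClosure_eq_top_iff,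
      Submodule.eq_bot_iff]
    intro u hu
    exact hr u fun f => (Submodule.mem_orthogonal' _ _).1 hu _ ⟨f, rfl⟩
  -- The range of `A + μ` is dense, and by `hle` the preimages of a convergent sequence are Cauchy,
  -- so the closure of `A` plus `μ` is onto.
  have hex : ∀ g : H, ∃ f : H, (f, g - (μ : ℂ) • f) ∈ A.closure.graph := by
    intro g
    obtain ⟨s, hsS, hlim⟩ := mem_closure_iff_seq_limit.1 (hSd g)
    choose f hf using hsS
    have hf' : ∀ n, A (f n) + (μ : ℂ) • (f n : H) = s n := hf
    have hmem : ∀ n, ((f n : H), A (f n)) ∈ A.closure.graph := fun n =>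
      LinearPMap.le_graph_of_le A.le_closure (A.mem_graph (f n))
    have hcs : CauchySeq fun n => (f n : H) := by
      have hsc := hlim.cauchySeq
      rw [Metric.cauchySeq_iff] at hsc ⊢
      intro ε hε
      obtain ⟨N, hN⟩ := hsc ε hε
      refine ⟨N, fun m hm n hn => lt_of_le_of_lt ?_ (hN m hm n hn)⟩
      rw [dist_eq_norm, dist_eq_norm]
      have := hle _ (Submodule.sub_mem _ (hmem m) (hmem n))
      refine this.trans_eq (congrArg norm ?_)
      rw [← hf', ← hf']
      simp only [Prod.fst_sub, Prod.snd_sub, smul_sub]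
      abel
    obtain ⟨a, ha⟩ := cauchySeq_tendsto_of_complete hcs
    refine ⟨a, ?_⟩
    refine (hA.closure_isClosed).mem_of_tendsto
      (f := fun n => ((f n : H), s n - (μ : ℂ) • (f n : H))) (b := Filter.atTop)
      (ha.prodMk_nhds (hlim.sub (ha.const_smul _))) (Filter.Eventually.of_forall fun n => ?_)
    have : s n - (μ : ℂ) • (f n : H) = A (f n) := by rw [← hf']; abel
    change ((f n : H), s n - (μ : ℂ) • (f n : H)) ∈ A.closure.graph
    rw [this]; exact hmem n
  have huniq : ∀ f g f' : H, (f, g - (μ : ℂ) • f) ∈ A.closure.graph →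
      (f', g - (μ : ℂ) • f') ∈ A.closure.graph → f = f' := by
    intro f g f' h1 h2
    have := hle _ (Submodule.sub_mem _ h1 h2)
    have h0 : (((f, g - (μ : ℂ) • f) - (f', g - (μ : ℂ) • f')).2
        + (μ : ℂ) • ((f, g - (μ : ℂ) • f) - (f', g - (μ : ℂ) • f')).1) = 0 := by
      simp only [Prod.fst_sub, Prod.snd_sub, smul_sub]; abel
    rw [h0, norm_zero] at this
    exact sub_eq_zero.1 (norm_le_zero_iff.1 this)
  choose r hrg using hex
  have hrn : ∀ g, ‖r g‖ ≤ ‖g‖ := fun g => by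
    have := hle _ (hrg g)
    simpa using this
  let R₀ : H →ₗ[ℂ] H :=
    { toFun := r
      map_add' := fun g g' => by
        refine huniq _ (g + g') _ (hrg _) ?_
        have := Submodule.add_mem _ (hrg g) (hrg g')
        convert this using 1
        simp only [Prod.mk_add_mk, smul_add]
        congr 1; abel
      map_smul' := fun c g => by
        refine huniq _ (c • g) _ (hrg _) ?_
        have := Submodule.smul_mem _ c (hrg g)
        convert this using 1
        simp only [Prod.smul_mk, smul_sub, RingHom.id_apply]
        rw [smul_comm] }
  let R : H →L[ℂ] H := R₀.mkContinuous 1 fun g => by rw [one_mul]; exact hrn g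
  have hRr : ∀ g, R g = r g := fun g => rfl
  have hsymm : ∀ f g : H, inner ℂ (R f) g = inner ℂ f (R g) := by
    intro f g
    have := hs' _ (hrg f) _ (hrg g)
    dsimp only at this
    rw [inner_sub_left, inner_sub_right, inner_smul_left, inner_smul_right,
      Complex.conj_ofReal] at this
    exact (sub_left_injective this).symm
  have hlow : ∀ g : H, ‖R g‖ ^ 2 ≤ (inner ℂ (R g) g).re := fun g => by
    rw [hRr]
    simpa using hl' _ (hrg g)
  refine ⟨R, ⟨fun f g => ⟨fun h => ?_, fun h => ?_⟩, ?_, hsymm, hlow⟩⟩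
  · refine huniq _ (g + (μ : ℂ) • f) _ (hrg _) ?_
    simpa using h
  · have := hrg (g + (μ : ℂ) • f)
    rw [← hRr, h] at this
    simpa using this
  · change IsCompactOperator (R : H →ₗ[ℂ] H)
    rw [isCompactOperator_iff_isCompact_closure_image_closedBall (R : H →ₗ[ℂ] H) one_pos]
    refine TotallyBounded.isCompact_of_isClosed (TotallyBounded.closure ?_) isClosed_closure
    rw [Metric.totallyBounded_iff]
    intro ε hε
    -- Differences of unit ball elements have norm at most `2`, hence form value at most `4`. With
    -- `ε² / 16` the form contributes at most `ε² / 4`, and `‖T (R g)‖ < ε / 2` contributes less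
    -- than another `ε² / 4`.
    obtain ⟨N, T, hT⟩ := hc (ε ^ 2 / 16) (by positivity)
    have hT' : ∀ q ∈ A.closure.graph, ‖q.1‖ ^ 2 ≤
        ε ^ 2 / 16 * (inner ℂ q.1 (q.2 + (μ : ℂ) • q.1)).re + ‖T q.1‖ ^ 2 := by
      refine closure_graph_induction hA ?_ hT
      refine isClosed_le (by fun_prop) ?_
      refine Continuous.add (continuous_const.mul ?_) (by fun_prop)
      exact Complex.continuous_re.comp (by fun_prop)
    have hRT : ∀ g : H, ‖g‖ ≤ 2 → ‖T (R g)‖ < ε / 2 → ‖R g‖ < ε := by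
      intro g hg hTg
      have h1 := hT' _ (hrg g)
      dsimp only at h1
      rw [sub_add_cancel, ← hRr] at h1
      have h2 : (inner ℂ (R g) g).re ≤ 4 := by
        refine (Complex.re_le_norm _).trans ((norm_inner_le_norm _ _).trans ?_)
        have := hrn g
        rw [hRr]
        nlinarith [norm_nonneg g, norm_nonneg (r g)]
      refine lt_of_pow_lt_pow_left₀ 2 hε.le ?_
      have h3 : ‖T (R g)‖ ^ 2 < (ε / 2) ^ 2 := pow_lt_pow_left₀ hTg (norm_nonneg _) two_ne_zero
      nlinarith [sq_nonneg ε]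
    -- `T ∘ R` maps the ball to a bounded set in a finite-dimensional space; by `hRT` a finite net
    -- for this image lifts to one for the image under `R`.
    have htb : TotallyBounded ((T ∘L R) '' Metric.closedBall (0 : H) 1) := by
      have hb : Bornology.IsBounded ((T ∘L R) '' Metric.closedBall (0 : H) 1) := by
        exact (T ∘L R).lipschitz.isBounded_image Metric.isBounded_closedBall
      exact hb.isCompact_closure.totallyBounded.subset subset_closure
    obtain ⟨t, htsub, htfin, htcov⟩ := Metric.finite_approx_of_totallyBounded htb (ε / 2)
      (by positivity)
    choose! k hk1 hk2 using fun y (hy : y ∈ t) => htsub hy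
    refine ⟨(fun y => R (k y)) '' t, htfin.image _, ?_⟩
    rintro _ ⟨g, hg, rfl⟩
    have hmem := htcov ⟨g, hg, rfl⟩
    simp only [Set.mem_iUnion] at hmem
    obtain ⟨y, hy, hgy⟩ := hmem
    simp only [Set.mem_iUnion, Set.mem_image]
    refine ⟨R (k y), ⟨y, hy, rfl⟩, ?_⟩
    rw [Metric.mem_ball, dist_eq_norm]
    change ‖R g - R (k y)‖ < ε
    rw [← map_sub]
    apply hRT
    · have h1 := hk1 y hy
      rw [mem_closedBall_zero_iff] at h1 hg
      exact (norm_sub_le _ _).trans (by linarith)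
    · rw [map_sub, map_sub]
      have h2 := hk2 y hy
      rw [Metric.mem_ball, dist_eq_norm, ← h2] at hgy
      exact hgy

end Closure

open MeasureTheory

set_option linter.unusedSectionVars false

/-! ### Integration by parts and the quadratic form on test functions. -/

section Calculus

variable {E : Type*} [NormedAddCommGroup E] [InnerProductSpace ℝ E] [FiniteDimensional ℝ E]
  {ι : Type*} [Fintype ι]

theorem contDiff_fderiv_apply {F : Type*} [NormedAddCommGroup F] [NormedSpace ℝ F] {f : E → F}
    (hf : ContDiff ℝ ∞ f) (v : E) : ContDiff ℝ ∞ fun x => fderiv ℝ f x v :=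
  (hf.fderiv_right (m := ∞) (by simp)).clm_apply contDiff_const

theorem hasCompactSupport_fderiv_apply {F : Type*} [NormedAddCommGroup F] [NormedSpace ℝ F]
    {f : E → F} (hf : HasCompactSupport f) (v : E) : HasCompactSupport fun x => fderiv ℝ f x v :=
  hf.fderiv_apply (𝕜 := ℝ) v

theorem laplacian_eq_sum {F : Type*} [NormedAddCommGroup F] [NormedSpace ℝ F]
    (b : OrthonormalBasis ι ℝ E) {f : E → F} (hf : ContDiff ℝ ∞ f) (x : E) :
    Δ f x = ∑ i, fderiv ℝ (fun y => fderiv ℝ f y (b i)) x (b i) := by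
  rw [InnerProductSpace.laplacian_eq_iteratedFDeriv_orthonormalBasis f b]
  refine Finset.sum_congr rfl fun i _ => ?_
  rw [iteratedFDeriv_two_apply]
  have h : DifferentiableAt ℝ (fderiv ℝ f) x :=
    ((hf.fderiv_right (m := ∞) (by simp)).differentiable (by simp)) x
  rw [fderiv_clm_apply h (by fun_prop)]
  simp

/-- The squared length of the gradient. -/
def gradSq (b : OrthonormalBasis ι ℝ E) (ψ : E → ℂ) (x : E) : ℝ :=
  ∑ i, ‖fderiv ℝ ψ x (b i)‖ ^ 2

theorem gradSq_nonneg (b : OrthonormalBasis ι ℝ E) (ψ : E → ℂ) (x : E) : 0 ≤ gradSq b ψ x :=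
  Finset.sum_nonneg fun _ _ => by positivity

theorem continuous_gradSq (b : OrthonormalBasis ι ℝ E) {ψ : E → ℂ} (hψ : ContDiff ℝ ∞ ψ) :
    Continuous (gradSq b ψ) :=
  continuous_finsetSum _ fun i _ => ((contDiff_fderiv_apply hψ (b i)).continuous.norm).pow 2

theorem hasCompactSupport_gradSq (b : OrthonormalBasis ι ℝ E) {ψ : E → ℂ}
    (hc : HasCompactSupport ψ) : HasCompactSupport (gradSq b ψ) := by
  refine hc.mono' (fun x hx => ?_)
  by_contra h
  apply hx
  have h0 : fderiv ℝ ψ x = 0 := fderiv_of_notMem_tsupport ℝ h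
  simp [gradSq, h0]

theorem laplacian_continuous {ψ : E → ℂ} (hψ : ContDiff ℝ ∞ ψ) : Continuous (Δ ψ) := by
  have : Δ ψ = fun x => ∑ i, fderiv ℝ (fun y => fderiv ℝ ψ y (stdOrthonormalBasis ℝ E i)) x
      (stdOrthonormalBasis ℝ E i) := funext fun x => laplacian_eq_sum _ hψ x
  rw [this]
  exact continuous_finsetSum _ fun i _ =>
    (contDiff_fderiv_apply (contDiff_fderiv_apply hψ _) _).continuous

theorem laplacian_hasCompactSupport {ψ : E → ℂ} (hψ : ContDiff ℝ ∞ ψ) (hc : HasCompactSupport ψ) :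
    HasCompactSupport (Δ ψ) := by
  refine hc.mono' (fun x hx => ?_)
  by_contra h
  apply hx
  rw [laplacian_eq_sum (stdOrthonormalBasis ℝ E) hψ]
  refine Finset.sum_eq_zero fun i _ => ?_
  have h2 : x ∉ tsupport fun y => fderiv ℝ ψ y (stdOrthonormalBasis ℝ E i) := fun hx =>
    h (tsupport_fderiv_apply_subset ℝ _ hx)
  rw [fderiv_of_notMem_tsupport ℝ h2]
  simp

variable [MeasurableSpace E] [BorelSpace E]

theorem fderiv_conj_apply {ψ : E → ℂ} (hψ : ContDiff ℝ ∞ ψ) (x v : E) :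
    fderiv ℝ (fun y => (starRingEnd ℂ) (ψ y)) x v = (starRingEnd ℂ) (fderiv ℝ ψ x v) := by
  have h := ((hψ.differentiable (by simp)) x).hasFDerivAt
  have h2 := (Complex.conjCLE : ℂ ≃L[ℝ] ℂ).hasFDerivAt.comp x h
  change fderiv ℝ ((Complex.conjCLE : ℂ ≃L[ℝ] ℂ) ∘ ψ) x v = _
  rw [h2.fderiv]; rfl

theorem integrable_conj_mul {f g : E → ℂ} (hf : Continuous f) (hg : Continuous g)
    (hc : HasCompactSupport f) :
    Integrable fun x => (starRingEnd ℂ) (f x) * g x := by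
  refine Continuous.integrable_of_hasCompactSupport (by fun_prop) ?_
  refine hc.mono fun x hx => ?_
  contrapose! hx
  simp only [Function.mem_support, not_not] at hx ⊢
  simp [hx]

/-- Green's first identity for a compactly supported test function. -/
theorem integral_conj_mul_neg_laplacian (b : OrthonormalBasis ι ℝ E) {ψ u : E → ℂ}
    (hψ : ContDiff ℝ ∞ ψ) (hc : HasCompactSupport ψ) (hu : ContDiff ℝ ∞ u) :
    ∫ x, (starRingEnd ℂ) (ψ x) * -(Δ u) x
      = ∑ i, ∫ x, (starRingEnd ℂ) (fderiv ℝ ψ x (b i)) * fderiv ℝ u x (b i) := by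
  have hI : ∀ i, Integrable fun x => (starRingEnd ℂ) (ψ x) *
      fderiv ℝ (fun y => fderiv ℝ u y (b i)) x (b i) := fun i =>
    integrable_conj_mul hψ.continuous
      (contDiff_fderiv_apply (contDiff_fderiv_apply hu _) _).continuous hc
  have h1 : ∀ x, (starRingEnd ℂ) (ψ x) * -(Δ u) x = ∑ i, -((starRingEnd ℂ) (ψ x) *
      fderiv ℝ (fun y => fderiv ℝ u y (b i)) x (b i)) := fun x => by
    rw [laplacian_eq_sum b hu, mul_neg, Finset.mul_sum, Finset.sum_neg_distrib]
  simp_rw [h1]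
  rw [integral_finsetSum]
  swap
  · exact fun i _ => (hI i).neg
  refine Finset.sum_congr rfl fun i _ => ?_
  rw [integral_neg]
  have hcψ : ContDiff ℝ ∞ fun y => (starRingEnd ℂ) (ψ y) :=
    (Complex.conjCLE : ℂ ≃L[ℝ] ℂ).contDiff.comp hψ
  have hD : ContDiff ℝ ∞ fun y => fderiv ℝ u y (b i) := contDiff_fderiv_apply hu _
  rw [integral_mul_fderiv_eq_neg_fderiv_mul_of_integrable]
  · rw [neg_neg]
    refine integral_congr_ae (Filter.Eventually.of_forall fun x => ?_)
    dsimp only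
    rw [fderiv_conj_apply hψ]
  · simp_rw [fderiv_conj_apply hψ]
    exact integrable_conj_mul (contDiff_fderiv_apply hψ _).continuous hD.continuous
      (hasCompactSupport_fderiv_apply hc _)
  · exact hI i
  · exact integrable_conj_mul hψ.continuous hD.continuous hc
  · exact fun x _ => hcψ.differentiable (by simp) x
  · exact fun x _ => hD.differentiable (by simp) x

theorem integrable_gradSq (b : OrthonormalBasis ι ℝ E) {ψ : E → ℂ}
    (hψ : ContDiff ℝ ∞ ψ) (hc : HasCompactSupport ψ) : Integrable (gradSq b ψ) :=
  (continuous_gradSq b hψ).integrable_of_hasCompactSupport (hasCompactSupport_gradSq b hc)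

theorem integrable_mul_normSq {V : E → ℝ} (hV : Continuous V) {ψ : E → ℂ} (hψ : Continuous ψ)
    (hc : HasCompactSupport ψ) : Integrable fun x => V x * ‖ψ x‖ ^ 2 := by
  refine Continuous.integrable_of_hasCompactSupport (by fun_prop) ?_
  refine hc.mono fun x hx => ?_
  contrapose! hx
  simp only [Function.mem_support, not_not] at hx ⊢
  simp [hx]

theorem integrable_normSq {ψ : E → ℂ} (hψ : Continuous ψ)
    (hc : HasCompactSupport ψ) : Integrable fun x => ‖ψ x‖ ^ 2 := by
  simpa using integrable_mul_normSq (V := fun _ => 1) continuous_const hψ hc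

/-- The quadratic form of `-Δ + V`. -/
def energy (b : OrthonormalBasis ι ℝ E) (V : E → ℝ) (ψ : E → ℂ) : ℝ :=
  ∫ x, (gradSq b ψ x + V x * ‖ψ x‖ ^ 2)

theorem energy_eq (b : OrthonormalBasis ι ℝ E) {V : E → ℝ} (hV : Continuous V) {ψ : E → ℂ}
    (hψ : ContDiff ℝ ∞ ψ) (hc : HasCompactSupport ψ) :
    energy b V ψ = (∫ x, gradSq b ψ x) + ∫ x, V x * ‖ψ x‖ ^ 2 :=
  integral_add (integrable_gradSq b hψ hc) (integrable_mul_normSq hV hψ.continuous hc)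

theorem continuous_expr {V : E → ℝ} (hV : Continuous V) {ψ : E → ℂ} (hψ : ContDiff ℝ ∞ ψ) :
    Continuous (expr V ψ) := by
  have := laplacian_continuous hψ
  have := hψ.continuous
  unfold expr
  fun_prop

theorem hasCompactSupport_expr {V : E → ℝ} {ψ : E → ℂ} (hψ : ContDiff ℝ ∞ ψ)
    (hc : HasCompactSupport ψ) : HasCompactSupport (expr V ψ) := by
  have h1 := laplacian_hasCompactSupport hψ hc
  exact h1.neg.add (hc.mul_left (f := fun x => (V x : ℂ)))

theorem integral_conj_mul_expr (b : OrthonormalBasis ι ℝ E) {V : E → ℝ} (hV : Continuous V)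
    {ψ φ : E → ℂ} (hψ : ContDiff ℝ ∞ ψ) (hc : HasCompactSupport ψ) (hφ : ContDiff ℝ ∞ φ) :
    ∫ x, (starRingEnd ℂ) (ψ x) * expr V φ x
      = (∑ i, ∫ x, (starRingEnd ℂ) (fderiv ℝ ψ x (b i)) * fderiv ℝ φ x (b i))
        + ∫ x, (V x : ℂ) * ((starRingEnd ℂ) (ψ x) * φ x) := by
  rw [← integral_conj_mul_neg_laplacian b hψ hc hφ]
  have hφc := hφ.continuous
  have hlc := laplacian_continuous hφ
  rw [← integral_add]
  · refine integral_congr_ae (Filter.Eventually.of_forall fun x => ?_)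
    simp only [expr]; ring
  · exact integrable_conj_mul hψ.continuous (by fun_prop) hc
  · have := integrable_conj_mul hψ.continuous (g := fun x => (V x : ℂ) * φ x) (by fun_prop) hc
    refine this.congr (Filter.Eventually.of_forall fun x => ?_)
    dsimp only; ring

theorem conj_mul_self_re (z : ℂ) : ((starRingEnd ℂ) z * z).re = ‖z‖ ^ 2 := by
  rw [← Complex.normSq_eq_conj_mul_self, Complex.ofReal_re, Complex.normSq_eq_norm_sq]

theorem re_integral_conj_mul_expr (b : OrthonormalBasis ι ℝ E) {V : E → ℝ} (hV : Continuous V)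
    {ψ : E → ℂ} (hψ : ContDiff ℝ ∞ ψ) (hc : HasCompactSupport ψ) :
    (∫ x, (starRingEnd ℂ) (ψ x) * expr V ψ x).re = energy b V ψ := by
  rw [integral_conj_mul_expr b hV hψ hc hψ, energy_eq b hV hψ hc, Complex.add_re, Complex.re_sum]
  congr 1
  · unfold gradSq
    rw [integral_finsetSum]
    · refine Finset.sum_congr rfl fun i _ => ?_
      have hI := integrable_conj_mul (contDiff_fderiv_apply hψ (b i)).continuous
        (contDiff_fderiv_apply hψ (b i)).continuous (hasCompactSupport_fderiv_apply hc (b i))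
      have := integral_re hI
      change ∫ x, ((starRingEnd ℂ) _ * _).re = _ at this
      simp_rw [conj_mul_self_re] at this
      exact this.symm
    · exact fun i _ => integrable_normSq (contDiff_fderiv_apply hψ (b i)).continuous
        (hasCompactSupport_fderiv_apply hc (b i))
  · have hψc := hψ.continuous
    have hI : Integrable fun x => (V x : ℂ) * ((starRingEnd ℂ) (ψ x) * ψ x) := by
      have := integrable_conj_mul hψ.continuous (g := fun x => (V x : ℂ) * ψ x) (by fun_prop) hc
      refine this.congr (Filter.Eventually.of_forall fun x => ?_)
      dsimp only; ring
    have := integral_re hI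
    change ∫ x, ((V x : ℂ) * ((starRingEnd ℂ) _ * _)).re = _ at this
    simp_rw [Complex.re_ofReal_mul, conj_mul_self_re] at this
    exact this.symm

theorem integral_conj_mul_expr_symm {V : E → ℝ} (hV : Continuous V)
    {ψ φ : E → ℂ} (hψ : ContDiff ℝ ∞ ψ) (hc : HasCompactSupport ψ) (hφ : ContDiff ℝ ∞ φ)
    (hcφ : HasCompactSupport φ) :
    ∫ x, (starRingEnd ℂ) (expr V ψ x) * φ x = ∫ x, (starRingEnd ℂ) (ψ x) * expr V φ x := by
  have h1 := congrArg (starRingEnd ℂ)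
    (integral_conj_mul_expr (stdOrthonormalBasis ℝ E) hV hφ hcφ hψ)
  rw [integral_conj_mul_expr (stdOrthonormalBasis ℝ E) hV hψ hc hφ]
  rw [← integral_conj] at h1
  simp only [map_add, map_sum, ← integral_conj, map_mul, Complex.conj_conj,
    Complex.conj_ofReal] at h1
  simpa only [mul_comm] using h1

end Calculus

/-! ### Mollification and its commutator with the potential. -/

section Mollify

open scoped Convolution
open ContinuousLinearMap (lsmul)

/-- Jensen's inequality for the square and a probability density. -/
theorem sq_integral_mul_le {α : Type*} [MeasurableSpace α] {ν : Measure α} {w g : α → ℝ}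
    (hw0 : ∀ x, 0 ≤ w x) (hw : Integrable w ν) (hw1 : ∫ x, w x ∂ν = 1)
    (hg : Integrable (fun x => w x * g x) ν) (hg2 : Integrable (fun x => w x * g x ^ 2) ν) :
    (∫ x, w x * g x ∂ν) ^ 2 ≤ ∫ x, w x * g x ^ 2 ∂ν := by
  set m := ∫ x, w x * g x ∂ν with hm
  -- This is the variance `∫ w (g - m)²`, expanded.
  have h0 : 0 ≤ ∫ x, (w x * g x ^ 2 - 2 * m * (w x * g x) + m ^ 2 * w x) ∂ν := by
    refine integral_nonneg fun x => ?_
    have : w x * g x ^ 2 - 2 * m * (w x * g x) + m ^ 2 * w x = w x * (g x - m) ^ 2 := by ring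
    change 0 ≤ w x * g x ^ 2 - 2 * m * (w x * g x) + m ^ 2 * w x
    rw [this]
    exact mul_nonneg (hw0 x) (sq_nonneg _)
  have hsub : Integrable (fun x => w x * g x ^ 2 - 2 * m * (w x * g x)) ν :=
    hg2.sub (hg.const_mul _)
  rw [integral_add hsub (hw.const_mul _),
    integral_sub hg2 (hg.const_mul _), integral_const_mul, integral_const_mul, hw1, ← hm] at h0
  linarith

variable {E : Type*} [NormedAddCommGroup E] [InnerProductSpace ℝ E] [FiniteDimensional ℝ E]
  [MeasurableSpace E] [BorelSpace E]

theorem fderiv_convolution_apply {F : Type*} [NormedAddCommGroup F] [NormedSpace ℝ F]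
    {ρ : E → ℝ} (hρ : ContDiff ℝ ∞ ρ) (hc : HasCompactSupport ρ) {u : E → F}
    (hu : LocallyIntegrable u) (x v : E) :
    fderiv ℝ (ρ ⋆[lsmul ℝ ℝ, volume] u) x v
      = ((fun t => fderiv ℝ ρ t v) ⋆[lsmul ℝ ℝ, volume] u) x := by
  rw [← convolution_flip (lsmul ℝ ℝ) (f := ρ), ← convolution_flip (lsmul ℝ ℝ) (g := u)]
  have h1 : ContDiff ℝ 1 ρ := hρ.of_le (by simp)
  rw [(hc.hasFDerivAt_convolution_right (lsmul ℝ ℝ).flip hu h1 x).fderiv]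
  exact convolution_precompR_apply _ hu (hc.fderiv ℝ) (h1.continuous_fderiv one_ne_zero) _ _

/-- Mollification of `u` by the normalised bump function `φ`. -/
def mollify (φ : ContDiffBump (0 : E)) {F : Type*} [NormedAddCommGroup F] [NormedSpace ℝ F]
    (u : E → F) : E → F :=
  φ.normed volume ⋆[lsmul ℝ ℝ, volume] u

variable (φ : ContDiffBump (0 : E))

theorem contDiff_bump : ContDiff ℝ ∞ (φ.normed (volume : Measure E)) :=
  φ.contDiff_normed (n := (⊤ : ℕ∞))

theorem hasCompactSupport_bump : HasCompactSupport (φ.normed (volume : Measure E)) :=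
  φ.hasCompactSupport_normed

theorem mollify_apply {F : Type*} [NormedAddCommGroup F] [NormedSpace ℝ F] (u : E → F) (x : E) :
    mollify φ u x = ∫ t, φ.normed volume (x - t) • u t := by
  rw [mollify, convolution_eq_swap]; rfl

theorem contDiff_mollify {F : Type*} [NormedAddCommGroup F] [NormedSpace ℝ F] {u : E → F}
    (hu : LocallyIntegrable u) : ContDiff ℝ ∞ (mollify φ u) :=
  (hasCompactSupport_bump φ).contDiff_convolution_left (n := (⊤ : ℕ∞)) _
    (contDiff_bump φ) hu

theorem integrable_comp_sub_smul {F : Type*} [NormedAddCommGroup F] [NormedSpace ℝ F]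
    {ρ : E → ℝ} (hρ : Continuous ρ) (hc : HasCompactSupport ρ) {u : E → F}
    (hu : LocallyIntegrable u) (x : E) : Integrable fun t => ρ (x - t) • u t :=
  (hc.convolutionExists_left (lsmul ℝ ℝ) hρ hu x).integrable_swap

theorem integral_bump_sub (x : E) : ∫ t, φ.normed volume (x - t) = 1 := by
  rw [integral_sub_left_eq_self (fun t => φ.normed (volume : Measure E) t) volume x]
  exact φ.integral_normed

theorem integrable_bump_sub (x : E) : Integrable fun t => φ.normed (volume : Measure E) (x - t) :=
  (φ.integrable_normed).comp_sub_left x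

theorem norm_mollify_le {F : Type*} [NormedAddCommGroup F] [NormedSpace ℝ F] (u : E → F) (x : E) :
    ‖mollify φ u x‖ ≤ mollify φ (fun t => ‖u t‖) x := by
  rw [mollify_apply, mollify_apply]
  refine (norm_integral_le_integral_norm _).trans_eq ?_
  refine integral_congr_ae (Filter.Eventually.of_forall fun t => ?_)
  dsimp only
  rw [norm_smul, Real.norm_of_nonneg (φ.nonneg_normed _), smul_eq_mul]

theorem locallyIntegrable_of_memLp {F : Type*} [NormedAddCommGroup F] {u : E → F}
    (hu : MemLp u 2) : LocallyIntegrable u :=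
  hu.locallyIntegrable (by norm_num)

theorem locallyIntegrable_norm {F : Type*} [NormedAddCommGroup F] {u : E → F}
    (hu : LocallyIntegrable u) : LocallyIntegrable fun t => ‖u t‖ :=
  fun x => (hu x).norm

theorem sq_mollify_norm_le {F : Type*} [NormedAddCommGroup F] {u : E → F}
    (hu : MemLp u 2) (x : E) :
    mollify φ (fun t => ‖u t‖) x ^ 2 ≤ mollify φ (fun t => ‖u t‖ ^ 2) x := by
  have h1 : LocallyIntegrable fun t => ‖u t‖ := locallyIntegrable_norm (locallyIntegrable_of_memLp hu)
  have h2 : LocallyIntegrable fun t => ‖u t‖ ^ 2 :=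
    (hu.integrable_norm_pow two_ne_zero).locallyIntegrable
  rw [mollify_apply, mollify_apply]
  have hρ := (contDiff_bump φ).continuous
  have hc := hasCompactSupport_bump φ
  exact sq_integral_mul_le (fun t => φ.nonneg_normed _) (integrable_bump_sub φ x)
    (integral_bump_sub φ x) (integrable_comp_sub_smul hρ hc h1 x)
    (integrable_comp_sub_smul hρ hc h2 x)

theorem integrable_mollify {F : Type*} [NormedAddCommGroup F] [NormedSpace ℝ F] {u : E → F}
    (hu : Integrable u) : Integrable (mollify φ u) :=
  (φ.integrable_normed).integrable_convolution _ hu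

theorem integrable_sq_mollify_norm {F : Type*} [NormedAddCommGroup F] {u : E → F}
    (hu : MemLp u 2) : Integrable fun x => mollify φ (fun t => ‖u t‖) x ^ 2 := by
  have h1 : LocallyIntegrable fun t => ‖u t‖ := locallyIntegrable_norm (locallyIntegrable_of_memLp hu)
  have h2 : Integrable fun t => ‖u t‖ ^ 2 := hu.integrable_norm_pow two_ne_zero
  refine (integrable_mollify φ h2).mono' ?_ (Filter.Eventually.of_forall fun x => ?_)
  · exact ((contDiff_mollify φ h1).continuous.pow 2).aestronglyMeasurable
  · rw [Real.norm_of_nonneg (sq_nonneg _)]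
    exact sq_mollify_norm_le φ hu x

/-- Pointwise Jensen with the kernel as probability density; convolution with a kernel of mass one
then preserves the integral. -/
theorem integral_sq_mollify_norm_le {F : Type*} [NormedAddCommGroup F] {u : E → F}
    (hu : MemLp u 2) : ∫ x, mollify φ (fun t => ‖u t‖) x ^ 2 ≤ ∫ x, ‖u x‖ ^ 2 := by
  have h2 : Integrable fun t => ‖u t‖ ^ 2 := hu.integrable_norm_pow two_ne_zero
  refine (integral_mono (integrable_sq_mollify_norm φ hu) (integrable_mollify φ h2)
    fun x => sq_mollify_norm_le φ hu x).trans_eq ?_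
  rw [mollify, integral_convolution _ φ.integrable_normed h2, φ.integral_normed]
  simp

/-- The reflected kernel `s ↦ ρ (x - s)` is the test function inserted into the weak equation at the
point `x`. Two derivatives of it carry no sign. -/
theorem fderiv_reflect_apply {f : E → ℝ} (hf : ContDiff ℝ ∞ f) (x t v : E) :
    fderiv ℝ (fun s => (f (x - s) : ℂ)) t v = -((fderiv ℝ f (x - t) v : ℝ) : ℂ) := by
  have h1 : HasFDerivAt (fun s : E => x - s) (-ContinuousLinearMap.id ℝ E) t :=
    (hasFDerivAt_id t).const_sub x
  have h2 := ((hf.differentiable (by simp)) (x - t)).hasFDerivAt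
  have h3 := Complex.ofRealCLM.hasFDerivAt.comp t (h2.comp t h1)
  change fderiv ℝ (Complex.ofRealCLM ∘ (f ∘ fun s => x - s)) t v = _
  rw [h3.fderiv]
  simp

theorem contDiff_reflect {f : E → ℝ} (hf : ContDiff ℝ ∞ f) (x : E) :
    ContDiff ℝ ∞ fun s => (f (x - s) : ℂ) :=
  Complex.ofRealCLM.contDiff.comp (hf.comp (contDiff_const.sub contDiff_id))

theorem hasCompactSupport_reflect {f : E → ℝ} (hf : HasCompactSupport f) (x : E) :
    HasCompactSupport fun s => (f (x - s) : ℂ) := by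
  have h1 : HasCompactSupport fun s => f (x - s) :=
    hf.comp_homeomorph (Homeomorph.subLeft x)
  exact h1.comp_left (g := fun r : ℝ => (r : ℂ)) Complex.ofReal_zero

theorem laplacian_reflect {ι : Type*} [Fintype ι] (b : OrthonormalBasis ι ℝ E)
    {f : E → ℝ} (hf : ContDiff ℝ ∞ f) (x t : E) :
    Δ (fun s => (f (x - s) : ℂ)) t =
      ((∑ i, fderiv ℝ (fun y => fderiv ℝ f y (b i)) (x - t) (b i) : ℝ) : ℂ) := by
  rw [laplacian_eq_sum b (contDiff_reflect hf x)]
  simp_rw [fderiv_reflect_apply hf]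
  push_cast
  refine Finset.sum_congr rfl fun i _ => ?_
  have := fderiv_reflect_apply (contDiff_fderiv_apply hf (b i)) x t (b i)
  rw [fderiv_fun_neg]
  change -(fderiv ℝ _ t (b i)) = _
  rw [this, neg_neg]

/-- Both derivatives fall on the kernel, so `u` need only be locally integrable. -/
theorem laplacian_mollify {ι : Type*} [Fintype ι] (b : OrthonormalBasis ι ℝ E) {u : E → ℂ}
    (hu : LocallyIntegrable u) (x : E) :
    Δ (mollify φ u) x = ∫ t, Δ (fun s => (φ.normed volume (x - s) : ℂ)) t * u t := by
  have hρ := contDiff_bump φ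
  have hc := hasCompactSupport_bump φ
  rw [laplacian_eq_sum b (contDiff_mollify φ hu)]
  have h1 : ∀ i, (fun y => fderiv ℝ (mollify φ u) y (b i))
      = (fun t => fderiv ℝ (φ.normed volume) t (b i)) ⋆[lsmul ℝ ℝ, volume] u := fun i =>
    funext fun y => fderiv_convolution_apply hρ hc hu y (b i)
  have h2 : ∀ i, fderiv ℝ (fun y => fderiv ℝ (mollify φ u) y (b i)) x (b i)
      = ∫ t, fderiv ℝ (fun y => fderiv ℝ (φ.normed volume) y (b i)) (x - t) (b i) • u t := by
    intro i
    rw [h1, fderiv_convolution_apply (contDiff_fderiv_apply hρ _)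
      (hasCompactSupport_fderiv_apply hc _) hu, convolution_eq_swap]
    rfl
  simp_rw [h2]
  rw [← integral_finsetSum]
  · refine integral_congr_ae (Filter.Eventually.of_forall fun t => ?_)
    dsimp only
    rw [laplacian_reflect b hρ, ← Finset.sum_smul, Complex.real_smul]
  · intro i _
    exact integrable_comp_sub_smul
      (contDiff_fderiv_apply (contDiff_fderiv_apply hρ _) _).continuous
      (hasCompactSupport_fderiv_apply (hasCompactSupport_fderiv_apply hc _) _) hu x

/-- If `(-Δ + V) u = 0` weakly, then `(-Δ + V)` applied to a mollification of `u` is a commutator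
term. -/
theorem expr_mollify {V : E → ℝ} (hV : Continuous V) {u : E → ℂ} (hu : LocallyIntegrable u)
    (h : ∀ ψ : E → ℂ, ContDiff ℝ ∞ ψ → HasCompactSupport ψ →
      ∫ x, (starRingEnd ℂ) (u x) * expr V ψ x = 0) (x : E) :
    expr V (mollify φ u) x = ∫ t, φ.normed volume (x - t) • (((V x - V t : ℝ) : ℂ) * u t) := by
  have hρ := contDiff_bump φ
  have hc := hasCompactSupport_bump φ
  have hψ := contDiff_reflect hρ x
  have hψc := hasCompactSupport_reflect hc x
  have h1 := congrArg (starRingEnd ℂ) (h _ hψ hψc)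
  rw [← integral_conj, map_zero] at h1
  have hVu : LocallyIntegrable fun t => ((V t : ℝ) : ℂ) * u t := by
    have := hu.smul_continuous (f := u) (g := fun t => (V t : ℂ)) (by fun_prop)
    simpa only [smul_eq_mul, mul_comm] using this
  have hreal : ∀ t, (starRingEnd ℂ) ((starRingEnd ℂ) (u t) *
      expr V (fun s => (φ.normed volume (x - s) : ℂ)) t)
      = -(Δ (fun s => (φ.normed volume (x - s) : ℂ)) t * u t)
        + φ.normed volume (x - t) • (((V t : ℝ) : ℂ) * u t) := by
    intro t
    rw [expr, laplacian_reflect (stdOrthonormalBasis ℝ E) hρ]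
    simp only [map_mul, map_add, map_neg, Complex.conj_conj, Complex.conj_ofReal,
      Complex.real_smul]
    ring
  simp_rw [hreal] at h1
  have hΔ : Integrable fun t => Δ (fun s => (φ.normed volume (x - s) : ℂ)) t * u t := by
    have hI : Integrable fun t => ∑ i, fderiv ℝ (fun y => fderiv ℝ
        (φ.normed (volume : Measure E)) y (stdOrthonormalBasis ℝ E i)) (x - t)
        (stdOrthonormalBasis ℝ E i) • u t :=
      integrable_finsetSum _ fun i _ => integrable_comp_sub_smul
        (contDiff_fderiv_apply (contDiff_fderiv_apply hρ _) _).continuous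
        (hasCompactSupport_fderiv_apply (hasCompactSupport_fderiv_apply hc _) _) hu x
    refine hI.congr (Filter.Eventually.of_forall fun t => ?_)
    dsimp only
    rw [laplacian_reflect (stdOrthonormalBasis ℝ E) hρ, ← Finset.sum_smul, Complex.real_smul]
  have hI2 := integrable_comp_sub_smul hρ.continuous hc hVu x
  have hI1 := integrable_comp_sub_smul hρ.continuous hc hu x
  have hΔn : Integrable fun t => -(Δ (fun s => (φ.normed volume (x - s) : ℂ)) t * u t) := hΔ.neg
  rw [integral_add hΔn hI2, integral_neg] at h1
  rw [expr, laplacian_mollify φ (stdOrthonormalBasis ℝ E) hu, mollify_apply]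
  have h4 : ∀ t, φ.normed volume (x - t) • (((V x - V t : ℝ) : ℂ) * u t)
      = (V x : ℂ) * (φ.normed volume (x - t) • u t)
        - φ.normed volume (x - t) • (((V t : ℝ) : ℂ) * u t) := by
    intro t
    simp only [Complex.real_smul]; push_cast; ring
  simp_rw [h4]
  rw [integral_sub (hI1.const_mul _) hI2, integral_const_mul]
  linear_combination h1

/-- The kernel vanishes at distance `φ.rOut` and beyond, so only the oscillation of `V` on that
scale around `x` enters the commutator. -/
theorem norm_expr_mollify_le {V : E → ℝ} (hV : Continuous V) {u : E → ℂ}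
    (hu : LocallyIntegrable u)
    (h : ∀ ψ : E → ℂ, ContDiff ℝ ∞ ψ → HasCompactSupport ψ →
      ∫ x, (starRingEnd ℂ) (u x) * expr V ψ x = 0) {x : E} {c : ℝ}
    (hc : ∀ t, dist t x < φ.rOut → |V x - V t| ≤ c) :
    ‖expr V (mollify φ u) x‖ ≤ c * mollify φ (fun t => ‖u t‖) x := by
  rw [expr_mollify φ hV hu h, mollify_apply, ← integral_const_mul]
  refine norm_integral_le_of_norm_le ?_ (Filter.Eventually.of_forall fun t => ?_)
  · exact (integrable_comp_sub_smul (contDiff_bump φ).continuous (hasCompactSupport_bump φ)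
      (locallyIntegrable_norm hu) x).const_mul _
  · rw [norm_smul, norm_mul, Complex.norm_real, Real.norm_of_nonneg (φ.nonneg_normed _),
      Real.norm_eq_abs, smul_eq_mul]
    by_cases ht : dist t x < φ.rOut
    · have := hc t ht
      have h0 := φ.nonneg_normed (μ := (volume : Measure E)) (x - t)
      calc _ ≤ φ.normed volume (x - t) * (c * ‖u t‖) := by gcongr
        _ = _ := by ring
    · have h0 : φ.normed (volume : Measure E) (x - t) = 0 := by
        rw [← Function.notMem_support, φ.support_normed_eq, mem_ball_zero_iff]
        rwa [dist_comm, dist_eq_norm] at ht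
      simp [h0]

end Mollify

open Filter Topology

/-! ### Vanishing of square integrable weak solutions. -/

section EssentialSelfAdjointness

/-- Fatou's lemma for Bochner integrals of nonnegative functions. -/
theorem integral_le_of_tendsto_ae {α : Type*} [MeasurableSpace α] {ν : Measure α}
    {f : ℕ → α → ℝ} {g : α → ℝ} {c : ℕ → ℝ} {d : ℝ} (hf0 : ∀ n x, 0 ≤ f n x)
    (hfi : ∀ n, Integrable (f n) ν)
    (hfg : ∀ᵐ x ∂ν, Tendsto (fun n => f n x) atTop (𝓝 (g x)))
    (hfc : ∀ᶠ n in atTop, ∫ x, f n x ∂ν ≤ c n) (hcd : Tendsto c atTop (𝓝 d)) :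
    ∫ x, g x ∂ν ≤ d := by
  have hg0 : 0 ≤ᵐ[ν] g := by
    filter_upwards [hfg] with x hx
    exact ge_of_tendsto' hx fun n => hf0 n x
  have hd0 : 0 ≤ d := ge_of_tendsto hcd (by
    filter_upwards [hfc] with n hn
    exact (integral_nonneg (hf0 n)).trans hn)
  have hgm : AEStronglyMeasurable g ν :=
    aestronglyMeasurable_of_tendsto_ae atTop (fun n => (hfi n).aestronglyMeasurable) hfg
  rw [integral_eq_lintegral_of_nonneg_ae hg0 hgm]
  refine ENNReal.toReal_le_of_le_ofReal hd0 ?_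
  calc ∫⁻ x, ENNReal.ofReal (g x) ∂ν
      = ∫⁻ x, liminf (fun n => ENNReal.ofReal (f n x)) atTop ∂ν := by
        refine lintegral_congr_ae ?_
        filter_upwards [hfg] with x hx
        exact ((ENNReal.tendsto_ofReal hx).liminf_eq).symm
    _ ≤ liminf (fun n => ∫⁻ x, ENNReal.ofReal (f n x) ∂ν) atTop :=
        lintegral_liminf_le' fun n => (hfi n).aestronglyMeasurable.aemeasurable.ennreal_ofReal
    _ ≤ liminf (fun n => ENNReal.ofReal (c n)) atTop := by
        refine liminf_le_liminf ?_
        filter_upwards [hfc] with n hn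
        rw [← ofReal_integral_eq_lintegral_ofReal (hfi n) (Eventually.of_forall (hf0 n))]
        exact ENNReal.ofReal_le_ofReal hn
    _ = ENNReal.ofReal d := (ENNReal.tendsto_ofReal hcd).liminf_eq

variable {E : Type*} [NormedAddCommGroup E] [InnerProductSpace ℝ E] [FiniteDimensional ℝ E]
  [MeasurableSpace E] [BorelSpace E] {ι : Type*} [Fintype ι]

theorem fderiv_ofReal_mul_apply {χ : E → ℝ} (hχ : ContDiff ℝ ∞ χ) {w : E → ℂ}
    (hw : ContDiff ℝ ∞ w) (x v : E) :
    fderiv ℝ (fun y => (χ y : ℂ) * w y) x v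
      = (χ x : ℂ) * fderiv ℝ w x v + (fderiv ℝ χ x v : ℂ) * w x := by
  have h1 := ((hχ.differentiable (by simp)) x).hasFDerivAt
  have h2 := ((hw.differentiable (by simp)) x).hasFDerivAt
  have h3 : HasFDerivAt (fun y => (χ y : ℂ)) (Complex.ofRealCLM ∘L fderiv ℝ χ x) x :=
    Complex.ofRealCLM.hasFDerivAt.comp x h1
  have h4 : fderiv ℝ (fun y => (χ y : ℂ) * w y) x = _ := (h3.mul h2).fderiv
  rw [h4]
  simp [mul_comm]

theorem contDiff_ofReal_mul {χ : E → ℝ} (hχ : ContDiff ℝ ∞ χ) {w : E → ℂ}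
    (hw : ContDiff ℝ ∞ w) : ContDiff ℝ ∞ fun y => (χ y : ℂ) * w y :=
  (Complex.ofRealCLM.contDiff.comp hχ).mul hw

theorem hasCompactSupport_ofReal_mul {χ : E → ℝ} (hc : HasCompactSupport χ) (w : E → ℂ) :
    HasCompactSupport fun y => (χ y : ℂ) * w y :=
  (hc.comp_left (g := fun r : ℝ => (r : ℂ)) Complex.ofReal_zero).mul_right

theorem hasCompactSupport_mul_ofReal (χ : E → ℝ) {w : E → ℂ} (hc : HasCompactSupport w) :
    HasCompactSupport fun y => (χ y : ℂ) * w y :=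
  hc.mul_left

/-- The squared length of the gradient of a real function. -/
def gradSqReal (b : OrthonormalBasis ι ℝ E) (χ : E → ℝ) (x : E) : ℝ :=
  ∑ i, (fderiv ℝ χ x (b i)) ^ 2

theorem continuous_gradSqReal (b : OrthonormalBasis ι ℝ E) {χ : E → ℝ} (hχ : ContDiff ℝ ∞ χ) :
    Continuous (gradSqReal b χ) :=
  continuous_finsetSum _ fun i _ => (contDiff_fderiv_apply hχ (b i)).continuous.pow 2

/-- The pointwise form of `Re (conj (χ² w)' w') = |(χ w)'|² - χ'² |w|²`, with `a`, `a'` the cutoff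
and its derivative. It leaves no term mixing `w` and `w'` as an error. -/
theorem re_conj_mul_localized (a a' : ℝ) (w w' : ℂ) :
    ((starRingEnd ℂ) (((a ^ 2 : ℝ) : ℂ) * w' + ((2 * a * a' : ℝ) : ℂ) * w) * w').re
      = ‖(a : ℂ) * w' + (a' : ℂ) * w‖ ^ 2 - a' ^ 2 * ‖w‖ ^ 2 := by
  simp only [← Complex.normSq_eq_norm_sq, Complex.normSq_apply, Complex.mul_re, Complex.add_re,
    Complex.add_im, Complex.mul_im, Complex.conj_re, Complex.conj_im, Complex.ofReal_re,
    Complex.ofReal_im]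
  ring

/-- The localisation formula: the energy of a localised function. -/
theorem energy_localized (b : OrthonormalBasis ι ℝ E) {V : E → ℝ} (hV : Continuous V)
    {χ : E → ℝ} (hχ : ContDiff ℝ ∞ χ) (hc : HasCompactSupport χ) {w : E → ℂ}
    (hw : ContDiff ℝ ∞ w) :
    energy b V (fun x => (χ x : ℂ) * w x)
      = (∫ x, (starRingEnd ℂ) (((χ x ^ 2 : ℝ) : ℂ) * w x) * expr V w x).re
        + ∫ x, gradSqReal b χ x * ‖w x‖ ^ 2 := by
  have hχ2 : ContDiff ℝ ∞ fun x => χ x ^ 2 := hχ.pow 2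
  have hc2 : HasCompactSupport fun x => χ x ^ 2 := by
    simpa only [pow_two] using! hc.mul_right (f' := χ)
  have hψ := contDiff_ofReal_mul hχ2 hw
  have hψc := hasCompactSupport_ofReal_mul hc2 w
  have hχw := contDiff_ofReal_mul hχ hw
  have hχwc := hasCompactSupport_ofReal_mul hc w
  have hwc := hw.continuous
  rw [integral_conj_mul_expr b hV hψ hψc hw, energy_eq b hV hχw hχwc, Complex.add_re,
    Complex.re_sum]
  have hd2 : ∀ x v, fderiv ℝ (fun y => χ y ^ 2) x v = 2 * χ x * fderiv ℝ χ x v := by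
    intro x v
    have h1 := ((hχ.differentiable (by simp)) x).hasFDerivAt
    rw [(h1.pow 2).fderiv]
    simp
  have hcw : ∀ i, Integrable fun x => (fderiv ℝ χ x (b i)) ^ 2 * ‖w x‖ ^ 2 := by
    intro i
    have hci := (contDiff_fderiv_apply hχ (b i)).continuous
    refine Continuous.integrable_of_hasCompactSupport (by fun_prop) ?_
    have : HasCompactSupport fun x => (fderiv ℝ χ x (b i)) * (fderiv ℝ χ x (b i) * ‖w x‖ ^ 2) :=
      (hasCompactSupport_fderiv_apply hc (b i)).mul_right
    have he : (fun x => (fderiv ℝ χ x (b i)) ^ 2 * ‖w x‖ ^ 2)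
        = fun x => (fderiv ℝ χ x (b i)) * (fderiv ℝ χ x (b i) * ‖w x‖ ^ 2) := by
      funext x; ring
    rw [he]; exact this
  have hg : ∀ i, Integrable fun x => ‖fderiv ℝ (fun y => (χ y : ℂ) * w y) x (b i)‖ ^ 2 := fun i =>
    integrable_normSq (contDiff_fderiv_apply hχw (b i)).continuous
      (hasCompactSupport_fderiv_apply hχwc (b i))
  have hi : ∀ i, (∫ x, (starRingEnd ℂ) (fderiv ℝ (fun y => ((χ y ^ 2 : ℝ) : ℂ) * w y) x (b i))
      * fderiv ℝ w x (b i)).re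
      = (∫ x, ‖fderiv ℝ (fun y => (χ y : ℂ) * w y) x (b i)‖ ^ 2)
        - ∫ x, (fderiv ℝ χ x (b i)) ^ 2 * ‖w x‖ ^ 2 := by
    intro i
    have hI := integrable_conj_mul (contDiff_fderiv_apply hψ (b i)).continuous
      (contDiff_fderiv_apply hw (b i)).continuous (hasCompactSupport_fderiv_apply hψc (b i))
    have h1 := integral_re hI
    change ∫ x, ((starRingEnd ℂ) _ * _).re = _ at h1
    refine h1.symm.trans ?_
    rw [← integral_sub (hg i) (hcw i)]
    refine integral_congr_ae (Eventually.of_forall fun x => ?_)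
    dsimp only
    rw [fderiv_ofReal_mul_apply hχ2 hw, fderiv_ofReal_mul_apply hχ hw, hd2]
    exact re_conj_mul_localized _ _ _ _
  simp_rw [hi]
  have hVint : (∫ x, (V x : ℂ) * ((starRingEnd ℂ) (((χ x ^ 2 : ℝ) : ℂ) * w x) * w x)).re
      = ∫ x, V x * ‖(χ x : ℂ) * w x‖ ^ 2 := by
    have hI : Integrable fun x => (V x : ℂ) * ((starRingEnd ℂ) (((χ x ^ 2 : ℝ) : ℂ) * w x) * w x) := by
      have := integrable_conj_mul hψ.continuous (g := fun x => (V x : ℂ) * w x) (by fun_prop) hψc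
      refine this.congr (Eventually.of_forall fun x => ?_)
      dsimp only; ring
    have h1 := integral_re hI
    refine h1.symm.trans (integral_congr_ae (Eventually.of_forall fun x => ?_))
    change ((V x : ℂ) * ((starRingEnd ℂ) (((χ x ^ 2 : ℝ) : ℂ) * w x) * w x)).re
      = V x * ‖(χ x : ℂ) * w x‖ ^ 2
    rw [Complex.re_ofReal_mul, map_mul, Complex.conj_ofReal, mul_assoc, Complex.re_ofReal_mul,
      conj_mul_self_re, norm_mul, Complex.norm_real, Real.norm_eq_abs, mul_pow, sq_abs]
  have e1 : ∫ x, gradSq b (fun x => (χ x : ℂ) * w x) x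
      = ∑ i, ∫ x, ‖fderiv ℝ (fun y => (χ y : ℂ) * w y) x (b i)‖ ^ 2 :=
    integral_finsetSum _ fun i _ => hg i
  have e2 : ∫ x, gradSqReal b χ x * ‖w x‖ ^ 2
      = ∑ i, ∫ x, (fderiv ℝ χ x (b i)) ^ 2 * ‖w x‖ ^ 2 := by
    unfold gradSqReal
    simp_rw [Finset.sum_mul]
    exact integral_finsetSum _ fun i _ => hcw i
  rw [hVint, e1, e2, Finset.sum_sub_distrib]
  ring

/-- Local mass estimate for weak solutions of `(-Δ + V) u = 0` when `-Δ + V ≥ 1`. -/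
theorem integral_cutoff_le (b : OrthonormalBasis ι ℝ E) {V : E → ℝ} (hV : Continuous V)
    (hlow : ∀ ψ : E → ℂ, ContDiff ℝ ∞ ψ → HasCompactSupport ψ → ∫ x, ‖ψ x‖ ^ 2 ≤ energy b V ψ)
    {u : E → ℂ} (hu : MemLp u 2)
    (h : ∀ ψ : E → ℂ, ContDiff ℝ ∞ ψ → HasCompactSupport ψ →
      ∫ x, (starRingEnd ℂ) (u x) * expr V ψ x = 0)
    {χ : E → ℝ} (hχ : ContDiff ℝ ∞ χ) (hc : HasCompactSupport χ) (hχ1 : ∀ x, |χ x| ≤ 1) {δ : ℝ}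
    (hδ : ∀ x, gradSqReal b χ x ≤ δ) :
    ∫ x, χ x ^ 2 * ‖u x‖ ^ 2 ≤ δ * ∫ x, ‖u x‖ ^ 2 := by
  have hul := locallyIntegrable_of_memLp hu
  set C := ∫ x, ‖u x‖ ^ 2 with hC
  have hC0 : 0 ≤ C := integral_nonneg fun x => by positivity
  have hδ0 : 0 ≤ δ := le_trans (Finset.sum_nonneg fun _ _ => sq_nonneg _) (hδ 0)
  -- one step of the mollification estimate
  have step : ∀ (φ : ContDiffBump (0 : E)) (c : ℝ), 0 ≤ c →
      (∀ x ∈ tsupport χ, ∀ t, dist t x < φ.rOut → |V x - V t| ≤ c) →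
      ∫ x, ‖(χ x : ℂ) * mollify φ u x‖ ^ 2 ≤ δ * C + c * C := by
    intro φ c hc0 hφ
    have hw := contDiff_mollify φ hul
    have hwc := hw.continuous
    have hχc := hχ.continuous
    have hm2 := integrable_sq_mollify_norm φ hu
    have hm2i := integral_sq_mollify_norm_le φ hu
    refine (hlow _ (contDiff_ofReal_mul hχ hw) (hasCompactSupport_ofReal_mul hc _)).trans ?_
    -- The first term contains the commutator and is at most `c ‖u‖²`; the second contains the
    -- gradient of the cutoff and is at most `δ ‖u‖²`.
    rw [energy_localized b hV hχ hc hw, add_comm (δ * C)]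
    have hnm : ∀ x, ‖mollify φ u x‖ ^ 2 ≤ mollify φ (fun t => ‖u t‖) x ^ 2 := fun x =>
      pow_le_pow_left₀ (norm_nonneg _) (norm_mollify_le φ u x) 2
    refine add_le_add ?_ ?_
    · refine (Complex.re_le_norm _).trans ((norm_integral_le_of_norm_le (hm2.const_mul c)
        (Eventually.of_forall fun x => ?_)).trans ?_)
      · have hm0 : 0 ≤ mollify φ (fun t => ‖u t‖) x :=
          (norm_nonneg _).trans (norm_mollify_le φ u x)
        by_cases hx : x ∈ tsupport χ
        · have h1 := norm_expr_mollify_le φ hV hul h (hφ x hx)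
          rw [norm_mul, RCLike.norm_conj, norm_mul, Complex.norm_real, Real.norm_eq_abs, abs_pow]
          have h2 := pow_le_one₀ (n := 2) (abs_nonneg _) (hχ1 x)
          have h3 := norm_mollify_le φ u x
          calc |χ x| ^ 2 * ‖mollify φ u x‖ * ‖expr V (mollify φ u) x‖
              ≤ 1 * mollify φ (fun t => ‖u t‖) x * (c * mollify φ (fun t => ‖u t‖) x) := by
                gcongr
            _ = _ := by ring
        · have h0 : χ x = 0 := image_eq_zero_of_notMem_tsupport hx
          simp only [h0]
          simp only [ne_eq, OfNat.ofNat_ne_zero, not_false_eq_true, zero_pow, Complex.ofReal_zero,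
            zero_mul, map_zero, norm_zero]
          positivity
      · rw [integral_const_mul]
        exact mul_le_mul_of_nonneg_left hm2i hc0
    · calc ∫ x, gradSqReal b χ x * ‖mollify φ u x‖ ^ 2
          ≤ ∫ x, δ * mollify φ (fun t => ‖u t‖) x ^ 2 := by
            refine integral_mono_of_nonneg (Eventually.of_forall fun x => ?_) (hm2.const_mul δ)
              (Eventually.of_forall fun x => ?_)
            · exact mul_nonneg (Finset.sum_nonneg fun _ _ => sq_nonneg _) (sq_nonneg _)
            · exact mul_le_mul (hδ x) (hnm x) (sq_nonneg _) hδ0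
        _ ≤ δ * C := by
            rw [integral_const_mul]
            exact mul_le_mul_of_nonneg_left hm2i hδ0
  -- uniform continuity of `V` near the support of `χ`
  have hunif : ∀ c > 0, ∃ r > 0, ∀ x ∈ tsupport χ, ∀ t, dist t x < r → |V x - V t| ≤ c := by
    intro c hcpos
    have hK : IsCompact (tsupport χ) := hc
    have hK2 : IsCompact (Metric.cthickening 1 (tsupport χ)) := hK.cthickening
    have huc := hK2.uniformContinuousOn_of_continuous hV.continuousOn
    rw [Metric.uniformContinuousOn_iff] at huc
    obtain ⟨r, hr, hV'⟩ := huc c hcpos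
    refine ⟨min r 1, by positivity, fun x hx t ht => ?_⟩
    have h1 : x ∈ Metric.cthickening 1 (tsupport χ) := Metric.self_subset_cthickening _ hx
    have h2 : t ∈ Metric.cthickening 1 (tsupport χ) :=
      Metric.mem_cthickening_of_dist_le t x 1 _ hx (ht.le.trans (min_le_right _ _))
    have h3 := hV' x h1 t h2 (by rw [dist_comm]; exact ht.trans_le (min_le_left _ _))
    rw [Real.dist_eq] at h3
    exact h3.le
  have key : ∀ c > 0, ∫ x, χ x ^ 2 * ‖u x‖ ^ 2 ≤ δ * C + c * C := by
    intro c hcpos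
    obtain ⟨r, hr, hVr⟩ := hunif c hcpos
    -- The ratio of the outer to the inner radius is fixed at `2`, as almost everywhere convergence
    -- of the mollifications requires this ratio to be bounded.
    let φ : ℕ → ContDiffBump (0 : E) := fun n =>
      ⟨1 / ((n : ℝ) + 1) / 2, 1 / ((n : ℝ) + 1), by positivity, by
        have : 0 < 1 / ((n : ℝ) + 1) := by positivity
        linarith⟩
    have hlim : Tendsto (fun n => (φ n).rOut) atTop (𝓝 0) := tendsto_one_div_add_atTop_nhds_zero_nat
    have hae := ContDiffBump.ae_convolution_tendsto_right_of_locallyIntegrable (μ := volume)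
      (φ := φ) (l := atTop) (K := 2) hlim (Eventually.of_forall fun n => by
        change 1 / ((n : ℝ) + 1) ≤ 2 * (1 / ((n : ℝ) + 1) / 2); linarith) hul
    refine integral_le_of_tendsto_ae (f := fun n x => ‖(χ x : ℂ) * mollify (φ n) u x‖ ^ 2)
      (c := fun _ => δ * C + c * C) (fun n x => by positivity) (fun n => ?_) ?_ ?_
      tendsto_const_nhds
    · exact integrable_normSq (contDiff_ofReal_mul hχ (contDiff_mollify _ hul)).continuous
        (hasCompactSupport_ofReal_mul hc _)
    · filter_upwards [hae] with x hx
      have h1 := ((hx.const_mul (χ x : ℂ)).norm).pow 2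
      have h2 : χ x ^ 2 * ‖u x‖ ^ 2 = ‖(χ x : ℂ) * u x‖ ^ 2 := by
        rw [norm_mul, Complex.norm_real, Real.norm_eq_abs, mul_pow, sq_abs]
      rw [h2]
      exact h1
    · have hev : ∀ᶠ n in atTop, (φ n).rOut < r := hlim.eventually_lt_const hr
      filter_upwards [hev] with n hn
      exact step (φ n) c hcpos.le fun x hx t ht => hVr x hx t (ht.trans hn)
  have hlim : Tendsto (fun c : ℝ => δ * C + c * C) (𝓝[>] 0) (𝓝 (δ * C + 0 * C)) :=
    ((continuous_const.add (continuous_id.mul continuous_const)).tendsto 0).mono_left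
      nhdsWithin_le_nhds
  have := ge_of_tendsto hlim (eventually_mem_nhdsWithin.mono fun c hc => key c hc)
  simpa using this

/-- Slowly varying cutoff functions exhausting the space. -/
theorem exists_cutoff (b : OrthonormalBasis ι ℝ E) :
    ∃ (χ : ℕ → E → ℝ) (δ : ℕ → ℝ), (∀ n, ContDiff ℝ ∞ (χ n)) ∧ (∀ n, HasCompactSupport (χ n)) ∧
      (∀ n x, |χ n x| ≤ 1) ∧ (∀ n x, gradSqReal b (χ n) x ≤ δ n) ∧
      (∀ x, Tendsto (fun n => χ n x) atTop (𝓝 1)) ∧ Tendsto δ atTop (𝓝 0) := by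
  let f : ContDiffBump (0 : E) := ⟨1, 2, by norm_num, by norm_num⟩
  have hf : ContDiff ℝ ∞ f := f.contDiff (n := (⊤ : ℕ∞))
  have hfc : HasCompactSupport f := f.hasCompactSupport
  have hG : Continuous (gradSqReal b f) := continuous_gradSqReal b hf
  have hGc : HasCompactSupport (gradSqReal b f) := by
    refine hfc.mono' (fun x hx => ?_)
    by_contra h
    apply hx
    have h0 : fderiv ℝ f x = 0 := fderiv_of_notMem_tsupport ℝ h
    simp [gradSqReal, h0]
  obtain ⟨M, hM⟩ := hG.bounded_above_of_compact_support hGc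
  let a : ℕ → ℝ := fun n => 1 / ((n : ℝ) + 1)
  have ha0 : ∀ n, 0 < a n := fun n => by positivity
  have ha : Tendsto a atTop (𝓝 0) := tendsto_one_div_add_atTop_nhds_zero_nat
  -- Dilating one bump by `1 / a n` multiplies its gradient by `a n`, hence the bound `a n ^ 2 * M`.
  refine ⟨fun n x => f (a n • x), fun n => a n ^ 2 * M, fun n => ?_, fun n => ?_, fun n x => ?_,
    fun n x => ?_, fun x => ?_, ?_⟩
  · exact hf.comp (contDiff_const_smul (a n))
  · exact hfc.comp_smul (ha0 n).ne'
  · rw [abs_of_nonneg f.nonneg]; exact f.le_one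
  · have hd : ∀ v, fderiv ℝ (fun x => f (a n • x)) x v = a n * fderiv ℝ f (a n • x) v := by
      intro v
      have h1 := ((hf.differentiable (by simp)) (a n • x)).hasFDerivAt
      have h2 : HasFDerivAt (fun y : E => a n • y) (a n • ContinuousLinearMap.id ℝ E) x :=
        (hasFDerivAt_id x).const_smul (a n)
      have h3 := h1.comp x h2
      change fderiv ℝ (f ∘ fun y => a n • y) x v = _
      rw [h3.fderiv]
      simp
    unfold gradSqReal
    simp_rw [hd, mul_pow]
    rw [← Finset.mul_sum]
    exact mul_le_mul_of_nonneg_left ((le_abs_self _).trans (hM (a n • x))) (by positivity)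
  · have h1 : Tendsto (fun n => f (a n • x)) atTop (𝓝 (f ((0 : ℝ) • x))) :=
      (f.continuous.tendsto _).comp (ha.smul_const x)
    rwa [zero_smul, f.one_of_mem_closedBall (by simp [f])] at h1
  · simpa using (ha.pow 2).mul_const M

/-- A square integrable weak solution of `(-Δ + V) u = 0` vanishes when `-Δ + V ≥ 1`. -/
theorem ae_eq_zero_of_weak_solution (b : OrthonormalBasis ι ℝ E) {V : E → ℝ} (hV : Continuous V)
    (hlow : ∀ ψ : E → ℂ, ContDiff ℝ ∞ ψ → HasCompactSupport ψ → ∫ x, ‖ψ x‖ ^ 2 ≤ energy b V ψ)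
    {u : E → ℂ} (hu : MemLp u 2)
    (h : ∀ ψ : E → ℂ, ContDiff ℝ ∞ ψ → HasCompactSupport ψ →
      ∫ x, (starRingEnd ℂ) (u x) * expr V ψ x = 0) : u =ᵐ[volume] 0 := by
  obtain ⟨χ, δ, hχ, hc, hχ1, hδ, hlim, hδ0⟩ := exists_cutoff (E := E) b
  have hu2 : Integrable fun x => ‖u x‖ ^ 2 := hu.integrable_norm_pow two_ne_zero
  have h0 : ∫ x, ‖u x‖ ^ 2 ≤ 0 := by
    refine integral_le_of_tendsto_ae (f := fun n x => χ n x ^ 2 * ‖u x‖ ^ 2)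
      (c := fun n => δ n * ∫ x, ‖u x‖ ^ 2) (fun n x => by positivity) (fun n => ?_) ?_ ?_ ?_
    · refine hu2.mono' ?_ (Eventually.of_forall fun x => ?_)
      · exact ((hχ n).continuous.pow 2).aestronglyMeasurable.mul hu2.aestronglyMeasurable
      · rw [Real.norm_of_nonneg (by positivity), ← sq_abs (χ n x)]
        exact mul_le_of_le_one_left (by positivity) (pow_le_one₀ (abs_nonneg _) (hχ1 n x))
    · refine Eventually.of_forall fun x => ?_
      simpa using ((hlim x).pow 2).mul_const (‖u x‖ ^ 2)
    · exact Eventually.of_forall fun n =>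
        integral_cutoff_le b hV hlow hu h (hχ n) (hc n) (hχ1 n) (hδ n)
    · simpa using hδ0.mul_const (∫ x, ‖u x‖ ^ 2)
  have h1 := (integral_eq_zero_iff_of_nonneg (fun x => by positivity) hu2).1
    (le_antisymm h0 (integral_nonneg fun x => by positivity))
  filter_upwards [h1] with x hx
  simpa using hx

end EssentialSelfAdjointness

/-! ### Approximation by mollification, controlled by the gradient. -/

section Compactness

variable {E : Type*} [NormedAddCommGroup E] [InnerProductSpace ℝ E] [FiniteDimensional ℝ E]
  [MeasurableSpace E] [BorelSpace E] {ι : Type*} [Fintype ι]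

theorem norm_fderiv_apply_sq_le (b : OrthonormalBasis ι ℝ E) (ψ : E → ℂ) (x t : E) :
    ‖fderiv ℝ ψ x t‖ ^ 2 ≤ ‖t‖ ^ 2 * gradSq b ψ x := by
  have h1 : fderiv ℝ ψ x t = ∑ i, (inner ℝ (b i) t) • fderiv ℝ ψ x (b i) := by
    conv_lhs => rw [← b.sum_repr' t]
    rw [map_sum]
    simp_rw [map_smul]
  have h2 : ‖fderiv ℝ ψ x t‖ ≤ ∑ i, ‖inner ℝ (b i) t‖ * ‖fderiv ℝ ψ x (b i)‖ := by
    rw [h1]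
    refine (norm_sum_le _ _).trans_eq ?_
    simp_rw [norm_smul]
  calc ‖fderiv ℝ ψ x t‖ ^ 2 ≤ (∑ i, ‖inner ℝ (b i) t‖ * ‖fderiv ℝ ψ x (b i)‖) ^ 2 :=
        pow_le_pow_left₀ (norm_nonneg _) h2 2
    _ ≤ (∑ i, ‖inner ℝ (b i) t‖ ^ 2) * ∑ i, ‖fderiv ℝ ψ x (b i)‖ ^ 2 :=
        Finset.sum_mul_sq_le_sq_mul_sq _ _ _
    _ = _ := by rw [b.sum_sq_norm_inner_right]; rfl

/-- The fundamental theorem of calculus along the segment from `x` to `x - t`, followed by Jensen on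
the unit interval. -/
theorem norm_sub_translate_sq_le (b : OrthonormalBasis ι ℝ E) {ψ : E → ℂ} (hψ : ContDiff ℝ ∞ ψ)
    (x t : E) :
    ‖ψ x - ψ (x - t)‖ ^ 2 ≤ ∫ s in Set.Ioc (0 : ℝ) 1, ‖t‖ ^ 2 * gradSq b ψ (x - s • t) := by
  have hc : Continuous fun s : ℝ => fderiv ℝ ψ (x - s • t) t :=
    (contDiff_fderiv_apply hψ t).continuous.comp (by fun_prop)
  have hG : Continuous fun s : ℝ => ‖t‖ ^ 2 * gradSq b ψ (x - s • t) :=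
    continuous_const.mul ((continuous_gradSq b hψ).comp (by fun_prop))
  have hd : ∀ s : ℝ, HasDerivAt (fun s : ℝ => -ψ (x - s • t)) (fderiv ℝ ψ (x - s • t) t) s := by
    intro s
    have h1 := ((hψ.differentiable (by simp)) (x - s • t)).hasFDerivAt
    have h2 : HasDerivAt (fun s : ℝ => x - s • t) (-t) s := by
      simpa using ((hasDerivAt_id s).smul_const t).const_sub x
    have h3 := (h1.comp_hasDerivAt s h2).neg
    simpa using! h3
  have hint := intervalIntegral.integral_eq_sub_of_hasDerivAt (a := 0) (b := 1)
    (fun s _ => hd s) (hc.intervalIntegrable 0 1)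
  rw [intervalIntegral.integral_of_le zero_le_one] at hint
  have he : ψ x - ψ (x - t) = ∫ s in Set.Ioc (0 : ℝ) 1, fderiv ℝ ψ (x - s • t) t := by
    rw [hint]; simp; ring
  rw [he]
  have hb : ∀ g : ℝ → ℝ, Continuous g → IntegrableOn g (Set.Ioc (0 : ℝ) 1) := fun g hg =>
    (hg.integrableOn_Icc).mono_set Set.Ioc_subset_Icc_self
  calc ‖∫ s in Set.Ioc (0 : ℝ) 1, fderiv ℝ ψ (x - s • t) t‖ ^ 2
      ≤ (∫ s in Set.Ioc (0 : ℝ) 1, 1 * ‖fderiv ℝ ψ (x - s • t) t‖) ^ 2 := by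
        simp_rw [one_mul]
        exact pow_le_pow_left₀ (norm_nonneg _) (norm_integral_le_integral_norm _) 2
    _ ≤ ∫ s in Set.Ioc (0 : ℝ) 1, 1 * ‖fderiv ℝ ψ (x - s • t) t‖ ^ 2 := by
        refine sq_integral_mul_le (fun _ => zero_le_one) (hb _ continuous_const) (by simp)
          (hb _ (by fun_prop)) (hb _ (by fun_prop))
    _ ≤ _ := by
        refine integral_mono (hb _ (by fun_prop)) (hb _ hG) fun s => ?_
        change 1 * ‖fderiv ℝ ψ (x - s • t) t‖ ^ 2 ≤ _
        rw [one_mul]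
        exact norm_fderiv_apply_sq_le b ψ _ _

/-- Integrate the segment estimate over `x`, exchange the integrals and use translation invariance.
Lower integrals spare all integrability conditions on the product space. -/
theorem lintegral_sub_translate_le (b : OrthonormalBasis ι ℝ E) {ψ : E → ℂ} (hψ : ContDiff ℝ ∞ ψ)
    (t : E) :
    ∫⁻ x, ENNReal.ofReal (‖ψ x - ψ (x - t)‖ ^ 2)
      ≤ ENNReal.ofReal (‖t‖ ^ 2) * ∫⁻ x, ENNReal.ofReal (gradSq b ψ x) := by
  have hG := continuous_gradSq b hψ
  have hm : Measurable fun p : E × ℝ => ENNReal.ofReal (‖t‖ ^ 2 * gradSq b ψ (p.1 - p.2 • t)) :=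
    (continuous_const.mul (hG.comp (by fun_prop))).measurable.ennreal_ofReal
  calc ∫⁻ x, ENNReal.ofReal (‖ψ x - ψ (x - t)‖ ^ 2)
      ≤ ∫⁻ x, ∫⁻ s in Set.Ioc (0 : ℝ) 1, ENNReal.ofReal (‖t‖ ^ 2 * gradSq b ψ (x - s • t)) := by
        refine lintegral_mono fun x => ?_
        have hGs : Continuous fun s : ℝ => ‖t‖ ^ 2 * gradSq b ψ (x - s • t) :=
          continuous_const.mul (hG.comp (by fun_prop))
        rw [← ofReal_integral_eq_lintegral_ofReal
          ((hGs.integrableOn_Icc).mono_set Set.Ioc_subset_Icc_self)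
          (Eventually.of_forall fun s => mul_nonneg (by positivity) (gradSq_nonneg _ _ _))]
        exact ENNReal.ofReal_le_ofReal (norm_sub_translate_sq_le b hψ x t)
    _ = ∫⁻ s in Set.Ioc (0 : ℝ) 1, ∫⁻ x, ENNReal.ofReal (‖t‖ ^ 2 * gradSq b ψ (x - s • t)) :=
        lintegral_lintegral_swap hm.aemeasurable
    _ = ∫⁻ s in Set.Ioc (0 : ℝ) 1, ∫⁻ x, ENNReal.ofReal (‖t‖ ^ 2 * gradSq b ψ x) := by
        refine lintegral_congr fun s => ?_
        exact lintegral_sub_right_eq_self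
          (fun x => ENNReal.ofReal (‖t‖ ^ 2 * gradSq b ψ x)) (s • t)
    _ = _ := by
        simp_rw [ENNReal.ofReal_mul (sq_nonneg ‖t‖)]
        rw [lintegral_const_mul _ hG.measurable.ennreal_ofReal]
        simp

theorem norm_sub_mollify_sq_le (φ : ContDiffBump (0 : E)) {ψ : E → ℂ} (hψ : Continuous ψ) (x : E) :
    ‖ψ x - mollify φ ψ x‖ ^ 2 ≤ ∫ t, φ.normed volume t * ‖ψ x - ψ (x - t)‖ ^ 2 := by
  have hρ := (contDiff_bump φ).continuous
  have hc := hasCompactSupport_bump φ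
  have hI : ∀ {F : Type} [NormedAddCommGroup F] [NormedSpace ℝ F] (g : E → F), Continuous g →
      Integrable fun t => φ.normed volume t • g t := fun g hg =>
    (hρ.smul hg).integrable_of_hasCompactSupport hc.smul_right
  have h1 : ψ x - mollify φ ψ x = ∫ t, φ.normed volume t • (ψ x - ψ (x - t)) := by
    simp_rw [smul_sub]
    rw [integral_sub (hI _ continuous_const) (hI _ (by fun_prop)), integral_smul_const,
      φ.integral_normed, one_smul]
    rfl
  rw [h1]
  calc _ ≤ (∫ t, φ.normed volume t * ‖ψ x - ψ (x - t)‖) ^ 2 := by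
        refine pow_le_pow_left₀ (norm_nonneg _) ?_ 2
        refine (norm_integral_le_integral_norm _).trans_eq ?_
        refine integral_congr_ae (Eventually.of_forall fun t => ?_)
        dsimp only
        rw [norm_smul, Real.norm_of_nonneg (φ.nonneg_normed _)]
    _ ≤ _ := sq_integral_mul_le (fun t => φ.nonneg_normed _) φ.integrable_normed φ.integral_normed
        (hI (fun t => ‖ψ x - ψ (x - t)‖) (by fun_prop))
        (hI (fun t => ‖ψ x - ψ (x - t)‖ ^ 2) (by fun_prop))

/-- The error is an average of translation differences over `‖t‖ < φ.rOut`, each of which costs at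
most `φ.rOut ^ 2` times the Dirichlet integral. -/
theorem lintegral_sub_mollify_le (b : OrthonormalBasis ι ℝ E) (φ : ContDiffBump (0 : E))
    {ψ : E → ℂ} (hψ : ContDiff ℝ ∞ ψ) :
    ∫⁻ x, ENNReal.ofReal (‖ψ x - mollify φ ψ x‖ ^ 2)
      ≤ ENNReal.ofReal (φ.rOut ^ 2) * ∫⁻ x, ENNReal.ofReal (gradSq b ψ x) := by
  have hρ := (contDiff_bump φ).continuous
  have hc := hasCompactSupport_bump φ
  have hψc := hψ.continuous
  set G := ∫⁻ x, ENNReal.ofReal (gradSq b ψ x)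
  have hm : Measurable fun p : E × E =>
      ENNReal.ofReal (φ.normed volume p.2 * ‖ψ p.1 - ψ (p.1 - p.2)‖ ^ 2) := by
    refine Continuous.measurable ?_ |>.ennreal_ofReal
    fun_prop
  calc ∫⁻ x, ENNReal.ofReal (‖ψ x - mollify φ ψ x‖ ^ 2)
      ≤ ∫⁻ x, ∫⁻ t, ENNReal.ofReal (φ.normed volume t * ‖ψ x - ψ (x - t)‖ ^ 2) := by
        refine lintegral_mono fun x => ?_
        rw [← ofReal_integral_eq_lintegral_ofReal]
        · exact ENNReal.ofReal_le_ofReal (norm_sub_mollify_sq_le φ hψc x)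
        · exact Continuous.integrable_of_hasCompactSupport (by fun_prop) hc.mul_right
        · exact Eventually.of_forall fun t => mul_nonneg (φ.nonneg_normed _) (sq_nonneg _)
    _ = ∫⁻ t, ∫⁻ x, ENNReal.ofReal (φ.normed volume t * ‖ψ x - ψ (x - t)‖ ^ 2) :=
        lintegral_lintegral_swap hm.aemeasurable
    _ ≤ ∫⁻ t, ENNReal.ofReal (φ.normed (volume : Measure E) t) *
          (ENNReal.ofReal (φ.rOut ^ 2) * G) := by
        refine lintegral_mono fun t => ?_
        dsimp only
        simp_rw [ENNReal.ofReal_mul (φ.nonneg_normed (μ := (volume : Measure E)) t)]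
        rw [lintegral_const_mul _ (by
          refine Continuous.measurable ?_ |>.ennreal_ofReal
          fun_prop)]
        by_cases ht : ‖t‖ < φ.rOut
        · gcongr
          refine (lintegral_sub_translate_le b hψ t).trans ?_
          gcongr
        · have h0 : φ.normed (volume : Measure E) t = 0 := by
            rw [← Function.notMem_support, φ.support_normed_eq, mem_ball_zero_iff]
            exact ht
          simp [h0]
    _ = _ := by
        rw [lintegral_mul_const _ hρ.measurable.ennreal_ofReal,
          ← ofReal_integral_eq_lintegral_ofReal φ.integrable_normed
            (Eventually.of_forall fun t => φ.nonneg_normed _), φ.integral_normed]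
        simp

theorem hasCompactSupport_mollify (φ : ContDiffBump (0 : E)) {ψ : E → ℂ}
    (hc : HasCompactSupport ψ) : HasCompactSupport (mollify φ ψ) :=
  (hasCompactSupport_bump φ).convolution _ hc

theorem integral_sub_mollify_le (b : OrthonormalBasis ι ℝ E) (φ : ContDiffBump (0 : E))
    {ψ : E → ℂ} (hψ : ContDiff ℝ ∞ ψ) (hc : HasCompactSupport ψ) :
    ∫ x, ‖ψ x - mollify φ ψ x‖ ^ 2 ≤ φ.rOut ^ 2 * ∫ x, gradSq b ψ x := by
  have h := lintegral_sub_mollify_le b φ hψ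
  have hul : LocallyIntegrable ψ := hψ.continuous.locallyIntegrable
  have hI : Integrable fun x => ‖ψ x - mollify φ ψ x‖ ^ 2 :=
    integrable_normSq (hψ.continuous.sub (contDiff_mollify φ hul).continuous)
      (hc.sub (hasCompactSupport_mollify φ hc))
  rw [← ofReal_integral_eq_lintegral_ofReal hI (Eventually.of_forall fun x => sq_nonneg _),
    ← ofReal_integral_eq_lintegral_ofReal (integrable_gradSq b hψ hc)
      (Eventually.of_forall fun x => gradSq_nonneg _ _ _),
    ← ENNReal.ofReal_mul (sq_nonneg _)] at h
  exact (ENNReal.ofReal_le_ofReal_iff (mul_nonneg (sq_nonneg _)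
    (integral_nonneg fun x => gradSq_nonneg _ _ _))).1 h

/-- Equicontinuity of mollified functions in terms of the `L²` norm. -/
theorem norm_mollify_sub_sq_le (φ : ContDiffBump (0 : E)) (hφ : φ.rOut ≤ 1) {L : NNReal}
    (hL : LipschitzWith L (φ.normed (volume : Measure E))) {ψ : E → ℂ} (hψ : Continuous ψ)
    (hc : HasCompactSupport ψ) {r : ℝ} (hr : 0 < r) {x y : E} (hx : ‖x‖ ≤ r) (hy : ‖y‖ ≤ r) :
    ‖mollify φ ψ x - mollify φ ψ y‖ ^ 2
      ≤ (L * ‖x - y‖) ^ 2 * volume.real (Metric.closedBall (0 : E) (r + 1)) * ∫ t, ‖ψ t‖ ^ 2 := by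
  have hρ := (contDiff_bump φ).continuous
  have hρc := hasCompactSupport_bump φ
  have hul : LocallyIntegrable ψ := hψ.locallyIntegrable
  set S := Metric.closedBall (0 : E) (r + 1)
  set v := volume.real S with hv
  have hSfin : volume S ≠ ⊤ := (isCompact_closedBall _ _).measure_lt_top.ne
  have hvpos : 0 < v := ENNReal.toReal_pos
    ((Metric.measure_closedBall_pos volume _ (by positivity)).ne') hSfin
  have hzero : ∀ z : E, ‖z‖ ≤ r → ∀ t ∉ S, φ.normed (volume : Measure E) (z - t) = 0 := by
    intro z hz t ht
    rw [← Function.notMem_support, φ.support_normed_eq, mem_ball_zero_iff, not_lt]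
    simp only [S, mem_closedBall_zero_iff, not_le] at ht
    have := norm_sub_norm_le t z
    rw [norm_sub_rev] at this
    linarith
  have hIn : Integrable fun t => ‖ψ t‖ :=
    hψ.norm.integrable_of_hasCompactSupport hc.norm
  have h1 : mollify φ ψ x - mollify φ ψ y
      = ∫ t, (φ.normed volume (x - t) - φ.normed volume (y - t)) • ψ t := by
    rw [mollify_apply, mollify_apply, ← integral_sub (integrable_comp_sub_smul hρ hρc hul x)
      (integrable_comp_sub_smul hρ hρc hul y)]
    simp_rw [sub_smul]
  have h2 : ‖mollify φ ψ x - mollify φ ψ y‖ ≤ (L * ‖x - y‖) * ∫ t in S, ‖ψ t‖ := by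
    rw [h1, ← integral_const_mul, ← integral_indicator Metric.isClosed_closedBall.measurableSet]
    refine norm_integral_le_of_norm_le
      ((hIn.const_mul _).indicator Metric.isClosed_closedBall.measurableSet)
      (Eventually.of_forall fun t => ?_)
    by_cases ht : t ∈ S
    · rw [Set.indicator_of_mem ht, norm_smul]
      gcongr
      have := hL.dist_le_mul (x - t) (y - t)
      rwa [dist_eq_norm, dist_eq_norm, sub_sub_sub_cancel_right] at this
    · rw [Set.indicator_of_notMem ht, hzero x hx t ht, hzero y hy t ht]
      simp
  have h3 : (∫ t in S, ‖ψ t‖) ^ 2 ≤ v * ∫ t, ‖ψ t‖ ^ 2 := by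
    have hI2 := integrable_normSq hψ hc
    have hw : ∫ _ in S, v⁻¹ = 1 := by
      rw [setIntegral_const, smul_eq_mul, ← hv, mul_inv_cancel₀ hvpos.ne']
    have := sq_integral_mul_le (ν := volume.restrict S) (w := fun _ => v⁻¹) (g := fun t => ‖ψ t‖)
      (fun _ => by positivity) (integrableOn_const hSfin) hw
      (hIn.integrableOn.const_mul _) (hI2.integrableOn.const_mul _)
    rw [integral_const_mul, integral_const_mul, mul_pow] at this
    have h4 : (∫ t in S, ‖ψ t‖) ^ 2 ≤ v * ∫ t in S, ‖ψ t‖ ^ 2 := by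
      have h5 := mul_le_mul_of_nonneg_left this (sq_nonneg v)
      have e1 : v ^ 2 * (v⁻¹ ^ 2 * (∫ t in S, ‖ψ t‖) ^ 2) = (∫ t in S, ‖ψ t‖) ^ 2 := by
        field_simp
      have e2 : v ^ 2 * (v⁻¹ * ∫ t in S, ‖ψ t‖ ^ 2) = v * ∫ t in S, ‖ψ t‖ ^ 2 := by
        field_simp
      rwa [e1, e2] at h5
    refine h4.trans (mul_le_mul_of_nonneg_left ?_ hvpos.le)
    exact setIntegral_le_integral hI2 (Eventually.of_forall fun t => sq_nonneg _)
  calc ‖mollify φ ψ x - mollify φ ψ y‖ ^ 2 ≤ ((L * ‖x - y‖) * ∫ t in S, ‖ψ t‖) ^ 2 :=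
        pow_le_pow_left₀ (norm_nonneg _) h2 2
    _ = (L * ‖x - y‖) ^ 2 * (∫ t in S, ‖ψ t‖) ^ 2 := by ring
    _ ≤ (L * ‖x - y‖) ^ 2 * (v * ∫ t, ‖ψ t‖ ^ 2) := by gcongr
    _ = _ := by ring

/-- The mollification at a point as a continuous functional on `L²`. -/
theorem exists_mollify_functional (φ : ContDiffBump (0 : E)) (x : E) :
    ∃ T : L2 E →L[ℂ] ℂ, ∀ (f : L2 E) (ψ : E → ℂ), f =ᵐ[volume] ψ → T f = mollify φ ψ x := by
  have hk : MemLp (fun s => (φ.normed volume (x - s) : ℂ)) 2 (volume : Measure E) :=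
    (contDiff_reflect (contDiff_bump φ) x).continuous.memLp_of_hasCompactSupport
      (hasCompactSupport_reflect (hasCompactSupport_bump φ) x)
  refine ⟨innerSL ℂ hk.toLp, fun f ψ hf => ?_⟩
  rw [innerSL_apply_apply, L2.inner_def, mollify_apply]
  refine integral_congr_ae ?_
  filter_upwards [hf, hk.coeFn_toLp] with t h1 h2
  rw [h1, h2, RCLike.inner_apply, Complex.conj_ofReal, Complex.real_smul, mul_comm]

theorem norm_sq_eq_integral {f : L2 E} {ψ : E → ℂ} (hf : f =ᵐ[volume] ψ) :
    ‖f‖ ^ 2 = ∫ x, ‖ψ x‖ ^ 2 := by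
  have h1 : ‖f‖ ^ 2 = (inner ℂ f f).re := (inner_self_eq_norm_sq (𝕜 := ℂ) f).symm
  have hI := L2.integrable_inner (𝕜 := ℂ) f f
  have h2 := integral_re hI
  rw [h1, L2.inner_def]
  refine h2.symm.trans (integral_congr_ae ?_)
  filter_upwards [hf] with t ht
  rw [ht]
  exact inner_self_eq_norm_sq (𝕜 := ℂ) (ψ t)

end Compactness

/-! ### Schrödinger operators dominating a confining form. -/

section General

variable {E : Type*} [NormedAddCommGroup E] [InnerProductSpace ℝ E] [FiniteDimensional ℝ E]
  [MeasurableSpace E] [BorelSpace E] {ι : Type*} [Fintype ι]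

/-- A quantitative form of the compactness of the embedding of a weighted Sobolev space
into `L²`. -/
theorem exists_functional_norm_sq_le (b : OrthonormalBasis ι ℝ E) {W : E → ℝ} (hW : Continuous W)
    (hW1 : ∀ x, 1 ≤ W x) (hWlim : Tendsto W (cocompact E) atTop) {κ : ℝ} (hκ : 0 < κ) {ε : ℝ}
    (hε : 0 < ε) :
    ∃ (N : ℕ) (T : L2 E →L[ℂ] (Fin N → ℂ)), ∀ (f : L2 E) (ψ : E → ℂ), ContDiff ℝ ∞ ψ →
      HasCompactSupport ψ → f =ᵐ[volume] ψ →
      ‖f‖ ^ 2 ≤ ε * (∫ x, (κ * gradSq b ψ x + W x * ‖ψ x‖ ^ 2)) + ‖T f‖ ^ 2 := by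
  -- the ball outside which the weight is large
  obtain ⟨r, hr, hWr⟩ : ∃ r > 0, ∀ x ∉ Metric.closedBall (0 : E) r, 4 / ε ≤ W x := by
    have h1 := hWlim.eventually_ge_atTop (4 / ε)
    obtain ⟨K, hK, hKW⟩ := mem_cocompact.1 h1
    obtain ⟨r, hr, hKr⟩ := hK.isBounded.subset_closedBall_lt 0 0
    exact ⟨r, hr, fun x hx => hKW fun hxK => hx (hKr hxK)⟩
  -- the scale of mollification
  obtain ⟨h, hh, hh1, hhε⟩ : ∃ h > 0, h ≤ 1 ∧ 2 * h ^ 2 ≤ ε / 4 * κ := by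
    refine ⟨min 1 (ε * κ / 8), by positivity, min_le_left _ _, ?_⟩
    have h1 : min 1 (ε * κ / 8) ≤ 1 := min_le_left _ _
    have h2 : min 1 (ε * κ / 8) ≤ ε * κ / 8 := min_le_right _ _
    have h3 : 0 < min 1 (ε * κ / 8) := by positivity
    nlinarith
  let φ : ContDiffBump (0 : E) := ⟨h / 2, h, by positivity, by linarith⟩
  obtain ⟨L, hL⟩ := ((contDiff_bump φ).of_le (m := 1) (by simp)).lipschitzWith_of_hasCompactSupport
    (hasCompactSupport_bump φ) one_ne_zero
  set v := volume.real (Metric.closedBall (0 : E) (r + 1)) with hv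
  have hv0 : 0 ≤ v := measureReal_nonneg
  -- `η` is the mesh of the net in the ball: at this scale the equicontinuity error of the mollified
  -- function, integrated over the ball, is at most `ε / 4` of the squared norm.
  obtain ⟨η, hη, hηε⟩ : ∃ η > 0, 4 * v * ((L * η) ^ 2 * v) ≤ ε / 4 := by
    have hlim : Tendsto (fun η : ℝ => 4 * v * ((L * η) ^ 2 * v)) (𝓝[>] 0) (𝓝 0) := by
      have hc : Continuous fun η : ℝ => 4 * v * ((L * η) ^ 2 * v) := by fun_prop
      have := hc.tendsto 0
      simp only [mul_zero, ne_eq, OfNat.ofNat_ne_zero, not_false_eq_true, zero_pow,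
        zero_mul] at this
      exact this.mono_left nhdsWithin_le_nhds
    have h1 := (hlim.eventually_le_const (show (0 : ℝ) < ε / 4 by positivity)).and
      eventually_mem_nhdsWithin
    obtain ⟨η, h2, h3⟩ := h1.exists
    exact ⟨η, h3, h2⟩
  obtain ⟨s, hsub, hfin, hcov⟩ := Metric.finite_approx_of_totallyBounded
    (isCompact_closedBall (0 : E) r).totallyBounded η hη
  obtain ⟨N, y, -, hy⟩ := hfin.fin_param
  choose T' hT' using fun x : E => exists_mollify_functional φ x
  let T₀ : L2 E →L[ℂ] (Fin N → ℂ) := ContinuousLinearMap.pi fun i => T' (y i)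
  -- The square of `2 √v` is `4 v`: one factor `2` from splitting `ψ` into error and mollification,
  -- one from comparing with a net point, and `v` bounds the volume of the ball.
  refine ⟨N, ((2 * Real.sqrt v : ℝ) : ℂ) • T₀, fun f ψ hψ hc hf => ?_⟩
  have hψc := hψ.continuous
  have hul : LocallyIntegrable ψ := hψc.locallyIntegrable
  have hmc := (contDiff_mollify φ hul).continuous
  have hmcs := hasCompactSupport_mollify φ hc
  have hIψ := integrable_normSq hψc hc
  have hIW := integrable_mul_normSq hW hψc hc
  have hIG := integrable_gradSq b hψ hc
  have hId : Integrable fun x => ‖ψ x - mollify φ ψ x‖ ^ 2 :=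
    integrable_normSq (hψc.sub hmc) (hc.sub hmcs)
  have hIm := integrable_normSq hmc hmcs
  set I := ∫ x, ‖ψ x‖ ^ 2
  set G := ∫ x, gradSq b ψ x
  set P := ∫ x, W x * ‖ψ x‖ ^ 2
  have hQ : ∫ x, (κ * gradSq b ψ x + W x * ‖ψ x‖ ^ 2) = κ * G + P := by
    rw [integral_add (hIG.const_mul κ) hIW, integral_const_mul]
  have hG0 : 0 ≤ G := integral_nonneg fun x => gradSq_nonneg _ _ _
  have hI0 : 0 ≤ I := integral_nonneg fun x => sq_nonneg _
  have hIP : I ≤ P := integral_mono hIψ hIW fun x =>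
    le_mul_of_one_le_left (sq_nonneg _) (hW1 x)
  have hTn : ‖(((2 * Real.sqrt v : ℝ) : ℂ) • T₀) f‖ ^ 2 = 4 * v * ‖T₀ f‖ ^ 2 := by
    change ‖((2 * Real.sqrt v : ℝ) : ℂ) • T₀ f‖ ^ 2 = _
    rw [norm_smul, Complex.norm_real, Real.norm_of_nonneg (by positivity), mul_pow, mul_pow,
      Real.sq_sqrt hv0]
    ring
  rw [norm_sq_eq_integral hf, hQ, hTn]
  set B := Metric.closedBall (0 : E) r
  have hB : MeasurableSet B := Metric.isClosed_closedBall.measurableSet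
  have hsplit : I = (∫ x in B, ‖ψ x‖ ^ 2) + ∫ x in Bᶜ, ‖ψ x‖ ^ 2 :=
    (integral_add_compl hB hIψ).symm
  have hout : ∫ x in Bᶜ, ‖ψ x‖ ^ 2 ≤ ε / 4 * P := by
    calc ∫ x in Bᶜ, ‖ψ x‖ ^ 2 ≤ ∫ x in Bᶜ, ε / 4 * (W x * ‖ψ x‖ ^ 2) := by
          refine setIntegral_mono_on hIψ.integrableOn (hIW.const_mul _).integrableOn hB.compl
            fun x hx => ?_
          have h1 := hWr x hx
          rw [div_le_iff₀ hε] at h1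
          nlinarith [sq_nonneg ‖ψ x‖]
      _ ≤ ∫ x, ε / 4 * (W x * ‖ψ x‖ ^ 2) :=
          setIntegral_le_integral (hIW.const_mul _) (Eventually.of_forall fun x =>
            mul_nonneg (by positivity) (mul_nonneg (zero_le_one.trans (hW1 x)) (sq_nonneg _)))
      _ = _ := integral_const_mul _ _
  have hsup : ∀ x ∈ B, ‖mollify φ ψ x‖ ^ 2 ≤ 2 * ‖T₀ f‖ ^ 2 + 2 * ((L * η) ^ 2 * v * I) := by
    intro x hx
    have hxc := hcov hx
    simp only [Set.mem_iUnion] at hxc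
    obtain ⟨z, hz, hxz⟩ := hxc
    have hzB := hsub hz
    rw [← hy] at hz
    obtain ⟨i, rfl⟩ := hz
    have h1 := norm_mollify_sub_sq_le φ hh1 hL hψc hc hr (mem_closedBall_zero_iff.1 hx)
      (mem_closedBall_zero_iff.1 hzB)
    rw [Metric.mem_ball, dist_eq_norm] at hxz
    have h2 : ‖mollify φ ψ x - mollify φ ψ (y i)‖ ^ 2 ≤ (L * η) ^ 2 * v * I := by
      refine h1.trans ?_
      gcongr
    have h3 : ‖mollify φ ψ (y i)‖ ≤ ‖T₀ f‖ := by
      rw [← hT' (y i) f ψ hf]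
      exact norm_le_pi_norm (T₀ f) i
    have h4 : ‖mollify φ ψ x‖ ≤ ‖mollify φ ψ x - mollify φ ψ (y i)‖ + ‖mollify φ ψ (y i)‖ := by
      simpa using norm_add_le (mollify φ ψ x - mollify φ ψ (y i)) (mollify φ ψ (y i))
    have h5 := pow_le_pow_left₀ (norm_nonneg _) h4 2
    have h6 := pow_le_pow_left₀ (norm_nonneg _) h3 2
    nlinarith [sq_nonneg (‖mollify φ ψ x - mollify φ ψ (y i)‖ - ‖mollify φ ψ (y i)‖)]
  have hmB : ∫ x in B, ‖mollify φ ψ x‖ ^ 2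
      ≤ v * (2 * ‖T₀ f‖ ^ 2 + 2 * ((L * η) ^ 2 * v * I)) := by
    have hBfin : volume B ≠ ⊤ := (isCompact_closedBall _ _).measure_lt_top.ne
    calc ∫ x in B, ‖mollify φ ψ x‖ ^ 2
        ≤ ∫ x in B, (2 * ‖T₀ f‖ ^ 2 + 2 * ((L * η) ^ 2 * v * I)) :=
          setIntegral_mono_on hIm.integrableOn (integrableOn_const hBfin) hB hsup
      _ = volume.real B * (2 * ‖T₀ f‖ ^ 2 + 2 * ((L * η) ^ 2 * v * I)) := by
          rw [setIntegral_const, smul_eq_mul]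
      _ ≤ _ := by
          refine mul_le_mul_of_nonneg_right ?_ (by positivity)
          exact measureReal_mono (Metric.closedBall_subset_closedBall (by linarith))
            (isCompact_closedBall _ _).measure_lt_top.ne
  have hin : ∫ x in B, ‖ψ x‖ ^ 2
      ≤ 2 * (∫ x, ‖ψ x - mollify φ ψ x‖ ^ 2) + 2 * ∫ x in B, ‖mollify φ ψ x‖ ^ 2 := by
    calc ∫ x in B, ‖ψ x‖ ^ 2
        ≤ ∫ x in B, (2 * ‖ψ x - mollify φ ψ x‖ ^ 2 + 2 * ‖mollify φ ψ x‖ ^ 2) := by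
          refine setIntegral_mono_on hIψ.integrableOn
            ((hId.const_mul 2).integrableOn.add (hIm.const_mul 2).integrableOn) hB fun x _ => ?_
          have h4 : ‖ψ x‖ ≤ ‖ψ x - mollify φ ψ x‖ + ‖mollify φ ψ x‖ := by
            simpa using norm_add_le (ψ x - mollify φ ψ x) (mollify φ ψ x)
          have h5 := pow_le_pow_left₀ (norm_nonneg _) h4 2
          nlinarith [sq_nonneg (‖ψ x - mollify φ ψ x‖ - ‖mollify φ ψ x‖)]
      _ = 2 * (∫ x in B, ‖ψ x - mollify φ ψ x‖ ^ 2) + 2 * ∫ x in B, ‖mollify φ ψ x‖ ^ 2 := by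
          rw [integral_add (hId.const_mul 2).integrableOn (hIm.const_mul 2).integrableOn,
            integral_const_mul, integral_const_mul]
      _ ≤ _ := add_le_add (mul_le_mul_of_nonneg_left (setIntegral_le_integral hId
          (Eventually.of_forall fun t => sq_nonneg _)) zero_le_two) le_rfl
  have hmol := integral_sub_mollify_le b φ hψ hc
  change _ ≤ h ^ 2 * G at hmol
  -- Three errors remain: mollification, mesh of the net, and the exterior of the ball. Each is at
  -- most a quarter of `ε` times a part of the form.
  have e1 : 2 * (h ^ 2 * G) ≤ ε / 4 * κ * G := by nlinarith
  have e2 : 4 * v * ((L * η) ^ 2 * v) * I ≤ ε / 4 * P :=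
    (mul_le_mul_of_nonneg_right hηε hI0).trans (mul_le_mul_of_nonneg_left hIP (by positivity))
  have e3 : 0 ≤ ε * (κ * G) := by positivity
  have e4 : 0 ≤ ε * P := mul_nonneg hε.le (hI0.trans hIP)
  nlinarith

theorem mem_coreGraph {V : E → ℝ} (hV : Continuous V) {ψ : E → ℂ} (hψ : ContDiff ℝ ∞ ψ)
    (hc : HasCompactSupport ψ) :
    ∃ f : (coreOperator V).domain, ((f : L2 E) =ᵐ[volume] ψ) ∧
      (coreOperator V f =ᵐ[volume] expr V ψ) := by
  have h1 : MemLp ψ 2 (volume : Measure E) := hψ.continuous.memLp_of_hasCompactSupport hc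
  have h2 : MemLp (expr V ψ) 2 (volume : Measure E) :=
    (continuous_expr hV hψ).memLp_of_hasCompactSupport (hasCompactSupport_expr hψ hc)
  have hmem : (h1.toLp, h2.toLp) ∈ (coreOperator V).graph := by
    rw [coreOperator_graph]
    exact ⟨ψ, hψ, hc, h1.coeFn_toLp, h2.coeFn_toLp⟩
  obtain ⟨f, hf, hAf⟩ := (LinearPMap.mem_graph_iff _).1 hmem
  dsimp only at hf hAf
  refine ⟨f, ?_, ?_⟩
  · rw [hf]; exact h1.coeFn_toLp
  · rw [hAf]; exact h2.coeFn_toLp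

theorem exists_rep {V : E → ℝ} (f : (coreOperator V).domain) :
    ∃ ψ : E → ℂ, ContDiff ℝ ∞ ψ ∧ HasCompactSupport ψ ∧ ((f : L2 E) =ᵐ[volume] ψ) ∧
      (coreOperator V f =ᵐ[volume] expr V ψ) := by
  have h := (coreOperator V).mem_graph f
  rw [coreOperator_graph] at h
  exact h

theorem inner_eq_integral {f g : L2 E} {ψ χ : E → ℂ} (hf : f =ᵐ[volume] ψ)
    (hg : g =ᵐ[volume] χ) : inner ℂ f g = ∫ x, (starRingEnd ℂ) (ψ x) * χ x := by
  rw [L2.inner_def]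
  refine integral_congr_ae ?_
  filter_upwards [hf, hg] with x h1 h2
  rw [h1, h2, RCLike.inner_apply, mul_comm]

theorem dense_coreOperator_domain {V : E → ℝ} (hV : Continuous V) :
    Dense ((coreOperator V).domain : Set (L2 E)) := by
  rw [Submodule.dense_iff_topologicalClosure_eq_top, Submodule.topologicalClosure_eq_top_iff,
    Submodule.eq_bot_iff]
  intro u hu
  rw [Lp.eq_zero_iff_ae_eq_zero]
  have hul : LocallyIntegrable u := locallyIntegrable_of_memLp (Lp.memLp u)
  refine ae_eq_zero_of_integral_contDiff_smul_eq_zero hul fun g hg hgc => ?_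
  obtain ⟨f, hf, -⟩ := mem_coreGraph hV (ψ := fun x => (g x : ℂ))
    (Complex.ofRealCLM.contDiff.comp hg) (hgc.comp_left (g := fun r : ℝ => (r : ℂ)) Complex.ofReal_zero)
  have h := (Submodule.mem_orthogonal _ _).1 hu f f.2
  rw [inner_eq_integral hf (EventuallyEq.refl _ (u : E → ℂ))] at h
  simpa only [Complex.conj_ofReal, Complex.real_smul] using h

theorem core_inner_add_smul_eq (b : OrthonormalBasis ι ℝ E) {V : E → ℝ} (hV : Continuous V) (μ : ℝ)
    {f : (coreOperator V).domain} {ψ : E → ℂ} (hψ : ContDiff ℝ ∞ ψ) (hc : HasCompactSupport ψ)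
    (hf : (f : L2 E) =ᵐ[volume] ψ) (hAf : coreOperator V f =ᵐ[volume] expr V ψ) :
    (inner ℂ (f : L2 E) (coreOperator V f + (μ : ℂ) • (f : L2 E))).re
      = energy b V ψ + μ * ∫ x, ‖ψ x‖ ^ 2 := by
  rw [IsCompactResolvent.re_inner_add_smul, inner_eq_integral hf hAf,
    re_integral_conj_mul_expr b hV hψ hc, norm_sq_eq_integral hf]

theorem energy_add_const (b : OrthonormalBasis ι ℝ E) {V : E → ℝ} (hV : Continuous V) (μ : ℝ)
    {ψ : E → ℂ} (hψ : ContDiff ℝ ∞ ψ) (hc : HasCompactSupport ψ) :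
    energy b (fun x => V x + μ) ψ = energy b V ψ + μ * ∫ x, ‖ψ x‖ ^ 2 := by
  have hVμ : Continuous fun x => V x + μ := by fun_prop
  rw [energy_eq b hVμ hψ hc, energy_eq b hV hψ hc, add_assoc, ← integral_const_mul,
    ← integral_add (integrable_mul_normSq hV hψ.continuous hc)
      ((integrable_normSq hψ.continuous hc).const_mul μ)]
  simp_rw [add_mul]

/-- A Schrödinger operator whose quadratic form dominates that of `-κ Δ + W` for a confining
weight `W` has compact resolvent. -/
theorem exists_isCompactResolvent_schrodinger (b : OrthonormalBasis ι ℝ E) {V W : E → ℝ}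
    (hV : Continuous V) (hW : Continuous W) (hWlim : Tendsto W (cocompact E) atTop) {κ : ℝ}
    (hκ : 0 < κ)
    (hVW : ∀ ψ : E → ℂ, ContDiff ℝ ∞ ψ → HasCompactSupport ψ →
      ∫ x, (κ * gradSq b ψ x + W x * ‖ψ x‖ ^ 2) ≤ energy b V ψ) :
    ∃ (μ : ℝ) (R : L2 E →L[ℂ] L2 E), IsCompactResolvent (schrodinger V) μ R := by
  obtain ⟨x₀, hx₀⟩ := hW.exists_forall_le hWlim
  -- A continuous function tending to infinity attains its minimum; this shift makes `W + μ ≥ 1`.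
  set μ : ℝ := 1 - W x₀ with hμ
  have hWμ : Continuous fun x => W x + μ := by fun_prop
  have hVμ : Continuous fun x => V x + μ := by fun_prop
  have hW1 : ∀ x, 1 ≤ W x + μ := fun x => by have := hx₀ x; linarith
  have hWμlim : Tendsto (fun x => W x + μ) (cocompact E) atTop :=
    tendsto_atTop_add_const_right _ _ hWlim
  have hdom : ∀ ψ : E → ℂ, ContDiff ℝ ∞ ψ → HasCompactSupport ψ →
      ∫ x, (κ * gradSq b ψ x + (W x + μ) * ‖ψ x‖ ^ 2) ≤ energy b (fun x => V x + μ) ψ := by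
    intro ψ hψ hc
    rw [energy_add_const b hV μ hψ hc]
    refine le_trans (le_of_eq ?_) (add_le_add_left (hVW ψ hψ hc) _)
    have hI1 : Integrable fun x => κ * gradSq b ψ x + W x * ‖ψ x‖ ^ 2 :=
      ((integrable_gradSq b hψ hc).const_mul κ).add (integrable_mul_normSq hW hψ.continuous hc)
    rw [← integral_const_mul, ← integral_add hI1
      ((integrable_normSq hψ.continuous hc).const_mul μ)]
    refine integral_congr_ae (Eventually.of_forall fun x => ?_)
    dsimp only; ring
  have hlow : ∀ ψ : E → ℂ, ContDiff ℝ ∞ ψ → HasCompactSupport ψ →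
      ∫ x, ‖ψ x‖ ^ 2 ≤ energy b (fun x => V x + μ) ψ := by
    intro ψ hψ hc
    refine le_trans ?_ (hdom ψ hψ hc)
    refine integral_mono (integrable_normSq hψ.continuous hc)
      (((integrable_gradSq b hψ hc).const_mul κ).add
        (integrable_mul_normSq hWμ hψ.continuous hc)) fun x => ?_
    have h1 := mul_nonneg hκ.le (gradSq_nonneg b ψ x)
    have h2 := le_mul_of_one_le_left (sq_nonneg ‖ψ x‖) (hW1 x)
    change _ ≤ κ * gradSq b ψ x + (W x + μ) * ‖ψ x‖ ^ 2
    linarith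
  refine ⟨μ, exists_isCompactResolvent (dense_coreOperator_domain hV) ?_ ?_ ?_ ?_⟩
  · intro f g
    obtain ⟨ψ, hψ, hc, hf, hAf⟩ := exists_rep f
    obtain ⟨χ, hχ, hcχ, hg, hAg⟩ := exists_rep g
    rw [inner_eq_integral hAf hg, inner_eq_integral hf hAg,
      integral_conj_mul_expr_symm hV hψ hc hχ hcχ]
  · intro f
    obtain ⟨ψ, hψ, hc, hf, hAf⟩ := exists_rep f
    rw [core_inner_add_smul_eq b hV μ hψ hc hf hAf, norm_sq_eq_integral hf,
      ← energy_add_const b hV μ hψ hc]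
    exact hlow ψ hψ hc
  -- A vector orthogonal to the range of the shifted core operator is exactly a weak solution.
  · intro u hu
    rw [Lp.eq_zero_iff_ae_eq_zero]
    refine ae_eq_zero_of_weak_solution b hVμ hlow (Lp.memLp u) fun ψ hψ hc => ?_
    obtain ⟨f, hf, hAf⟩ := mem_coreGraph hV hψ hc
    have h := hu f
    have hsum : (coreOperator V f + (μ : ℂ) • (f : L2 E) : L2 E) =ᵐ[volume]
        expr (fun x => V x + μ) ψ := by
      filter_upwards [Lp.coeFn_add (coreOperator V f) ((μ : ℂ) • (f : L2 E)),
        Lp.coeFn_smul (μ : ℂ) (f : L2 E), hf, hAf] with x h1 h2 h3 h4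
      rw [h1, Pi.add_apply, h2, Pi.smul_apply, h3, h4, expr, expr, smul_eq_mul]
      push_cast; ring
    rw [inner_eq_integral (EventuallyEq.refl _ (u : E → ℂ)) hsum] at h
    exact h
  · intro ε hε
    obtain ⟨N, T, hT⟩ := exists_functional_norm_sq_le b hWμ hW1 hWμlim hκ hε
    refine ⟨N, T, fun f => ?_⟩
    obtain ⟨ψ, hψ, hc, hf, hAf⟩ := exists_rep f
    rw [core_inner_add_smul_eq b hV μ hψ hc hf hAf, ← energy_add_const b hV μ hψ hc]
    refine (hT f ψ hψ hc hf).trans ?_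
    gcongr
    exact hdom ψ hψ hc

/-- A lower bound of the operator bounds its quadratic form. -/
theorem mul_integral_le_energy (b : OrthonormalBasis ι ℝ E) {V : E → ℝ} (hV : Continuous V) {c : ℝ}
    (h : IsBoundedBelowBy (schrodinger V) c) {ψ : E → ℂ} (hψ : ContDiff ℝ ∞ ψ)
    (hc : HasCompactSupport ψ) : c * ∫ x, ‖ψ x‖ ^ 2 ≤ energy b V ψ := by
  obtain ⟨f, hf, hAf⟩ := mem_coreGraph hV hψ hc
  have hle := (coreOperator V).le_closure
  have h1 := h ⟨f, hle.1 f.2⟩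
  have h2 : schrodinger V ⟨f, hle.1 f.2⟩ = coreOperator V f := (hle.2 rfl).symm
  rw [h2] at h1
  rwa [norm_sq_eq_integral hf, inner_eq_integral hf hAf,
    re_integral_conj_mul_expr b hV hψ hc] at h1

end General

/-! ### The one-dimensional oscillator and its scaling. -/

section Oscillator

theorem continuous_abs_rpow {p : ℝ} (hp : 0 < p) : Continuous fun t : ℝ => |t| ^ p :=
  continuous_abs.rpow_const fun _ => Or.inr hp.le

theorem gradSq_real (ψ : ℝ → ℂ) (t : ℝ) :
    gradSq (OrthonormalBasis.singleton (Fin 1) ℝ) ψ t = ‖deriv ψ t‖ ^ 2 := by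
  simp [gradSq]

/-- On the zero space there would be no eigenvalue, so this is needed for `γ_p` to be attained. -/
theorem nontrivial_L2_real : Nontrivial (L2 ℝ) := by
  refine ⟨⟨indicatorConstLp 2 (measurableSet_Icc (a := (0 : ℝ)) (b := 1)) (by simp) (1 : ℂ), 0,
    fun h => ?_⟩⟩
  have := congrArg norm h
  rw [norm_indicatorConstLp (by norm_num) (by norm_num)] at this
  simp [Measure.real] at this

/-- The ground state energy of the oscillator is its least eigenvalue and satisfies the variational
inequality. -/
theorem groundEnergy_spec {p : ℝ} (hp : 0 < p) :
    IsLeast {μ : ℝ | IsEigenvalue (oscillator p) (μ : ℂ)} (groundEnergy p) ∧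
      ∀ g : ℝ → ℂ, ContDiff ℝ ∞ g → HasCompactSupport g →
        groundEnergy p * ∫ t, ‖g t‖ ^ 2 ≤ ∫ t, (‖deriv g t‖ ^ 2 + |t| ^ p * ‖g t‖ ^ 2) := by
  have hV := continuous_abs_rpow hp
  have hlim : Tendsto (fun t : ℝ => |t| ^ p) (cocompact ℝ) atTop :=
    (tendsto_rpow_atTop hp).comp tendsto_norm_cocompact_atTop
  obtain ⟨μ, R, h⟩ := exists_isCompactResolvent_schrodinger
    (OrthonormalBasis.singleton (Fin 1) ℝ) hV hV hlim one_pos fun ψ _ _ => by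
      simp only [one_mul, energy]; exact le_rfl
  have := nontrivial_L2_real
  obtain ⟨h1, h2⟩ := h.isLeast_eigenvalue
  have hg : groundEnergy p = ‖R‖⁻¹ - μ := h1.csInf_eq
  rw [hg]
  refine ⟨h1, fun g hgs hgc => ?_⟩
  have := mul_integral_le_energy (OrthonormalBasis.singleton (Fin 1) ℝ) hV h2 hgs hgc
  simpa only [energy, gradSq_real] using this

/-- The variational inequality for the rescaled oscillator `-d²/dt² + |s t|^p`. -/
theorem groundEnergy_scaled {p : ℝ} (hp : 0 < p) {g : ℝ → ℂ} (hg : ContDiff ℝ ∞ g)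
    (hc : HasCompactSupport g) (s : ℝ) :
    groundEnergy p * (s ^ 2) ^ (p / (p + 2)) * ∫ t, ‖g t‖ ^ 2
      ≤ ∫ t, (‖deriv g t‖ ^ 2 + |s * t| ^ p * ‖g t‖ ^ 2) := by
  have hp2 : 0 < p + 2 := by linarith
  -- At `s = 0` the constant is `0 ^ a = 0`, and only positivity of the energy is needed.
  rcases eq_or_ne s 0 with rfl | hs
  · rw [zero_pow two_ne_zero, Real.zero_rpow (by positivity), mul_zero, zero_mul]
    refine integral_nonneg fun t => ?_
    positivity
  set a := p / (p + 2) with ha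
  have hs' : 0 < |s| := abs_pos.2 hs
  -- This length balances the two terms under `t = k u`: since `a (p + 2) = p`, one has `k⁻¹ ^ (2 +
  -- p) = |s| ^ p`, so both acquire the factor `k⁻¹ ^ 2 = (s ^ 2) ^ a`.
  set k : ℝ := |s| ^ (-a) with hk
  have hk0 : 0 < k := Real.rpow_pos_of_pos hs' _
  have hh : ContDiff ℝ ∞ fun u => g (k * u) := hg.comp (contDiff_const.mul contDiff_id)
  have hhc : HasCompactSupport fun u => g (k * u) := by
    simpa only [smul_eq_mul] using! hc.comp_smul hk0.ne'
  have h1 := (groundEnergy_spec hp).2 _ hh hhc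
  have hd : ∀ u, deriv (fun u => g (k * u)) u = (k : ℂ) * deriv g (k * u) := by
    intro u
    rw [deriv_comp_mul_left k g u, Complex.real_smul]
  have hF : ∀ u, ‖deriv (fun u => g (k * u)) u‖ ^ 2 + |u| ^ p * ‖g (k * u)‖ ^ 2
      = (fun t => k ^ 2 * ‖deriv g t‖ ^ 2 + |k⁻¹ * t| ^ p * ‖g t‖ ^ 2) (k * u) := by
    intro u
    dsimp only
    rw [hd, norm_mul, Complex.norm_real, Real.norm_of_nonneg hk0.le, mul_pow,
      inv_mul_cancel_left₀ hk0.ne']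
  simp_rw [hF] at h1
  rw [Measure.integral_comp_mul_left (fun t => ‖g t‖ ^ 2),
    Measure.integral_comp_mul_left
      (fun t => k ^ 2 * ‖deriv g t‖ ^ 2 + |k⁻¹ * t| ^ p * ‖g t‖ ^ 2), smul_eq_mul, smul_eq_mul,
    mul_left_comm] at h1
  have hki : 0 < |k⁻¹| := abs_pos.2 (inv_ne_zero hk0.ne')
  have h2 := le_of_mul_le_mul_left h1 hki
  have hkinv : k⁻¹ = |s| ^ a := by rw [hk, Real.rpow_neg hs'.le, inv_inv]
  have hk2 : (s ^ 2) ^ a = k⁻¹ ^ 2 := by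
    rw [hkinv, ← sq_abs s, ← Real.rpow_natCast, ← Real.rpow_natCast, ← Real.rpow_mul hs'.le,
      ← Real.rpow_mul hs'.le, mul_comm]
  have hkp : k⁻¹ ^ 2 * k⁻¹ ^ p = |s| ^ p := by
    rw [hkinv, ← Real.rpow_natCast, ← Real.rpow_mul hs'.le, ← Real.rpow_mul hs'.le,
      ← Real.rpow_add hs']
    congr 1
    rw [ha]; field_simp; push_cast; ring
  have h3 := mul_le_mul_of_nonneg_left h2 (sq_nonneg k⁻¹)
  rw [hk2]
  refine le_trans (le_of_eq (by ring)) (h3.trans (le_of_eq ?_))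
  rw [← integral_const_mul]
  refine integral_congr_ae (Eventually.of_forall fun t => ?_)
  dsimp only
  rw [abs_mul, abs_mul, Real.mul_rpow (abs_nonneg _) (abs_nonneg _),
    Real.mul_rpow (abs_nonneg _) (abs_nonneg _), abs_of_pos (inv_pos.2 hk0), ← hkp]
  have : k⁻¹ ^ 2 * k ^ 2 = 1 := by field_simp
  linear_combination (‖deriv g t‖ ^ 2) * this

end Oscillator

/-! ### Slicing the plane along the coordinate directions. -/

section Plane

/-- The plane. -/
abbrev Plane : Type := EuclideanSpace ℝ (Fin 2)

/-- Iterated integration over the plane is bounded below by bounds on slices. -/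
theorem integral_plane_mono {F G : Plane → ℝ} (hF : Integrable F) (hG : Integrable G)
    (h : ∀ x : ℝ, ∫ y, F !₂[x, y] ≤ ∫ y, G !₂[x, y]) : ∫ v, F v ≤ ∫ v, G v := by
  let e : ℝ × ℝ ≃ᵐ Plane := MeasurableEquiv.finTwoArrow.symm.trans
    (MeasurableEquiv.toLp 2 (Fin 2 → ℝ))
  have he : MeasurePreserving e volume volume :=
    (PiLp.volume_preserving_toLp (Fin 2)).comp ((volume_preserving_finTwoArrow ℝ).symm _)
  have hFe : Integrable (fun z : ℝ × ℝ => F (e z)) :=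
    (he.integrable_comp_emb e.measurableEmbedding).2 hF
  have hGe : Integrable (fun z : ℝ × ℝ => G (e z)) :=
    (he.integrable_comp_emb e.measurableEmbedding).2 hG
  rw [← he.integral_comp' F, ← he.integral_comp' G, Measure.volume_eq_prod,
    integral_prod _ hFe, integral_prod _ hGe]
  exact integral_mono hFe.integral_prod_left hGe.integral_prod_left h

theorem integral_plane_mono_swap {F G : Plane → ℝ} (hF : Integrable F) (hG : Integrable G)
    (h : ∀ y : ℝ, ∫ x, F !₂[x, y] ≤ ∫ x, G !₂[x, y]) : ∫ v, F v ≤ ∫ v, G v := by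
  let e : ℝ × ℝ ≃ᵐ Plane := MeasurableEquiv.finTwoArrow.symm.trans
    (MeasurableEquiv.toLp 2 (Fin 2 → ℝ))
  have he : MeasurePreserving e volume volume :=
    (PiLp.volume_preserving_toLp (Fin 2)).comp ((volume_preserving_finTwoArrow ℝ).symm _)
  have hFe : Integrable (fun z : ℝ × ℝ => F (e z)) :=
    (he.integrable_comp_emb e.measurableEmbedding).2 hF
  have hGe : Integrable (fun z : ℝ × ℝ => G (e z)) :=
    (he.integrable_comp_emb e.measurableEmbedding).2 hG
  rw [← he.integral_comp' F, ← he.integral_comp' G, Measure.volume_eq_prod,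
    integral_prod_symm _ hFe, integral_prod_symm _ hGe]
  exact integral_mono hFe.integral_prod_right hGe.integral_prod_right h

/-- As `e` is a unit vector, `t ↦ w + t e` is an isometry, hence a closed embedding, and compact
support is inherited by the slice. -/
theorem slice_spec {E : Type*} [NormedAddCommGroup E] [InnerProductSpace ℝ E] {ψ : E → ℂ}
    (hψ : ContDiff ℝ ∞ ψ) (hc : HasCompactSupport ψ) (w : E) {e : E} (he : ‖e‖ = 1) :
    ContDiff ℝ ∞ (fun t : ℝ => ψ (w + t • e)) ∧ HasCompactSupport (fun t : ℝ => ψ (w + t • e)) ∧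
      ∀ t, deriv (fun t : ℝ => ψ (w + t • e)) t = fderiv ℝ ψ (w + t • e) e := by
  refine ⟨hψ.comp (by fun_prop), ?_, fun t => ?_⟩
  · refine hc.comp_isClosedEmbedding (g := fun t : ℝ => w + t • e) (Isometry.isClosedEmbedding ?_)
    refine Isometry.of_dist_eq fun s t => ?_
    rw [dist_add_left, dist_eq_norm, ← sub_smul, norm_smul, he, mul_one, ← dist_eq_norm]
  · have h1 := ((hψ.differentiable (by simp)) (w + t • e)).hasFDerivAt
    have h2 : HasDerivAt (fun t : ℝ => w + t • e) e t := by
      simpa using ((hasDerivAt_id t).smul_const e).const_add w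
    exact (h1.comp_hasDerivAt t h2).deriv

/-- The standard orthonormal basis of the plane. -/
abbrev planeBasis : OrthonormalBasis (Fin 2) ℝ Plane := EuclideanSpace.basisFun (Fin 2) ℝ

theorem plane_eq_slice_one (x y : ℝ) : (!₂[x, y] : Plane) = !₂[x, 0] + y • planeBasis 1 := by
  ext i; fin_cases i <;> simp

theorem plane_eq_slice_zero (x y : ℝ) : (!₂[x, y] : Plane) = !₂[0, y] + x • planeBasis 0 := by
  ext i; fin_cases i <;> simp

theorem continuous_channel {p : ℝ} (hp : 0 < p) :
    Continuous fun v : Plane => |v 0 * v 1| ^ p :=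
  (continuous_abs_rpow hp).comp (by fun_prop)

theorem continuous_coord_rpow {a : ℝ} (ha : 0 ≤ a) (j : Fin 2) :
    Continuous fun v : Plane => ((v j) ^ 2) ^ a :=
  Continuous.rpow_const (by fun_prop) fun _ => Or.inr ha

/-- The transversal energy in a channel. -/
theorem channel_energy_one {p : ℝ} (hp : 0 < p) {ψ : Plane → ℂ} (hψ : ContDiff ℝ ∞ ψ)
    (hc : HasCompactSupport ψ) :
    ∫ v, groundEnergy p * ((v 0) ^ 2) ^ (p / (p + 2)) * ‖ψ v‖ ^ 2
      ≤ ∫ v, (‖fderiv ℝ ψ v (planeBasis 1)‖ ^ 2 + |v 0 * v 1| ^ p * ‖ψ v‖ ^ 2) := by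
  have ha : 0 ≤ p / (p + 2) := by positivity
  refine integral_plane_mono ?_ ?_ fun x => ?_
  · exact integrable_mul_normSq (continuous_const.mul (continuous_coord_rpow ha 0)) hψ.continuous hc
  · exact (integrable_normSq (contDiff_fderiv_apply hψ _).continuous
      (hasCompactSupport_fderiv_apply hc _)).add
      (integrable_mul_normSq (continuous_channel hp) hψ.continuous hc)
  · obtain ⟨h1, h2, h3⟩ := slice_spec hψ hc !₂[x, 0]
      (show ‖planeBasis 1‖ = 1 from planeBasis.norm_eq_one 1)
    have := groundEnergy_scaled hp h1 h2 x
    rw [← integral_const_mul] at this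
    simp_rw [h3, ← plane_eq_slice_one] at this
    simpa using this

theorem channel_energy_zero {p : ℝ} (hp : 0 < p) {ψ : Plane → ℂ} (hψ : ContDiff ℝ ∞ ψ)
    (hc : HasCompactSupport ψ) :
    ∫ v, groundEnergy p * ((v 1) ^ 2) ^ (p / (p + 2)) * ‖ψ v‖ ^ 2
      ≤ ∫ v, (‖fderiv ℝ ψ v (planeBasis 0)‖ ^ 2 + |v 0 * v 1| ^ p * ‖ψ v‖ ^ 2) := by
  have ha : 0 ≤ p / (p + 2) := by positivity
  refine integral_plane_mono_swap ?_ ?_ fun y => ?_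
  · exact integrable_mul_normSq (continuous_const.mul (continuous_coord_rpow ha 1)) hψ.continuous hc
  · exact (integrable_normSq (contDiff_fderiv_apply hψ _).continuous
      (hasCompactSupport_fderiv_apply hc _)).add
      (integrable_mul_normSq (continuous_channel hp) hψ.continuous hc)
  · obtain ⟨h1, h2, h3⟩ := slice_spec hψ hc !₂[0, y]
      (show ‖planeBasis 0‖ = 1 from planeBasis.norm_eq_one 0)
    have := groundEnergy_scaled hp h1 h2 y
    rw [← integral_const_mul] at this
    simp_rw [h3, ← plane_eq_slice_zero] at this
    simpa [mul_comm y] using this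

end Plane

/-! ### IMS localisation by a smooth angle. -/

section Localization

variable {E : Type*} [NormedAddCommGroup E] [InnerProductSpace ℝ E] [FiniteDimensional ℝ E]
  [MeasurableSpace E] [BorelSpace E] {ι : Type*} [Fintype ι]

theorem contDiff_cos_comp {θ : E → ℝ} (hθ : ContDiff ℝ ∞ θ) :
    ContDiff ℝ ∞ fun x => Real.cos (θ x) := Real.contDiff_cos.comp hθ

theorem contDiff_sin_comp {θ : E → ℝ} (hθ : ContDiff ℝ ∞ θ) :
    ContDiff ℝ ∞ fun x => Real.sin (θ x) := Real.contDiff_sin.comp hθ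

theorem norm_sq_rotation (c s d : ℝ) (hcs : c ^ 2 + s ^ 2 = 1) (w w' : ℂ) :
    ‖(c : ℂ) * w' + ((-s * d : ℝ) : ℂ) * w‖ ^ 2 + ‖(s : ℂ) * w' + ((c * d : ℝ) : ℂ) * w‖ ^ 2
      = ‖w'‖ ^ 2 + d ^ 2 * ‖w‖ ^ 2 := by
  simp only [← Complex.normSq_eq_norm_sq, Complex.normSq_apply, Complex.mul_re, Complex.add_re,
    Complex.add_im, Complex.mul_im, Complex.ofReal_re, Complex.ofReal_im]
  linear_combination (w'.re ^ 2 + w'.im ^ 2 + d ^ 2 * (w.re ^ 2 + w.im ^ 2)) * hcs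

/-- Passing to `(cos θ ψ, sin θ ψ)` is a pointwise rotation: the mixed terms of the two gradients
cancel, leaving `|∇θ|² |ψ|²` as the only error. -/
theorem gradSq_cos_add_gradSq_sin (b : OrthonormalBasis ι ℝ E) {θ : E → ℝ} (hθ : ContDiff ℝ ∞ θ)
    {ψ : E → ℂ} (hψ : ContDiff ℝ ∞ ψ) (x : E) :
    gradSq b (fun y => (Real.cos (θ y) : ℂ) * ψ y) x
      + gradSq b (fun y => (Real.sin (θ y) : ℂ) * ψ y) x
      = gradSq b ψ x + gradSqReal b θ x * ‖ψ x‖ ^ 2 := by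
  have hd := ((hθ.differentiable (by simp)) x).hasFDerivAt
  unfold gradSq gradSqReal
  rw [Finset.sum_mul, ← Finset.sum_add_distrib, ← Finset.sum_add_distrib]
  refine Finset.sum_congr rfl fun i _ => ?_
  have hcd : fderiv ℝ (fun y => Real.cos (θ y)) x (b i)
      = -Real.sin (θ x) * fderiv ℝ θ x (b i) := by
    rw [hd.cos.fderiv]; simp
  have hsd : fderiv ℝ (fun y => Real.sin (θ y)) x (b i)
      = Real.cos (θ x) * fderiv ℝ θ x (b i) := by
    rw [hd.sin.fderiv]; simp
  rw [fderiv_ofReal_mul_apply (contDiff_cos_comp hθ) hψ,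
    fderiv_ofReal_mul_apply (contDiff_sin_comp hθ) hψ, hcd, hsd]
  exact norm_sq_rotation _ _ _ (Real.cos_sq_add_sin_sq _) _ _

/-- The IMS localisation formula for the partition of unity `cos² θ + sin² θ = 1`. -/
theorem energy_ge_localized (b : OrthonormalBasis ι ℝ E) {V : E → ℝ} (hV : Continuous V)
    {θ : E → ℝ} (hθ : ContDiff ℝ ∞ θ) {M : ℝ} (hM : ∀ x, gradSqReal b θ x ≤ M)
    {ψ : E → ℂ} (hψ : ContDiff ℝ ∞ ψ) (hc : HasCompactSupport ψ) :
    energy b V (fun y => (Real.cos (θ y) : ℂ) * ψ y)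
      + energy b V (fun y => (Real.sin (θ y) : ℂ) * ψ y) - M * ∫ x, ‖ψ x‖ ^ 2
      ≤ energy b V ψ := by
  have hcs := contDiff_ofReal_mul (contDiff_cos_comp hθ) hψ
  have hss := contDiff_ofReal_mul (contDiff_sin_comp hθ) hψ
  have hcc := hasCompactSupport_mul_ofReal (fun y => Real.cos (θ y)) hc
  have hsc := hasCompactSupport_mul_ofReal (fun y => Real.sin (θ y)) hc
  have i1 := (integrable_gradSq b hcs hcc).add (integrable_mul_normSq hV hcs.continuous hcc)
  have i2 := (integrable_gradSq b hss hsc).add (integrable_mul_normSq hV hss.continuous hsc)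
  have i3 := (integrable_gradSq b hψ hc).add (integrable_mul_normSq hV hψ.continuous hc)
  have i4 := (integrable_normSq hψ.continuous hc).const_mul M
  rw [sub_le_iff_le_add, ← integral_const_mul]
  calc _ = ∫ x, ((gradSq b (fun y => (Real.cos (θ y) : ℂ) * ψ y) x
          + V x * ‖(Real.cos (θ x) : ℂ) * ψ x‖ ^ 2)
        + (gradSq b (fun y => (Real.sin (θ y) : ℂ) * ψ y) x
          + V x * ‖(Real.sin (θ x) : ℂ) * ψ x‖ ^ 2)) := (integral_add i1 i2).symm
    _ ≤ ∫ x, ((gradSq b ψ x + V x * ‖ψ x‖ ^ 2) + M * ‖ψ x‖ ^ 2) := by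
        refine integral_mono (i1.add i2) (i3.add i4) fun x => ?_
        change (gradSq b (fun y => (Real.cos (θ y) : ℂ) * ψ y) x
            + V x * ‖(Real.cos (θ x) : ℂ) * ψ x‖ ^ 2)
          + (gradSq b (fun y => (Real.sin (θ y) : ℂ) * ψ y) x
            + V x * ‖(Real.sin (θ x) : ℂ) * ψ x‖ ^ 2)
          ≤ (gradSq b ψ x + V x * ‖ψ x‖ ^ 2) + M * ‖ψ x‖ ^ 2
        have h1 := gradSq_cos_add_gradSq_sin b hθ hψ x
        have h2 := mul_le_mul_of_nonneg_right (hM x) (sq_nonneg ‖ψ x‖)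
        simp only [norm_mul, Complex.norm_real, Real.norm_eq_abs, mul_pow, sq_abs]
        have h3 : V x * (Real.cos (θ x) ^ 2 * ‖ψ x‖ ^ 2) + V x * (Real.sin (θ x) ^ 2 * ‖ψ x‖ ^ 2)
            = V x * ‖ψ x‖ ^ 2 := by
          linear_combination (V x * ‖ψ x‖ ^ 2) * Real.cos_sq_add_sin_sq (θ x)
        linarith
    _ = _ := integral_add i3 i4

theorem integral_normSq_cos_add_sin {θ : E → ℝ} (hθ : ContDiff ℝ ∞ θ)
    {ψ : E → ℂ} (hψ : ContDiff ℝ ∞ ψ) (hc : HasCompactSupport ψ) :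
    (∫ x, ‖(Real.cos (θ x) : ℂ) * ψ x‖ ^ 2) + ∫ x, ‖(Real.sin (θ x) : ℂ) * ψ x‖ ^ 2
      = ∫ x, ‖ψ x‖ ^ 2 := by
  rw [← integral_add
    (integrable_normSq (contDiff_ofReal_mul (contDiff_cos_comp hθ) hψ).continuous
      (hasCompactSupport_mul_ofReal _ hc))
    (integrable_normSq (contDiff_ofReal_mul (contDiff_sin_comp hθ) hψ).continuous
      (hasCompactSupport_mul_ofReal _ hc))]
  refine integral_congr_ae (Eventually.of_forall fun x => ?_)
  simp only [norm_mul, Complex.norm_real, Real.norm_eq_abs, mul_pow, sq_abs]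
  linear_combination (‖ψ x‖ ^ 2) * Real.cos_sq_add_sin_sq (θ x)

/-- A lower bound on the potential bounds the energy. -/
theorem energy_ge_of_le_on_support (b : OrthonormalBasis ι ℝ E) {V : E → ℝ} (hV : Continuous V)
    {ψ : E → ℂ} (hψ : ContDiff ℝ ∞ ψ) (hc : HasCompactSupport ψ) {c : ℝ}
    (h : ∀ x, ψ x ≠ 0 → c ≤ V x) : c * ∫ x, ‖ψ x‖ ^ 2 ≤ energy b V ψ := by
  rw [← integral_const_mul]
  refine integral_mono ((integrable_normSq hψ.continuous hc).const_mul c)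
    ((integrable_gradSq b hψ hc).add (integrable_mul_normSq hV hψ.continuous hc)) fun x => ?_
  change c * ‖ψ x‖ ^ 2 ≤ gradSq b ψ x + V x * ‖ψ x‖ ^ 2
  have h1 := gradSq_nonneg b ψ x
  by_cases h0 : ψ x = 0
  · simp [h0, h1]
  · have := mul_le_mul_of_nonneg_right (h x h0) (sq_nonneg ‖ψ x‖)
    linarith

end Localization

/-! ### The angle separating a channel from its complement. -/

section Angle

/-- A smooth angle that is `0` for `t² ≤ 1` and `π / 2` for `t² ≥ 2`. -/
def angle (t : ℝ) : ℝ := Real.pi / 2 * Real.smoothTransition (t ^ 2 - 1)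

theorem contDiff_angle : ContDiff ℝ ∞ angle :=
  contDiff_const.mul ((Real.smoothTransition.contDiff (n := (⊤ : ℕ∞))).comp
    ((contDiff_id.pow 2).sub contDiff_const))

theorem sq_le_two_of_cos_angle_ne_zero {t : ℝ} (h : Real.cos (angle t) ≠ 0) : t ^ 2 ≤ 2 := by
  by_contra hn
  push Not at hn
  apply h
  rw [angle, Real.smoothTransition.one_of_one_le (by linarith), mul_one, Real.cos_pi_div_two]

theorem one_le_sq_of_sin_angle_ne_zero {t : ℝ} (h : Real.sin (angle t) ≠ 0) : 1 ≤ t ^ 2 := by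
  by_contra hn
  push Not at hn
  apply h
  rw [angle, Real.smoothTransition.zero_of_nonpos (by linarith), mul_zero, Real.sin_zero]

/-- The angle is constant for `t² ≥ 2`, so its derivative is continuous with compact support. This
makes the localisation error a constant. -/
theorem exists_deriv_angle_bound : ∃ M, ∀ t, (deriv angle t) ^ 2 ≤ M := by
  have hc : Continuous (deriv angle) := contDiff_angle.continuous_deriv (by simp)
  have hs : HasCompactSupport (deriv angle) := by
    refine HasCompactSupport.intro (isCompact_Icc (a := (-2 : ℝ)) (b := 2)) fun t ht => ?_
    have hopen : IsOpen (Set.Icc (-2 : ℝ) 2)ᶜ := isClosed_Icc.isOpen_compl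
    have heq : angle =ᶠ[𝓝 t] fun _ => Real.pi / 2 := by
      filter_upwards [hopen.mem_nhds ht] with s hs
      have h4 : 2 ≤ s ^ 2 := by
        by_contra hn
        push Not at hn
        exact hs ⟨by nlinarith, by nlinarith⟩
      rw [angle, Real.smoothTransition.one_of_one_le (by linarith), mul_one]
    rw [heq.deriv_eq, deriv_const]
  obtain ⟨M, hM⟩ := hc.bounded_above_of_compact_support hs
  refine ⟨M ^ 2, fun t => ?_⟩
  rw [← sq_abs]
  exact pow_le_pow_left₀ (abs_nonneg _) (hM t) 2

theorem contDiff_angle_coord (j : Fin 2) : ContDiff ℝ ∞ fun v : Plane => angle (v j) :=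
  contDiff_angle.comp (by fun_prop)

theorem gradSqReal_angle_coord (j : Fin 2) (v : Plane) :
    gradSqReal planeBasis (fun v : Plane => angle (v j)) v = (deriv angle (v j)) ^ 2 := by
  have h1 := (((contDiff_angle.differentiable (by simp)) (v j)).hasDerivAt)
  have h2 : HasFDerivAt (fun v : Plane => v j) (EuclideanSpace.proj j : Plane →L[ℝ] ℝ) v :=
    (EuclideanSpace.proj j : Plane →L[ℝ] ℝ).hasFDerivAt
  have h3 := h1.comp_hasFDerivAt v h2
  have h4 : fderiv ℝ (fun v : Plane => angle (v j)) v = _ := h3.fderiv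
  unfold gradSqReal
  rw [h4]
  fin_cases j <;> simp

end Angle

/-! ### The critical form in the plane and the subcritical operator. -/

section PlaneEnergy

/-- The potential `|x y|^p - c (x² + y²)^{p/(p+2)}`. -/
def potential (p c : ℝ) (v : Plane) : ℝ :=
  |v 0 * v 1| ^ p - c * ((v 0) ^ 2 + (v 1) ^ 2) ^ (p / (p + 2))

theorem continuous_radial {a : ℝ} (ha : 0 ≤ a) :
    Continuous fun v : Plane => ((v 0) ^ 2 + (v 1) ^ 2) ^ a :=
  Continuous.rpow_const (by fun_prop) fun _ => Or.inr ha

theorem continuous_potential {p : ℝ} (hp : 0 < p) (c : ℝ) : Continuous (potential p c) :=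
  (continuous_channel hp).sub (continuous_const.mul (continuous_radial (by positivity)))

theorem rpow_add_le {a x y : ℝ} (ha0 : 0 ≤ a) (ha1 : a ≤ 1) (hx : 0 ≤ x) (hy : 0 ≤ y) :
    (x + y) ^ a ≤ x ^ a + y ^ a := by
  have := NNReal.rpow_add_le_add_rpow ⟨x, hx⟩ ⟨y, hy⟩ ha0 ha1
  exact_mod_cast this

theorem gradSq_plane (ψ : Plane → ℂ) (v : Plane) : gradSq planeBasis ψ v
    = ‖fderiv ℝ ψ v (planeBasis 0)‖ ^ 2 + ‖fderiv ℝ ψ v (planeBasis 1)‖ ^ 2 := by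
  simp only [gradSq, Fin.sum_univ_two]

/-- Lower bound for functions supported in a channel along one of the axes. -/
theorem channel_energy_ge {p : ℝ} (hp : 0 < p) (hγ : 0 ≤ groundEnergy p) (j : Fin 2)
    {ψ : Plane → ℂ} (hψ : ContDiff ℝ ∞ ψ) (hc : HasCompactSupport ψ)
    (hs : ∀ v, ψ v ≠ 0 → (v j) ^ 2 ≤ 2) :
    -(groundEnergy p * 2 ^ (p / (p + 2))) * ∫ v, ‖ψ v‖ ^ 2
      ≤ energy planeBasis (potential p (groundEnergy p)) ψ := by
  set γ := groundEnergy p with hγdef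
  set a := p / (p + 2) with ha
  have ha0 : 0 ≤ a := by positivity
  have ha1 : a ≤ 1 := by rw [ha, div_le_one (by linarith)]; linarith
  have iR : Integrable fun v : Plane => γ * ((v 0) ^ 2 + (v 1) ^ 2) ^ a * ‖ψ v‖ ^ 2 :=
    integrable_mul_normSq (continuous_const.mul (continuous_radial ha0)) hψ.continuous hc
  have iX : Integrable fun v : Plane => |v 0 * v 1| ^ p * ‖ψ v‖ ^ 2 :=
    integrable_mul_normSq (continuous_channel hp) hψ.continuous hc
  have iD : ∀ i, Integrable fun v => ‖fderiv ℝ ψ v (planeBasis i)‖ ^ 2 := fun i =>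
    integrable_normSq (contDiff_fderiv_apply hψ _).continuous (hasCompactSupport_fderiv_apply hc _)
  have iC : ∀ i, Integrable fun v : Plane => γ * ((v i) ^ 2) ^ a * ‖ψ v‖ ^ 2 := fun i =>
    integrable_mul_normSq (continuous_const.mul (continuous_coord_rpow ha0 i)) hψ.continuous hc
  have iI := integrable_normSq hψ.continuous hc
  -- the channel estimate transversal to the axis
  have hch : ∃ k l : Fin 2, (∀ v : Plane, (v k) ^ 2 + (v j) ^ 2 = (v 0) ^ 2 + (v 1) ^ 2) ∧
      (∀ v, gradSq planeBasis ψ v = ‖fderiv ℝ ψ v (planeBasis j)‖ ^ 2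
        + ‖fderiv ℝ ψ v (planeBasis l)‖ ^ 2) ∧
      ∫ v, γ * ((v k) ^ 2) ^ a * ‖ψ v‖ ^ 2
        ≤ ∫ v, (‖fderiv ℝ ψ v (planeBasis j)‖ ^ 2 + |v 0 * v 1| ^ p * ‖ψ v‖ ^ 2) := by
    fin_cases j
    · exact ⟨1, 1, fun v => add_comm _ _, fun v => gradSq_plane ψ v,
        channel_energy_zero hp hψ hc⟩
    · exact ⟨0, 0, fun v => rfl, fun v => (gradSq_plane ψ v).trans (add_comm _ _),
        channel_energy_one hp hψ hc⟩
  -- The channel runs along coordinate `k`, with coordinate `j` transversal and bounded. The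
  -- derivative in direction `l` runs along the channel and is dropped as nonnegative.
  obtain ⟨k, l, hkj, hgrad, hch⟩ := hch
  have hpt : ∀ v : Plane, γ * ((v 0) ^ 2 + (v 1) ^ 2) ^ a * ‖ψ v‖ ^ 2
      ≤ γ * ((v k) ^ 2) ^ a * ‖ψ v‖ ^ 2 + γ * 2 ^ a * ‖ψ v‖ ^ 2 := by
    intro v
    by_cases h0 : ψ v = 0
    · simp [h0]
    · rw [← add_mul, ← mul_add, ← hkj]
      -- Since `a ≤ 1`, the power is subadditive: the attractive term splits into the part along the
      -- channel, paid for by the transversal energy, and a part bounded by `2 ^ a`.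
      have h1 := rpow_add_le ha0 ha1 (sq_nonneg (v k)) (sq_nonneg (v j))
      have h2 := Real.rpow_le_rpow (sq_nonneg (v j)) (hs v h0) ha0
      gcongr
      linarith
  have h1 : ∫ v : Plane, γ * ((v 0) ^ 2 + (v 1) ^ 2) ^ a * ‖ψ v‖ ^ 2
      ≤ (∫ v, γ * ((v k) ^ 2) ^ a * ‖ψ v‖ ^ 2) + γ * 2 ^ a * ∫ v, ‖ψ v‖ ^ 2 := by
    rw [← integral_const_mul, ← integral_add (iC k) (iI.const_mul _)]
    exact integral_mono iR ((iC k).add (iI.const_mul _)) hpt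
  have h2 : (∫ v, (‖fderiv ℝ ψ v (planeBasis j)‖ ^ 2 + |v 0 * v 1| ^ p * ‖ψ v‖ ^ 2))
      - ∫ v : Plane, γ * ((v 0) ^ 2 + (v 1) ^ 2) ^ a * ‖ψ v‖ ^ 2
      ≤ energy planeBasis (potential p γ) ψ := by
    have iDX : Integrable fun v : Plane =>
        ‖fderiv ℝ ψ v (planeBasis j)‖ ^ 2 + |v 0 * v 1| ^ p * ‖ψ v‖ ^ 2 := (iD j).add iX
    rw [← integral_sub iDX iR]
    refine integral_mono (iDX.sub iR) ((integrable_gradSq planeBasis hψ hc).add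
      (integrable_mul_normSq (continuous_potential hp γ) hψ.continuous hc)) fun v => ?_
    change ‖fderiv ℝ ψ v (planeBasis j)‖ ^ 2 + |v 0 * v 1| ^ p * ‖ψ v‖ ^ 2
        - γ * ((v 0) ^ 2 + (v 1) ^ 2) ^ a * ‖ψ v‖ ^ 2
      ≤ gradSq planeBasis ψ v + potential p γ v * ‖ψ v‖ ^ 2
    rw [hgrad, potential, ← ha]
    nlinarith [sq_nonneg ‖fderiv ℝ ψ v (planeBasis l)‖]
  linarith

theorem exists_rpow_lower_bound {q a c : ℝ} (ha : 0 ≤ a) (haq : a < q) (hc : 0 ≤ c) :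
    ∃ C, ∀ s : ℝ, 0 ≤ s → c * s ^ a ≤ (s / 2) ^ q + C := by
  -- Beyond this threshold `s ^ (q - a) ≥ c * 2 ^ q`, and the higher power wins; below it `c * S ^
  -- a` is enough.
  set S : ℝ := (c * 2 ^ q) ^ (q - a)⁻¹ with hS
  have hS0 : 0 ≤ S := by positivity
  refine ⟨c * S ^ a, fun s hs => ?_⟩
  rcases le_total s S with h | h
  · have h1 : c * s ^ a ≤ c * S ^ a := by gcongr
    have h2 : 0 ≤ (s / 2) ^ q := by positivity
    linarith
  · have h1 : c * 2 ^ q ≤ s ^ (q - a) := by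
      have := Real.rpow_le_rpow hS0 h (sub_pos.2 haq).le
      rwa [hS, ← Real.rpow_mul (by positivity), inv_mul_cancel₀ (sub_pos.2 haq).ne',
        Real.rpow_one] at this
    have h2 : s ^ q = s ^ (q - a) * s ^ a := by
      rw [← Real.rpow_add_of_nonneg hs (sub_pos.2 haq).le ha, sub_add_cancel]
    have h3 : (s / 2) ^ q = s ^ q / 2 ^ q := Real.div_rpow hs zero_le_two q
    have h4 : c * s ^ a ≤ (s / 2) ^ q := by
      rw [h3, le_div_iff₀ (by positivity), h2]
      have := mul_le_mul_of_nonneg_right h1 (Real.rpow_nonneg hs a)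
      linarith
    have h5 : 0 ≤ c * S ^ a := by positivity
    linarith

/-- Away from the axes the potential is bounded below. -/
theorem exists_potential_lower_bound {p : ℝ} (hp : 0 < p) {c : ℝ} (hc : 0 ≤ c) :
    ∃ C, ∀ v : Plane, 1 ≤ (v 0) ^ 2 → 1 ≤ (v 1) ^ 2 → -C ≤ potential p c v := by
  have haq : p / (p + 2) < p / 2 := by
    apply div_lt_div_of_pos_left hp (by norm_num) (by linarith)
  obtain ⟨C, hC⟩ := exists_rpow_lower_bound (q := p / 2) (a := p / (p + 2)) (by positivity) haq hc
  refine ⟨C, fun v h0 h1 => ?_⟩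
  have h2 := hC ((v 0) ^ 2 + (v 1) ^ 2) (by positivity)
  -- For `X, Y ≥ 1`, `(X - 1)(Y - 1) ≥ 0` gives `X Y ≥ X + Y - 1 ≥ (X + Y) / 2`. So `|xy|^p`
  -- dominates the power `p / 2` of half of `x² + y²`, and `p / 2` exceeds `p / (p + 2)`.
  have h3 : ((v 0) ^ 2 + (v 1) ^ 2) / 2 ≤ |v 0 * v 1| ^ 2 := by
    rw [sq_abs, mul_pow]
    nlinarith
  have h4 : (((v 0) ^ 2 + (v 1) ^ 2) / 2) ^ (p / 2) ≤ |v 0 * v 1| ^ p := by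
    have := Real.rpow_le_rpow (by positivity) h3 (show 0 ≤ p / 2 by positivity)
    have e : (|v 0 * v 1| ^ 2) ^ (p / 2) = |v 0 * v 1| ^ p := by
      rw [← Real.rpow_natCast, ← Real.rpow_mul (abs_nonneg _)]
      congr 1
      push_cast
      ring
    rwa [e] at this
  rw [potential]
  linarith

/-- At the critical coupling the quadratic form is still bounded below. -/
theorem exists_critical_energy_ge {p : ℝ} (hp : 0 < p) (hγ : 0 ≤ groundEnergy p) :
    ∃ C, ∀ ψ : Plane → ℂ, ContDiff ℝ ∞ ψ → HasCompactSupport ψ →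
      -C * ∫ v, ‖ψ v‖ ^ 2 ≤ energy planeBasis (potential p (groundEnergy p)) ψ := by
  obtain ⟨M, hM⟩ := exists_deriv_angle_bound
  have hM0 : 0 ≤ M := (sq_nonneg _).trans (hM 0)
  obtain ⟨C₁, hC₁⟩ := exists_potential_lower_bound hp hγ
  set C₂ := groundEnergy p * 2 ^ (p / (p + 2)) with hC₂
  set C₀ := max C₁ C₂ with hC₀
  -- `C₀` covers the three regions and each of the two localisations costs `M`.
  refine ⟨C₀ + 2 * M, fun ψ hψ hc => ?_⟩
  have hV := continuous_potential hp (groundEnergy p)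
  have hθ := contDiff_angle_coord
  have hgM : ∀ j v, gradSqReal planeBasis (fun v : Plane => angle (v j)) v ≤ M := fun j v => by
    rw [gradSqReal_angle_coord]; exact hM _
  -- localisation in the second, then in the first coordinate
  set χ : Plane → ℂ := fun v => (Real.sin (angle (v 1)) : ℂ) * ψ v with hχdef
  have hχ : ContDiff ℝ ∞ χ := contDiff_ofReal_mul (contDiff_sin_comp (hθ 1)) hψ
  have hχc : HasCompactSupport χ := hasCompactSupport_mul_ofReal _ hc
  have e1 := energy_ge_localized planeBasis hV (hθ 1) (hgM 1) hψ hc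
  have e2 := energy_ge_localized planeBasis hV (hθ 0) (hgM 0) hχ hχc
  have n1 := integral_normSq_cos_add_sin (hθ 1) hψ hc
  have n2 := integral_normSq_cos_add_sin (hθ 0) hχ hχc
  have f1 := channel_energy_ge hp hγ 1 (contDiff_ofReal_mul (contDiff_cos_comp (hθ 1)) hψ)
    (hasCompactSupport_mul_ofReal _ hc) fun v hv => by
      refine sq_le_two_of_cos_angle_ne_zero fun h0 => hv ?_
      simp [h0]
  have f2 := channel_energy_ge hp hγ 0 (contDiff_ofReal_mul (contDiff_cos_comp (hθ 0)) hχ)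
    (hasCompactSupport_mul_ofReal _ hχc) fun v hv => by
      refine sq_le_two_of_cos_angle_ne_zero fun h0 => hv ?_
      simp [h0]
  have f3 := energy_ge_of_le_on_support planeBasis hV
    (contDiff_ofReal_mul (contDiff_sin_comp (hθ 0)) hχ)
    (hasCompactSupport_mul_ofReal _ hχc) (c := -C₁) fun v hv => by
      refine hC₁ v (one_le_sq_of_sin_angle_ne_zero fun h0 => hv ?_)
        (one_le_sq_of_sin_angle_ne_zero fun h0 => hv ?_)
      · simp [h0]
      · simp only [hχdef, h0, Complex.ofReal_zero, zero_mul, mul_zero]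
  rw [← hC₂] at f1 f2
  set A₁ := ∫ v : Plane, ‖(Real.cos (angle (v 1)) : ℂ) * ψ v‖ ^ 2
  set A₂ := ∫ v : Plane, ‖(Real.cos (angle (v 0)) : ℂ) * χ v‖ ^ 2
  set A₃ := ∫ v : Plane, ‖(Real.sin (angle (v 0)) : ℂ) * χ v‖ ^ 2
  have a1 : 0 ≤ A₁ := integral_nonneg fun v => sq_nonneg _
  have a2 : 0 ≤ A₂ := integral_nonneg fun v => sq_nonneg _
  have a3 : 0 ≤ A₃ := integral_nonneg fun v => sq_nonneg _
  change A₁ + ∫ v, ‖χ v‖ ^ 2 = _ at n1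
  change _ + energy planeBasis _ χ - _ ≤ _ at e1
  have g1 : C₂ * A₁ ≤ C₀ * A₁ := mul_le_mul_of_nonneg_right (le_max_right _ _) a1
  have g2 : C₂ * A₂ ≤ C₀ * A₂ := mul_le_mul_of_nonneg_right (le_max_right _ _) a2
  have g3 : C₁ * A₃ ≤ C₀ * A₃ := mul_le_mul_of_nonneg_right (le_max_left _ _) a3
  rw [← n2] at n1 e2
  rw [← n1] at e1 ⊢
  -- The second localisation costs only `M ∫ ‖χ‖²`, which falls short of `M ∫ ‖ψ‖²` by `M * A₁`.
  have g4 : 0 ≤ M * A₁ := mul_nonneg hM0 a1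
  nlinarith

theorem tendsto_radial {a : ℝ} (ha : 0 < a) :
    Tendsto (fun v : Plane => ((v 0) ^ 2 + (v 1) ^ 2) ^ a) (cocompact Plane) atTop := by
  have h1 : ∀ v : Plane, (v 0) ^ 2 + (v 1) ^ 2 = ‖v‖ ^ 2 := fun v => by
    rw [EuclideanSpace.norm_sq_eq]; simp
  simp_rw [h1]
  exact (tendsto_rpow_atTop ha).comp
    ((tendsto_pow_atTop two_ne_zero).comp (tendsto_norm_cocompact_atTop (E := Plane)))

/-- Below the critical coupling the operator has compact resolvent. -/
theorem exists_isCompactResolvent_L {p : ℝ} (hp : 0 < p) {lam : ℝ} (hlam : 0 ≤ lam)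
    (hlt : lam < groundEnergy p) :
    ∃ (μ : ℝ) (R : L2 Plane →L[ℂ] L2 Plane), IsCompactResolvent (L p lam) μ R := by
  set γ := groundEnergy p with hγdef
  have hγ : 0 < γ := hlam.trans_lt hlt
  set a := p / (p + 2) with ha
  have ha0 : 0 < a := by positivity
  obtain ⟨C, hC⟩ := exists_critical_energy_ge hp hγ.le
  rw [← hγdef] at hC
  -- Removing `1 - ε` of the critical form leaves `ε` of the gradient, the nonnegative `ε |xy|^p`,
  -- and `(γ - lam - ε γ)` times the radial power. This `ε` spends half of the gap, leaving the
  -- coefficient `(γ - lam) / 2`.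
  set ε : ℝ := (γ - lam) / (2 * γ) with hε
  have hε0 : 0 < ε := div_pos (by linarith) (by linarith)
  have hεγ : ε * γ = (γ - lam) / 2 := by rw [hε]; field_simp
  have hε1 : 0 ≤ 1 - ε := by
    have : ε ≤ 1 := by rw [hε, div_le_one (by linarith)]; linarith
    linarith
  have hδ : 0 < (γ - lam) / 2 := by linarith
  let W : Plane → ℝ := fun v => (γ - lam) / 2 * ((v 0) ^ 2 + (v 1) ^ 2) ^ a + -((1 - ε) * C)
  have hW : Continuous W := (continuous_const.mul (continuous_radial ha0.le)).add continuous_const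
  have hWlim : Tendsto W (cocompact Plane) atTop :=
    tendsto_atTop_add_const_right _ _ ((tendsto_radial ha0).const_mul_atTop hδ)
  refine exists_isCompactResolvent_schrodinger planeBasis (continuous_potential hp lam) hW hWlim
    hε0 fun ψ hψ hc => ?_
  have hcrit := hC ψ hψ hc
  have iG := integrable_gradSq planeBasis hψ hc
  have iγ := integrable_mul_normSq (continuous_potential hp γ) hψ.continuous hc
  have iI := integrable_normSq hψ.continuous hc
  have hcrit' : (1 - ε) * (-C * ∫ v, ‖ψ v‖ ^ 2)
      ≤ (1 - ε) * energy planeBasis (potential p γ) ψ := mul_le_mul_of_nonneg_left hcrit hε1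
  have iR : Integrable fun v : Plane => ((v 0) ^ 2 + (v 1) ^ 2) ^ a * ‖ψ v‖ ^ 2 :=
    integrable_mul_normSq (continuous_radial ha0.le) hψ.continuous hc
  have iF : Integrable fun v : Plane => ε * gradSq planeBasis ψ v
      + (γ - lam) / 2 * (((v 0) ^ 2 + (v 1) ^ 2) ^ a * ‖ψ v‖ ^ 2) :=
    (iG.const_mul ε).add (iR.const_mul _)
  have hL : ∫ v, (ε * gradSq planeBasis ψ v + W v * ‖ψ v‖ ^ 2)
      = (∫ v : Plane, (ε * gradSq planeBasis ψ v
          + (γ - lam) / 2 * (((v 0) ^ 2 + (v 1) ^ 2) ^ a * ‖ψ v‖ ^ 2)))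
        + (1 - ε) * (-C * ∫ v, ‖ψ v‖ ^ 2) := by
    rw [← integral_const_mul, ← integral_const_mul, ← integral_add iF
      ((iI.const_mul _).const_mul _)]
    refine integral_congr_ae (Eventually.of_forall fun v => ?_)
    simp only [W]; ring
  rw [hL]
  refine (add_le_add le_rfl hcrit').trans ?_
  unfold energy
  have iE : Integrable fun v => gradSq planeBasis ψ v + potential p γ v * ‖ψ v‖ ^ 2 := iG.add iγ
  rw [← integral_const_mul, ← integral_add iF (iE.const_mul _)]
  refine integral_mono (iF.add (iE.const_mul _))
    (iG.add (integrable_mul_normSq (continuous_potential hp lam) hψ.continuous hc)) fun v => ?_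
  change ε * gradSq planeBasis ψ v
        + (γ - lam) / 2 * (((v 0) ^ 2 + (v 1) ^ 2) ^ a * ‖ψ v‖ ^ 2)
      + (1 - ε) * (gradSq planeBasis ψ v + potential p γ v * ‖ψ v‖ ^ 2)
    ≤ gradSq planeBasis ψ v + potential p lam v * ‖ψ v‖ ^ 2
  simp only [potential, ← ha]
  have hX : 0 ≤ ε * (|v 0 * v 1| ^ p * ‖ψ v‖ ^ 2) := by positivity
  set r := ((v 0) ^ 2 + (v 1) ^ 2) ^ a
  have key : ε * γ * (r * ‖ψ v‖ ^ 2) = (γ - lam) / 2 * (r * ‖ψ v‖ ^ 2) := by rw [hεγ]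
  linarith

end PlaneEnergy

end Schrodinger

end

/-- For `p ≥ 1`, the ground-state energy `γ_p` of `-d²/dt² + |t|^p` is attained as its least
eigenvalue, and for `0 ≤ lam < γ_p` the operator `L_p(lam)` is self-adjoint, bounded from below
(so that its spectrum lies in some half-line `[c, ∞)`), and has purely discrete spectrum. -/
theorem theorem2p1 (p : ℝ) (hp : 1 ≤ p) :
    IsLeast {μ : ℝ | Schrodinger.IsEigenvalue (Schrodinger.oscillator p) (μ : ℂ)}
      (Schrodinger.groundEnergy p) ∧
    ∀ lam : ℝ, 0 ≤ lam → lam < Schrodinger.groundEnergy p →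
      IsSelfAdjoint (Schrodinger.L p lam) ∧
      (∃ c : ℝ, Schrodinger.IsBoundedBelowBy (Schrodinger.L p lam) c ∧
        Schrodinger.spectrum (Schrodinger.L p lam) ⊆ (fun x : ℝ => (x : ℂ)) '' Set.Ici c) ∧
      Schrodinger.HasPurelyDiscreteSpectrum (Schrodinger.L p lam) := by
  have hp0 : 0 < p := zero_lt_one.trans_le hp
  refine ⟨(Schrodinger.groundEnergy_spec hp0).1, fun lam h0 hlt => ?_⟩
  obtain ⟨μ, R, h⟩ := Schrodinger.exists_isCompactResolvent_L hp0 h0 hlt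
  exact ⟨h.isSelfAdjoint, ⟨1 - μ, h.isBoundedBelowBy, h.spectrum_subset⟩,
    h.hasPurelyDiscreteSpectrum⟩
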